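/- For integers $0\le m\le q$, $0\le n\le p$ and $|z|<1$, $p=q$, let $$G^{mn}_{pq}\left(z\,\Big|\begin{array}{c}a_1,\dots,a_p\\ b_1,\dots,b_q\end{array}\right)=\frac1{2\pi i}\int_L\frac{\prod_{j=1}^m\Gamma(b_j-s)\prod_{j=1}^n\Gamma(1-a_j+s)}{\prod_{j=m+1}^q\Gamma(1-b_j+s)\prod_{j=n+1}^p\Gamma(a_j-s)}\,z^s\,ds$$ be the Meijer G-function, where $L$ is a loop that starts and ends at $+\infty$ and encircles the poles of $\Gamma(b_j-s)$, $j\le m$, once in the negative sense and none of the poles of $\Gamma(1-a_j+s)$, $j\le n$. Let ${}_2F_1(a,b;c;\cdot)$ be the principal branch on $\mathbb C\setminus[1,\infty)$ of the Gauss hypergeometric function, and let powers be principal. For a function $f$ of a complex parameter $k$ write $\mathrm{Re}_k f(k)=\tfrac12\big(f(k)+\overline{f(\bar k)}\big)$, which is the ordinary real part of $f(k)$ when $k$ is real. Let $k\in\mathbb C$ with $\mathrm{Re}\,k>-1$, and let $v=e^{ib}$ with $-\pi/2<b<\pi/2$, $b\ne0$. Then the loop integrals below converge absolutely, and $$G^{21}_{33}\left(\frac{(v+v^{-1})^2}{4}\bigg|\begin{array}{ccc}1&\frac{1+k}2&\frac{3-k}2\\1&1&\frac12\end{array}\right)+G^{21}_{33}\left(\frac{(v+v^{-1})^2}{4}\bigg|\begin{array}{ccc}1&\frac{1-k}2&\frac{3+k}2\\1&1&\frac12\end{array}\right)$$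 $$=\frac{(v+v^{-1})^2}{i\pi^{1/2}(v-v^{-1})}\Big\{\frac2\pi\cos\Big(\frac{\pi k}2\Big)\Big[\frac1{k+2}\mathrm{Re}_k A(k,v)-\frac1{k+1}\mathrm{Re}_k B(k,v)\Big]-\frac i2\big(v^k-v^{-k}\big)\Big\},$$ where $$A(k,v)=\frac{2v}{v+v^{-1}}\,{}_2F_1(1,k+2;k+3;iv)-\frac{2v^{-1}}{v+v^{-1}}\,{}_2F_1(1,k+2;k+3;iv^{-1}),$$ $$B(k,v)=\frac{v^{-2}-1}{i(v+v^{-1})}\,{}_2F_1(1,k+1;k+2;iv^{-1})-\frac{v^{2}-1}{i(v+v^{-1})}\,{}_2F_1(1,k+1;k+2;iv).$$ In particular, for real $k>-1$ the identity holds with the ordinary real parts $\mathrm{Re}\,A(k,v)$ and $\mathrm{Re}\,B(k,v)$. For $k=0$, and for every real $b$ with $\sin b\ne0$ and $\cos b\neq 0$, the loop integral converges absolutely and $$G^{21}_{33}\left(\cos^2b\,\bigg|\begin{array}{ccc}1&\frac12&\frac32\\1&1&\frac12\end{array}\right)=\frac2{\pi^{3/2}}\cos b\,\cot b\,\ln\left|\frac{\cos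 b}{1+\sin b}\right|.$$ -/

import Mathlib

open Complex MeasureTheory Set

noncomputable section

/-- The integrand of the Mellin-Barnes integral of `G^{m n}_{p q}(z | a ; b)`. The upper parameters
are `a 0, …, a (p-1)`, the lower ones `b 0, …, b (q-1)`. Since `(Complex.Gamma w)⁻¹ = 0` at the
poles of the Gamma function, the inverses are the entire function `1/Γ`. -/
def meijerIntegrand (m n : ℕ) {p q : ℕ} (a : Fin p → ℂ) (b : Fin q → ℂ) (z s : ℂ) : ℂ :=
  (∏ j : Fin q, if (j : ℕ) < m then Complex.Gamma (b j - s) else (Complex.Gamma (1 - b j + s))⁻¹) *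
  (∏ j : Fin p, if (j : ℕ) < n then Complex.Gamma (1 - a j + s) else (Complex.Gamma (a j - s))⁻¹) *
  z ^ s

/-- Admissible corner data of a rectangular loop: the line `Re s = c` has all poles of
`Γ(b_j - s)`, `j ≤ m`, on its right and all poles of `Γ(1 - a_j + s)`, `j ≤ n`, on its left, and
all these poles lie in the strip `|Im s| < R`. -/
def IsMeijerLoop (m n : ℕ) {p q : ℕ} (a : Fin p → ℂ) (b : Fin q → ℂ) (c R : ℝ) : Prop :=
  0 < R ∧
  (∀ j : Fin q, (j : ℕ) < m → c < (b j).re ∧ |(b j).im| < R) ∧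
  (∀ j : Fin p, (j : ℕ) < n → (a j).re - 1 < c ∧ |(a j).im| < R)

open Classical in
/-- The direction in which the loop goes to infinity: towards `+∞` if `p < q`, or `p = q` and
`|z| < 1`; towards `-∞` otherwise, that is for `p > q`, or `p = q` and `|z| > 1`. (For `p = q` and
`|z| = 1` the function is not defined by a loop integral.) -/
def meijerDirection (p q : ℕ) (z : ℂ) : ℝ :=
  if p < q ∨ (p = q ∧ ‖z‖ < 1) then 1 else -1

/-- `(1 / 2πi) ∫_L f(s) ds`, where for `ε = 1` the loop `L` runs
`+∞ - iR → c - iR → c + iR → +∞ + iR` (encircling what is on the right of `Re s = c` once in the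
negative sense), and for `ε = -1` it runs `-∞ - iR → c - iR → c + iR → -∞ + iR`
(encircling what is on the left once in the positive sense). -/
def loopIntegral (ε : ℝ) (f : ℂ → ℂ) (c R : ℝ) : ℂ :=
  (2 * (Real.pi : ℂ) * I)⁻¹ *
    ((ε : ℂ) * (∫ t : ℝ in Ioi 0, f (((c + ε * t : ℝ) : ℂ) + (R : ℂ) * I)) +
      I * (∫ y : ℝ in (-R)..R, f ((c : ℂ) + (y : ℂ) * I)) -
      (ε : ℂ) * (∫ t : ℝ in Ioi 0, f (((c + ε * t : ℝ) : ℂ) - (R : ℂ) * I)))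

/-- The Meijer G-function `G^{m n}_{p q}(z | a ; b)` as a Mellin-Barnes loop integral, for
parameters whose two families of poles are separated by a vertical line. By Cauchy's theorem the
value does not depend on the admissible loop. -/
def meijerG (m n : ℕ) {p q : ℕ} (a : Fin p → ℂ) (b : Fin q → ℂ) (z : ℂ) : ℂ :=
  open Classical in
  if h : ∃ cR : ℝ × ℝ, IsMeijerLoop m n a b cR.1 cR.2 then
    loopIntegral (meijerDirection p q z) (meijerIntegrand m n a b z) h.choose.1 h.choose.2
  else 0

/-- The loop integral defining `G^{m n}_{p q}(z | a ; b)` makes sense: there are admissible loops,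
and along each of them the integral converges absolutely. -/
def MeijerGConverges (m n : ℕ) {p q : ℕ} (a : Fin p → ℂ) (b : Fin q → ℂ) (z : ℂ) : Prop :=
  (∃ c R : ℝ, IsMeijerLoop m n a b c R) ∧
  ∀ c R : ℝ, IsMeijerLoop m n a b c R →
    IntegrableOn (fun t : ℝ => meijerIntegrand m n a b z
      (((c + meijerDirection p q z * t : ℝ) : ℂ) + (R : ℂ) * I)) (Ioi 0) ∧
    IntegrableOn (fun t : ℝ => meijerIntegrand m n a b z
      (((c + meijerDirection p q z * t : ℝ) : ℂ) - (R : ℂ) * I)) (Ioi 0) ∧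
    IntervalIntegrable (fun y : ℝ => meijerIntegrand m n a b z ((c : ℂ) + (y : ℂ) * I))
      volume (-R) R

/-- `F` is the principal branch of `₂F₁(a, b; c; ·)`: analytic on `ℂ ∖ [1, ∞)` and equal to the
Gauss series on the open unit disc. Such an `F` is unique on the cut plane. -/
def IsPrincipalBranch₂F₁ (a b c : ℂ) (F : ℂ → ℂ) : Prop :=
  AnalyticOnNhd ℂ F {z : ℂ | 1 - z ∈ Complex.slitPlane} ∧
  ∀ z : ℂ, ‖z‖ < 1 → F z = ordinaryHypergeometric a b c z

/-- The principal branch of the Gauss hypergeometric function on `ℂ ∖ [1, ∞)`. -/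
def gauss₂F₁ (a b c z : ℂ) : ℂ :=
  open Classical in
  if h : ∃ F : ℂ → ℂ, IsPrincipalBranch₂F₁ a b c F then h.choose z else 0

/-- The real part with respect to a parameter `k` that is treated as if it were real:
`(f(k) + conj (f (conj k))) / 2`. It is the usual real part of `f k` if `k` is real, and it is
holomorphic in `k` where `f` is. -/
def reParam (f : ℂ → ℂ) (k : ℂ) : ℂ :=
  (f k + (starRingEnd ℂ) (f ((starRingEnd ℂ) k))) / 2

/-- The upper parameters `1, (1+k)/2, (3-k)/2`. -/
def upperParams (k : ℂ) : Fin 3 → ℂ := ![1, (1 + k) / 2, (3 - k) / 2]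

/-- The lower parameters `1, 1, 1/2`. -/
def lowerParams : Fin 3 → ℂ := ![1, 1, 1 / 2]

/-- `2v/(v+v⁻¹) ₂F₁(1, k+2; k+3; iv) - (v → v⁻¹)`. -/
def bracketA (v k : ℂ) : ℂ :=
  2 * v / (v + v⁻¹) * gauss₂F₁ 1 (k + 2) (k + 3) (I * v) -
    2 * v⁻¹ / (v⁻¹ + v) * gauss₂F₁ 1 (k + 2) (k + 3) (I * v⁻¹)

/-- `(v⁻²-1)/(i(v+v⁻¹)) ₂F₁(1, k+1; k+2; iv⁻¹) - (v → v⁻¹)`. -/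
def bracketB (v k : ℂ) : ℂ :=
  ((v⁻¹) ^ 2 - 1) / (I * (v + v⁻¹)) * gauss₂F₁ 1 (k + 1) (k + 2) (I * v⁻¹) -
    (v ^ 2 - 1) / (I * (v⁻¹ + v)) * gauss₂F₁ 1 (k + 1) (k + 2) (I * v)

end

open Filter Topology

/-! Put x = (v + v⁻¹)²/4 = cos² b and L = log(4x), so that e^L < 4. The reciprocal Gamma factors of
the two integrands differ only by linear factors, and these add up to 1 - 2s. Reflection and
duplication then turn the sum into π^(-1/2) β(s) e^(Ls) (sin π(s+k/2) - cos(πk/2)/sin πs), where β =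
`betaKernel k` continues the Beta function B(s+k/2-1/2, 2-2s). This is
`integrand₃₃_add_integrand₃₃`; two kinds of loop integral remain.

The sine splits into exponentials e^(±iπs), which shift L to L ± iπ. For a real exponent the loop
opens to a vertical line, and Mellin inversion of the Beta integral, rewritten through r = t/(1-t)²,
gives the elementary function `betaKernelInv`. At L ± iπ the vertical line no longer suffices,
because the decay e^(-π|Im s|) of β is used up exactly. The loop integral, however, is holomorphic
in the exponent η on the half plane e^(Re η) < 4, so the identity theorem extends the formula
(`loopIntegral_betaKernel`). Its values at L ± iπ produce v^k - v^(-k).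

For the other term, π/sin πs is the Mellin transform of 1/(1+r). Fubini and t = τ² give the real
integral ∫₀¹ τ^k (1-τ²)/((1-τ²)²+4xτ²) dτ, which is `kernelIntegral`
(`loopIntegral_betaKernel_div_sin_eq`, `setIntegral_comp_sq`).

On the right-hand side, ₂F₁(1,a;a+1;u) = a ∫₀¹ t^(a-1)/(1-tu) dt on the cut plane. On |v| = 1
conjugation sends iv to -iv⁻¹, so the parametric real part selects even or odd parts of Euler
integrals. Both brackets reduce to ∫₀¹ t^k/(1-t²u²) dt at u = iv and u = iv⁻¹, and combining the
fractions gives the same `kernelIntegral` (`reParam_bracket_eq`,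
`eulerIntegralSq_sub_eq_kernelIntegral`). For k = 0 the two G-functions coincide and the kernel
integral is a logarithm.

Absolute convergence and independence of the loop come from the functional equation of Γ: the ratio
of the integrand at s+1 to its value at s tends to x < 1 as Re s → ∞. -/

/-! ### Geometric decay and Cauchy's theorem on half strips -/

/-- A bound on the strip c ≤ Re s ≤ N + 1 is carried to the right by unit steps, each gaining a
factor ρ. The constant may depend on Im s, so that decay in the imaginary direction survives the
iteration. -/
theorem norm_le_mul_rpow_of_norm_add_one_le {f : ℂ → ℂ} {S : Set ℝ} {A : ℝ → ℝ} {c N ρ : ℝ}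
    (hρ : 0 < ρ) (hρ1 : ρ ≤ 1) (hcN : c ≤ N)
    (h1 : ∀ s : ℂ, s.im ∈ S → c ≤ s.re → s.re ≤ N + 1 → ‖f s‖ ≤ A s.im)
    (h2 : ∀ s : ℂ, s.im ∈ S → N ≤ s.re → ‖f (s + 1)‖ ≤ ρ * ‖f s‖)
    (s : ℂ) (hs : s.im ∈ S) (hc : c ≤ s.re) : ‖f s‖ ≤ A s.im * ρ ^ (s.re - N - 1) := by
  have base : ∀ s : ℂ, s.im ∈ S → c ≤ s.re → s.re ≤ N + 1 →
      ‖f s‖ ≤ A s.im * ρ ^ (s.re - N - 1) := by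
    intro s hs hc hN
    have hA := h1 s hs hc hN
    have : 1 ≤ ρ ^ (s.re - N - 1) :=
      Real.one_le_rpow_of_pos_of_le_one_of_nonpos hρ hρ1 (by linarith)
    nlinarith [norm_nonneg (f s)]
  have key : ∀ (n : ℕ) (s : ℂ), s.im ∈ S → c ≤ s.re → s.re ≤ N + 1 + n →
      ‖f s‖ ≤ A s.im * ρ ^ (s.re - N - 1) := by
    intro n
    induction n with
    | zero => intro s hs hc hN; exact base s hs hc (by simpa using hN)
    | succ n ih =>
      intro s hs hc hN
      rcases le_or_gt s.re (N + 1) with h | h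
      · exact base s hs hc h
      · have h3 := ih (s - 1) (by simpa using hs) (by simp; linarith)
          (by push_cast at hN; simp; linarith)
        have h4 := h2 (s - 1) (by simpa using hs) (by simp; linarith)
        simp only [sub_add_cancel, sub_re, one_re, sub_im, one_im, sub_zero] at h3 h4
        have h5 : ρ ^ (s.re - N - 1) = ρ * ρ ^ (s.re - 1 - N - 1) := by
          rw [show s.re - N - 1 = 1 + (s.re - 1 - N - 1) by ring, Real.rpow_add hρ, Real.rpow_one]
        rw [h5]
        nlinarith
  obtain ⟨n, hn⟩ := exists_nat_ge (s.re - N - 1)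
  exact key n s hs hc (by linarith)

theorem hasDerivAt_ray (c y t : ℝ) :
    HasDerivAt (fun t : ℝ => ((c + t : ℝ) : ℂ) + (y : ℂ) * I) 1 t := by
  have := ((hasDerivAt_id t).const_add c).ofReal_comp
  simpa using this.add_const ((y : ℂ) * I)

theorem integrableOn_ray {f : ℂ → ℂ} {c y C δ : ℝ} (hδ : 0 < δ)
    (hf : ∀ t : ℝ, 0 ≤ t → ContinuousAt f ((c + t : ℝ) + (y : ℂ) * I))
    (hb : ∀ t : ℝ, 0 ≤ t → ‖f ((c + t : ℝ) + (y : ℂ) * I)‖ ≤ C * Real.exp (-δ * (c + t))) :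
    IntegrableOn (fun t : ℝ => f ((c + t : ℝ) + (y : ℂ) * I)) (Ioi 0) := by
  have h1 : IntegrableOn (fun t : ℝ => C * Real.exp (-δ * c) * Real.exp (-δ * t)) (Ioi 0) :=
    (exp_neg_integrableOn_Ioi 0 hδ).const_mul _
  refine h1.mono' ?_ ?_
  · refine ContinuousOn.aestronglyMeasurable (fun t ht => ?_) measurableSet_Ioi
    exact (ContinuousAt.comp (f := fun t : ℝ => ((c + t : ℝ) : ℂ) + (y : ℂ) * I)
      (hf t (le_of_lt ht)) (hasDerivAt_ray c y t).continuousAt).continuousWithinAt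
  · filter_upwards [ae_restrict_mem measurableSet_Ioi] with t ht
    refine (hb t (le_of_lt ht)).trans_eq ?_
    rw [mul_assoc, ← Real.exp_add]; ring_nf

/-- Cauchy's theorem on the rectangle of width T; the right-hand side of the rectangle vanishes
exponentially as T → ∞. -/
theorem integral_halfStrip {f : ℂ → ℂ} {c y₁ y₂ C δ : ℝ} (hy : y₁ ≤ y₂) (hδ : 0 < δ)
    (hf : ∀ s : ℂ, c ≤ s.re → s.im ∈ Icc y₁ y₂ → DifferentiableAt ℂ f s)
    (hb : ∀ s : ℂ, c ≤ s.re → s.im ∈ Icc y₁ y₂ → ‖f s‖ ≤ C * Real.exp (-δ * s.re)) :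
    (∫ t : ℝ in Ioi 0, f ((c + t : ℝ) + (y₁ : ℂ) * I)) -
      (∫ t : ℝ in Ioi 0, f ((c + t : ℝ) + (y₂ : ℂ) * I)) =
      I * ∫ y : ℝ in y₁..y₂, f ((c : ℂ) + (y : ℂ) * I) := by
  have hint : ∀ y ∈ Icc y₁ y₂,
      IntegrableOn (fun t : ℝ => f ((c + t : ℝ) + (y : ℂ) * I)) (Ioi 0) := by
    intro y hyy
    refine integrableOn_ray (C := C) hδ (fun t ht => (hf _ ?_ ?_).continuousAt) (fun t ht => ?_)
    · simp [ht]
    · simpa using hyy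
    · simpa using hb ((c + t : ℝ) + (y : ℂ) * I) (by simp [ht]) (by simpa using hyy)
  have hrect : ∀ T : ℝ, 0 ≤ T →
      (∫ t : ℝ in 0..T, f ((c + t : ℝ) + (y₁ : ℂ) * I)) -
      (∫ t : ℝ in 0..T, f ((c + t : ℝ) + (y₂ : ℂ) * I)) +
      I * (∫ y : ℝ in y₁..y₂, f ((c + T : ℝ) + (y : ℂ) * I)) =
      I * ∫ y : ℝ in y₁..y₂, f ((c : ℂ) + (y : ℂ) * I) := by
    intro T hT
    have := integral_boundary_rect_eq_zero_of_differentiableOn f (⟨c, y₁⟩ : ℂ) (⟨c + T, y₂⟩ : ℂ) ?_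
    · simp only [smul_eq_mul] at this
      have e : ∀ y : ℝ, (∫ t : ℝ in 0..T, f ((c + t : ℝ) + (y : ℂ) * I)) =
          ∫ x : ℝ in c..(c + T), f ((x : ℂ) + (y : ℂ) * I) := by
        intro y
        have := intervalIntegral.integral_comp_add_left (a := 0) (b := T)
          (fun x : ℝ => f ((x : ℂ) + (y : ℂ) * I)) c
        simpa using this
      rw [e, e]
      linear_combination this
    · intro s hs
      rw [mem_reProdIm, uIcc_of_le (by simpa using hT), uIcc_of_le (by simpa using hy)] at hs
      exact (hf s hs.1.1 hs.2).differentiableWithinAt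
  have hlim1 : ∀ y ∈ Icc y₁ y₂, Tendsto (fun T : ℝ => ∫ t : ℝ in 0..T, f ((c + t : ℝ) + (y : ℂ) * I))
      atTop (𝓝 (∫ t : ℝ in Ioi 0, f ((c + t : ℝ) + (y : ℂ) * I))) := fun y hyy =>
    intervalIntegral_tendsto_integral_Ioi 0 (hint y hyy) tendsto_id
  have hlim2 : Tendsto (fun T : ℝ => I * ∫ y : ℝ in y₁..y₂, f ((c + T : ℝ) + (y : ℂ) * I))
      atTop (𝓝 0) := by
    have hz : Tendsto (fun T : ℝ => C * Real.exp (-δ * (c + T)) * |y₂ - y₁|) atTop (𝓝 0) := by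
      have h1 : Tendsto (fun T : ℝ => -δ * (c + T)) atTop atBot :=
        (tendsto_atTop_add_const_left _ c tendsto_id).const_mul_atTop_of_neg (by linarith)
      simpa using ((Real.tendsto_exp_atBot.comp h1).const_mul C).mul_const |y₂ - y₁|
    refine squeeze_zero_norm' ?_ hz
    filter_upwards [eventually_ge_atTop 0] with T hT
    rw [norm_mul, norm_I, one_mul]
    refine intervalIntegral.norm_integral_le_of_norm_le_const fun y hyy => ?_
    rw [uIoc_of_le hy] at hyy
    simpa using hb ((c + T : ℝ) + (y : ℂ) * I) (by simp [hT]) (by simpa using ⟨hyy.1.le, hyy.2⟩)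
  have hl := ((hlim1 y₁ ⟨le_rfl, hy⟩).sub (hlim1 y₂ ⟨hy, le_rfl⟩)).add hlim2
  rw [add_zero] at hl
  refine tendsto_nhds_unique hl (tendsto_const_nhds.congr' ?_)
  filter_upwards [eventually_ge_atTop 0] with T hT
  exact (hrect T hT).symm

/-! ### Deformation of loops -/

/-- `f` is holomorphic on the half plane `σ < Re s` without the ray `[1, ∞)` and decays
exponentially along horizontal lines, locally uniformly away from the real axis. -/
structure LoopRegular (σ : ℝ) (f : ℂ → ℂ) : Prop where
  differentiableAt : ∀ s : ℂ, σ < s.re → (s.re < 1 ∨ s.im ≠ 0) → DifferentiableAt ℂ f s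
  decay : ∀ c r R : ℝ, σ < c → 0 < r → ∃ C δ : ℝ, 0 < δ ∧ ∀ s : ℂ, c ≤ s.re → r ≤ |s.im| →
    |s.im| ≤ R → ‖f s‖ ≤ C * Real.exp (-δ * s.re)

theorem loopIntegral_one (f : ℂ → ℂ) (c R : ℝ) :
    loopIntegral 1 f c R = (2 * (Real.pi : ℂ) * I)⁻¹ *
    ((∫ t : ℝ in Ioi 0, f ((c + t : ℝ) + (R : ℂ) * I)) +
      I * (∫ y : ℝ in (-R)..R, f ((c : ℂ) + (y : ℂ) * I)) -
      (∫ t : ℝ in Ioi 0, f ((c + t : ℝ) + ((-R : ℝ) : ℂ) * I))) := by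
  simp [loopIntegral, sub_eq_add_neg]

theorem integrable_of_norm_le_exp_neg_abs {g : ℝ → ℂ} {C : ℝ} (hg : Continuous g)
    (hb : ∀ y : ℝ, 1 ≤ |y| → ‖g y‖ ≤ C * Real.exp (-|y|)) : Integrable g := by
  have h1 : IntegrableOn g (Ioi 1) := by
    refine ((exp_neg_integrableOn_Ioi 1 one_pos).const_mul C).mono' hg.aestronglyMeasurable ?_
    filter_upwards [ae_restrict_mem measurableSet_Ioi] with y hy
    have hy1 : (1 : ℝ) < y := hy
    simpa [abs_of_pos (one_pos.trans hy1)] using hb y (hy1.le.trans (le_abs_self y))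
  have h2 : IntegrableOn g (Iic (-1)) := by
    have : IntegrableOn (fun y : ℝ => Real.exp y) (Iic (-1)) := integrableOn_exp_Iic _
    refine (this.const_mul C).mono' hg.aestronglyMeasurable ?_
    filter_upwards [ae_restrict_mem measurableSet_Iic] with y hy
    have hy1 : y ≤ -1 := hy
    have := hb y (by rw [abs_of_neg (by linarith)]; linarith)
    simpa [abs_of_neg (by linarith : y < 0)] using this
  have h3 : IntegrableOn g (Icc (-1) 1) := hg.continuousOn.integrableOn_Icc
  have := (h2.union h3).union h1
  rwa [Iic_union_Icc_eq_Iic (by norm_num), Iic_union_Ioi, integrableOn_univ] at this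

namespace LoopRegular

variable {σ : ℝ} {f : ℂ → ℂ}

theorem integrableOn (hf : LoopRegular σ f) {c y : ℝ} (hc : σ < c) (hy : y ≠ 0) :
    IntegrableOn (fun t : ℝ => f ((c + t : ℝ) + (y : ℂ) * I)) (Ioi 0) := by
  obtain ⟨C, δ, hδ, hb⟩ := hf.decay c |y| |y| hc (abs_pos.2 hy)
  refine integrableOn_ray (C := C) hδ (fun t ht => (hf.differentiableAt _ ?_ ?_).continuousAt)
    (fun t ht => ?_)
  · simp; linarith
  · simp [hy]
  · simpa using hb ((c + t : ℝ) + (y : ℂ) * I) (by simp [ht]) (by simp) (by simp)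

theorem continuous_vertical (hf : LoopRegular σ f) {c : ℝ} (hc : σ < c) (hc1 : c < 1) :
    Continuous (fun y : ℝ => f ((c : ℂ) + (y : ℂ) * I)) := by
  rw [continuous_iff_continuousAt]
  intro y
  refine ContinuousAt.comp' (hf.differentiableAt _ ?_ ?_).continuousAt (by fun_prop)
  · simpa using hc
  · simp [hc1]

theorem halfStrip (hf : LoopRegular σ f) {c y₁ y₂ : ℝ} (hc : σ < c) (hy : y₁ ≤ y₂)
    (h0 : 0 < y₁ ∨ y₂ < 0) :
    (∫ t : ℝ in Ioi 0, f ((c + t : ℝ) + (y₁ : ℂ) * I)) -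
      (∫ t : ℝ in Ioi 0, f ((c + t : ℝ) + (y₂ : ℂ) * I)) =
      I * ∫ y : ℝ in y₁..y₂, f ((c : ℂ) + (y : ℂ) * I) := by
  obtain ⟨C, δ, hδ, hb⟩ := hf.decay c (min |y₁| |y₂|) (max |y₁| |y₂|) hc (by
    rcases h0 with h0 | h0
    · exact lt_min (abs_pos.2 h0.ne') (abs_pos.2 (by linarith))
    · exact lt_min (abs_pos.2 (by linarith)) (abs_pos.2 h0.ne))
  refine integral_halfStrip (C := C) hy hδ (fun s hs hi => hf.differentiableAt s (by linarith) ?_)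
    (fun s hs hi => hb s hs ?_ ?_)
  · right
    rcases h0 with h0 | h0
    · linarith [hi.1]
    · exact (by linarith [hi.2] : s.im < 0).ne
  · rcases h0 with h0 | h0
    · exact (min_le_left _ _).trans (abs_le_abs_of_nonneg h0.le hi.1)
    · exact (min_le_right _ _).trans (abs_le_abs_of_nonpos h0.le hi.2)
  · rw [le_max_iff]
    rcases h0 with h0 | h0
    · exact Or.inr (abs_le_abs_of_nonneg (by linarith [hi.1]) hi.2)
    · exact Or.inl (abs_le_abs_of_nonpos (by linarith [hi.2]) hi.1)

/-- The two loops differ by two half strips, one above and one below the real axis; neither meets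
the ray [1, ∞) that may carry poles. -/
theorem loopIntegral_eq_of_le (hf : LoopRegular σ f) {c R R' : ℝ} (hc : σ < c) (hc1 : c < 1)
    (hR : 0 < R) (hR' : R ≤ R') : loopIntegral 1 f c R = loopIntegral 1 f c R' := by
  rw [loopIntegral_one, loopIntegral_one]
  have h1 := hf.halfStrip hc hR' (Or.inl hR)
  have h2 := hf.halfStrip hc (neg_le_neg hR') (Or.inr (neg_neg_of_pos hR))
  have hi := fun a b => (hf.continuous_vertical hc hc1).intervalIntegrable (μ := volume) a b
  have h3 := intervalIntegral.integral_add_adjacent_intervals (hi (-R') (-R)) (hi (-R) R)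
  have h4 := intervalIntegral.integral_add_adjacent_intervals (hi (-R') R) (hi R R')
  rw [← h4, ← h3]
  linear_combination (2 * (Real.pi : ℂ) * I)⁻¹ * (h1 + h2)

/-- The two loops differ by a rectangle lying in Re s < 1, where the integrand is holomorphic. -/
theorem loopIntegral_eq_of_le_left (hf : LoopRegular σ f) {c c' R : ℝ} (hc : σ < c) (hcc : c ≤ c')
    (hc1 : c' < 1) (hR : 0 < R) : loopIntegral 1 f c R = loopIntegral 1 f c' R := by
  rw [loopIntegral_one, loopIntegral_one]
  have h1 : ∀ y : ℝ, y ≠ 0 → (∫ t : ℝ in Ioi 0, f ((c + t : ℝ) + (y : ℂ) * I)) =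
      (∫ x : ℝ in c..c', f ((x : ℂ) + (y : ℂ) * I)) +
      ∫ t : ℝ in Ioi 0, f ((c' + t : ℝ) + (y : ℂ) * I) := by
    intro y hy
    have e : ∀ a : ℝ, ∫ t : ℝ in Ioi 0, f ((a + t : ℝ) + (y : ℂ) * I) =
        ∫ x : ℝ in Ioi a, f ((x : ℝ) + (y : ℂ) * I) := by
      intro a
      have := (measurePreserving_add_left (volume : Measure ℝ) a).setIntegral_preimage_emb
        (measurableEmbedding_addLeft a) (fun x : ℝ => f ((x : ℝ) + (y : ℂ) * I)) (Ioi a)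
      simpa only [preimage_const_add_Ioi, sub_self] using this
    have hi : IntegrableOn (fun x : ℝ => f ((x : ℝ) + (y : ℂ) * I)) (Ioi c) := by
      have := hf.integrableOn hc hy
      have h2 := (measurePreserving_add_left (volume : Measure ℝ) c).integrableOn_comp_preimage
        (measurableEmbedding_addLeft c) (f := fun x : ℝ => f ((x : ℝ) + (y : ℂ) * I)) (s := Ioi c)
      simp only [preimage_const_add_Ioi, sub_self] at h2
      exact h2.1 this
    rw [e, e]
    rw [intervalIntegral.integral_of_le hcc, ← setIntegral_union (Ioc_disjoint_Ioi le_rfl)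
      measurableSet_Ioi (hi.mono_set Ioc_subset_Ioi_self) (hi.mono_set (Ioi_subset_Ioi hcc)),
      Ioc_union_Ioi_eq_Ioi hcc]
  rw [h1 R hR.ne', h1 (-R) (by linarith)]
  have := integral_boundary_rect_eq_zero_of_differentiableOn f (⟨c, -R⟩ : ℂ) (⟨c', R⟩ : ℂ) ?_
  · simp only [smul_eq_mul] at this
    linear_combination -(2 * (Real.pi : ℂ) * I)⁻¹ * this
  · intro s hs
    rw [mem_reProdIm, uIcc_of_le (by simpa using hcc)] at hs
    exact (hf.differentiableAt s (by linarith [hs.1.1])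
      (Or.inl (by linarith [hs.1.2]))).differentiableWithinAt

theorem loopIntegral_eq (hf : LoopRegular σ f) {c c' R R' : ℝ} (hc : σ < c) (hc1 : c < 1)
    (hc' : σ < c') (hc1' : c' < 1) (hR : 0 < R) (hR' : 0 < R') :
    loopIntegral 1 f c R = loopIntegral 1 f c' R' := by
  have h1 : loopIntegral 1 f c R = loopIntegral 1 f c' R := by
    rcases le_total c c' with h | h
    · exact hf.loopIntegral_eq_of_le_left hc h hc1' hR
    · exact (hf.loopIntegral_eq_of_le_left hc' h hc1 hR).symm
  rw [h1]
  rcases le_total R R' with h | h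
  · exact hf.loopIntegral_eq_of_le hc' hc1' hR h
  · exact (hf.loopIntegral_eq_of_le hc' hc1' hR' h).symm

theorem integrable_vertical (hf : LoopRegular σ f) {c C : ℝ} (hc : σ < c) (hc1 : c < 1)
    (hb : ∀ y : ℝ, 1 ≤ |y| → ‖f (c + (y : ℂ) * I)‖ ≤ C * Real.exp (-|y|)) :
    Integrable (fun y : ℝ => f ((c : ℂ) + (y : ℂ) * I)) :=
  integrable_of_norm_le_exp_neg_abs (hf.continuous_vertical hc hc1) hb

/-- The loop integral does not depend on R, so it equals its limit as R → ∞. With decay in |Im s| as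
well, the two rays contribute nothing in the limit and the full vertical line remains. -/
theorem loopIntegral_eq_vertical (hf : LoopRegular σ f) {c R C δ : ℝ} (hc : σ < c) (hc1 : c < 1)
    (hR : 0 < R) (hδ : 0 < δ)
    (hb : ∀ s : ℂ, c ≤ s.re → 1 ≤ |s.im| → ‖f s‖ ≤ C * Real.exp (-δ * s.re) * Real.exp (-|s.im|)) :
    loopIntegral 1 f c R = (2 * (Real.pi : ℂ))⁻¹ * ∫ y : ℝ, f ((c : ℂ) + (y : ℂ) * I) := by
  have hint := hf.integrable_vertical (C := C * Real.exp (-δ * c)) hc hc1 (fun y hy => by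
    simpa using hb (c + (y : ℂ) * I) (by simp) (by simpa using hy))
  have hv : Tendsto (fun R : ℝ => ∫ y : ℝ in (-R)..R, f ((c : ℂ) + (y : ℂ) * I)) atTop
      (𝓝 (∫ y : ℝ, f ((c : ℂ) + (y : ℂ) * I))) :=
    intervalIntegral_tendsto_integral hint tendsto_neg_atTop_atBot tendsto_id
  have hh : ∀ u : ℝ → ℝ, (∀ R, |u R| = |R|) →
      Tendsto (fun R : ℝ => ∫ t : ℝ in Ioi 0, f ((c + t : ℝ) + (u R : ℂ) * I)) atTop (𝓝 0) := by
    intro u hu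
    have hz : Tendsto (fun R : ℝ => (∫ t : ℝ in Ioi 0, C * Real.exp (-δ * c) * Real.exp (-δ * t)) *
        Real.exp (-R)) atTop (𝓝 0) := by
      simpa using (Real.tendsto_exp_atBot.comp tendsto_neg_atTop_atBot).const_mul
        (∫ t : ℝ in Ioi 0, C * Real.exp (-δ * c) * Real.exp (-δ * t))
    refine squeeze_zero_norm' ?_ hz
    filter_upwards [eventually_ge_atTop 1] with R hR
    rw [← integral_mul_const]
    refine norm_integral_le_of_norm_le
      (((exp_neg_integrableOn_Ioi 0 hδ).const_mul _).mul_const _) ?_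
    filter_upwards [ae_restrict_mem measurableSet_Ioi] with t ht
    have ht0 : (0 : ℝ) < t := ht
    have hRR : |u R| = R := by rw [hu, abs_of_nonneg (by linarith)]
    have := hb ((c + t : ℝ) + (u R : ℂ) * I) (by simp; linarith) (by simp [hRR, hR])
    refine this.trans_eq ?_
    rw [show -δ * ((c + t : ℝ) + (u R : ℂ) * I).re = -δ * c + -δ * t by simp; ring, Real.exp_add]
    simp only [ofReal_re, I_re, mul_zero, ofReal_im, I_im, mul_one,
      add_zero, add_im, mul_im, zero_add, hRR]
    ring
  have hl : Tendsto (fun R : ℝ => loopIntegral 1 f c R) atTop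
      (𝓝 ((2 * (Real.pi : ℂ) * I)⁻¹ * (0 + I * (∫ y : ℝ, f ((c : ℂ) + (y : ℂ) * I)) - 0))) := by
    simp_rw [loopIntegral_one]
    exact (((hh id (fun _ => rfl)).add (hv.const_mul I)).sub (hh (fun R => -R)
      (fun R => abs_neg R))).const_mul _
  have hconst : Tendsto (fun R : ℝ => loopIntegral 1 f c R) atTop (𝓝 (loopIntegral 1 f c R)) := by
    refine tendsto_const_nhds.congr' ?_
    filter_upwards [eventually_gt_atTop 0] with R' hR'
    exact hf.loopIntegral_eq hc hc1 hc hc1 hR hR'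
  rw [tendsto_nhds_unique hconst hl]
  have : (Real.pi : ℂ) ≠ 0 := by exact_mod_cast Real.pi_ne_zero
  field_simp
  simp

end LoopRegular

/-! ### Regularity from the asymptotic ratio of consecutive values -/

theorem exists_norm_add_le {ρ : ℝ} (hρ : 1 < ρ) (α β : ℂ) :
    ∃ N : ℝ, ∀ s : ℂ, N ≤ s.re → ‖s + α‖ ≤ ρ * ‖s + β‖ := by
  refine ⟨‖α - β‖ / (ρ - 1) - β.re, fun s hs => ?_⟩
  have h1 : ‖α - β‖ / (ρ - 1) ≤ ‖s + β‖ := by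
    refine le_trans ?_ (re_le_norm _)
    rw [add_re]; linarith
  rw [div_le_iff₀ (by linarith)] at h1
  have h2 : ‖s + α‖ ≤ ‖s + β‖ + ‖α - β‖ := by
    refine (congrArg norm (by ring : s + α = (s + β) + (α - β))).trans_le (norm_add_le _ _)
  linarith

theorem exists_mul_norm_add_le {x q : ℝ} (hx : 0 < x) (hq : x < q) (α β γ δ : ℂ) :
    ∃ N : ℝ, ∀ s : ℂ, N ≤ s.re → x * (‖s + α‖ * ‖s + β‖) ≤ q * (‖s + γ‖ * ‖s + δ‖) := by
  have hq0 : 0 < q := hx.trans hq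
  -- The slack q/x > 1 is shared equally by the two linear factors.
  have h1 : 1 < √(q / x) := by
    rw [Real.lt_sqrt zero_le_one, one_pow, lt_div_iff₀ hx]; linarith
  obtain ⟨N, hN⟩ := exists_norm_add_le h1 α γ
  obtain ⟨M, hM⟩ := exists_norm_add_le h1 β δ
  refine ⟨max N M, fun s hs => ?_⟩
  have h2 := mul_le_mul (hN s ((le_max_left _ _).trans hs)) (hM s ((le_max_right _ _).trans hs))
    (norm_nonneg _) (by positivity)
  have h3 : √(q / x) * √(q / x) = q / x := Real.mul_self_sqrt (by positivity)
  calc x * (‖s + α‖ * ‖s + β‖) ≤ x * (√(q / x) * ‖s + γ‖ * (√(q / x) * ‖s + δ‖)) := by gcongr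
    _ = x * (√(q / x) * √(q / x)) * (‖s + γ‖ * ‖s + δ‖) := by ring
    _ = q * (‖s + γ‖ * ‖s + δ‖) := by rw [h3]; field_simp

/-- Compactness bounds f on two rectangles away from the real axis, and the ratio bound propagates
this to the right with decay rate -log ρ. -/
theorem LoopRegular.of_norm_add_one_le {σ ρ N : ℝ} {f : ℂ → ℂ} (hρ : 0 < ρ) (hρ1 : ρ < 1)
    (hd : ∀ s : ℂ, σ < s.re → (s.re < 1 ∨ s.im ≠ 0) → DifferentiableAt ℂ f s)
    (hN : ∀ s : ℂ, s.im ≠ 0 → N ≤ s.re → ‖f (s + 1)‖ ≤ ρ * ‖f s‖) : LoopRegular σ f := by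
  refine ⟨hd, fun c r R hc hr => ?_⟩
  set M := max N c
  have hcpt : IsCompact (Icc c (M + 1) ×ℂ (Icc (-R) (-r) ∪ Icc r R)) :=
    isCompact_Icc.reProdIm (isCompact_Icc.union isCompact_Icc)
  have hcont : ContinuousOn f (Icc c (M + 1) ×ℂ (Icc (-R) (-r) ∪ Icc r R)) := by
    intro s hs
    refine (hd s (by linarith [hs.1.1]) (Or.inr ?_)).continuousAt.continuousWithinAt
    rcases hs.2 with h | h
    · exact (by linarith [h.2] : s.im < 0).ne
    · exact (by linarith [h.1] : 0 < s.im).ne'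
  obtain ⟨A, hA⟩ := hcpt.exists_bound_of_continuousOn hcont
  refine ⟨A * ρ ^ (-M - 1), -Real.log ρ, by linarith [Real.log_neg hρ hρ1], ?_⟩
  intro s hs h1 h2
  have := norm_le_mul_rpow_of_norm_add_one_le (f := f) (S := {y | r ≤ |y| ∧ |y| ≤ R})
    (A := fun _ => A) (c := c) (N := M) hρ hρ1.le (le_max_right _ _) ?_ ?_ s ⟨h1, h2⟩ hs
  · refine this.trans_eq ?_
    rw [show s.re - M - 1 = (-M - 1) + s.re by ring, Real.rpow_add hρ, neg_neg,
      Real.rpow_def_of_pos hρ s.re]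
    ring
  · intro s hs hc1 hc2
    refine hA s ⟨⟨hc1, hc2⟩, ?_⟩
    rcases le_total 0 s.im with h | h
    · right; simpa [abs_of_nonneg h] using hs
    · left
      have := hs
      simp only [mem_ofPred_eq, abs_of_nonpos h] at this
      exact ⟨by linarith, by linarith⟩
  · intro s hs hM
    exact hN s (abs_pos.1 (hr.trans_le hs.1)) ((le_max_left _ _).trans hM)

namespace LoopRegular

variable {σ c R : ℝ} {f g : ℂ → ℂ}

theorem loopIntegral_add (hf : LoopRegular σ f) (hg : LoopRegular σ g) (hc : σ < c) (hc1 : c < 1)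
    (hR : 0 < R) :
    loopIntegral 1 (fun s => f s + g s) c R = loopIntegral 1 f c R + loopIntegral 1 g c R := by
  simp only [loopIntegral_one]
  rw [integral_add (hf.integrableOn hc hR.ne') (hg.integrableOn hc hR.ne'),
    integral_add (hf.integrableOn hc (neg_neg_of_pos hR).ne)
      (hg.integrableOn hc (neg_neg_of_pos hR).ne),
    intervalIntegral.integral_add ((hf.continuous_vertical hc hc1).intervalIntegrable _ _)
      ((hg.continuous_vertical hc hc1).intervalIntegrable _ _)]
  ring

end LoopRegular

theorem loopIntegral_const_mul (a : ℂ) (f : ℂ → ℂ) (c R : ℝ) :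
    loopIntegral 1 (fun s => a * f s) c R = a * loopIntegral 1 f c R := by
  simp only [loopIntegral_one, integral_const_mul, intervalIntegral.integral_const_mul]
  ring

/-- The loop avoids the ray [1, ∞), so an identity that holds only off this ray is enough. -/
theorem loopIntegral_congr {σ c R : ℝ} {f g : ℂ → ℂ} (hc : σ < c) (hc1 : c < 1) (hR : 0 < R)
    (h : ∀ s : ℂ, σ < s.re → (s.re < 1 ∨ s.im ≠ 0) → f s = g s) :
    loopIntegral 1 f c R = loopIntegral 1 g c R := by
  simp only [loopIntegral_one]
  have h1 : ∀ y : ℝ, y ≠ 0 → ∫ t : ℝ in Ioi 0, f ((c + t : ℝ) + (y : ℂ) * I) =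
      ∫ t : ℝ in Ioi 0, g ((c + t : ℝ) + (y : ℂ) * I) := fun y hy =>
    setIntegral_congr_fun measurableSet_Ioi fun t (ht : 0 < t) => h _ (by simp; linarith)
      (by simp [hy])
  rw [h1 R hR.ne', h1 (-R) (neg_neg_of_pos hR).ne]
  congr 4
  exact intervalIntegral.integral_congr fun y _ => h _ (by simpa using hc) (by simp [hc1])

/-! ### The integrand of G^{21}_{33} and convergence of its loop integral -/

/-- The integrand of `G^{2 1}_{3 3}(x | 1, α, β ; 1, 1, 1/2)`. -/
noncomputable def integrand₃₃ (α β : ℂ) (x : ℝ) (s : ℂ) : ℂ :=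
  Gamma (1 - s) ^ 2 * Gamma s * (Gamma (1 / 2 + s))⁻¹ * (Gamma (α - s))⁻¹ * (Gamma (β - s))⁻¹ *
    (x : ℂ) ^ s

theorem meijerIntegrand_eq_integrand₃₃ (α β : ℂ) (x : ℝ) :
    meijerIntegrand 2 1 ![1, α, β] lowerParams x = integrand₃₃ α β x := by
  funext s
  have h : (1 : ℂ) - 2⁻¹ = 2⁻¹ := by norm_num
  simp [meijerIntegrand, integrand₃₃, lowerParams, Fin.prod_univ_three, h]
  exact Or.inl (by ring)

theorem one_sub_ne_neg_natCast {s : ℂ} (h : s.re < 1 ∨ s.im ≠ 0) (m : ℕ) : 1 - s ≠ -m := by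
  rintro h1
  have hs : s = ((1 + m : ℝ) : ℂ) := by push_cast; linear_combination -h1
  have hm : (0 : ℝ) ≤ m := m.cast_nonneg
  rw [hs] at h
  rcases h with h | h
  · simp only [ofReal_re] at h; linarith
  · simp at h

theorem ne_neg_natCast_of_re_pos {s : ℂ} (h : 0 < s.re) (m : ℕ) : s ≠ -m := by
  rintro rfl
  have hm : (0 : ℝ) ≤ m := m.cast_nonneg
  simp at h
  linarith

theorem Gamma_inv_eq (s : ℂ) : (Gamma s)⁻¹ = s * (Gamma (s + 1))⁻¹ :=
  one_div_Gamma_eq_self_mul_one_div_Gamma_add_one s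

/-- The functional equation of Γ in each factor. The ratio of consecutive values is a rational
function of s that tends to x at infinity, and x < 1 gives decay. -/
theorem integrand₃₃_add_one (α β : ℂ) {x : ℝ} (hx : 0 < x) {s : ℂ} (hs : 0 < s.re) :
    integrand₃₃ α β x (s + 1) * (s * (s + 1 / 2)) =
      x * ((s + (1 - α)) * (s + (1 - β))) * integrand₃₃ α β x s := by
  have hs0 : s ≠ 0 := by rintro rfl; simp at hs
  have h1 : Gamma (1 - s) = -s * Gamma (-s) := by
    rw [← Gamma_add_one _ (neg_ne_zero.2 hs0)]; ring_nf
  have h2 : (Gamma (1 / 2 + s))⁻¹ = (1 / 2 + s) * (Gamma (1 / 2 + (s + 1)))⁻¹ := by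
    rw [Gamma_inv_eq, add_assoc]
  have h3 : ∀ a : ℂ, (Gamma (a - (s + 1)))⁻¹ = (a - 1 - s) * (Gamma (a - s))⁻¹ := by
    intro a
    rw [Gamma_inv_eq]; ring_nf
  simp only [integrand₃₃]
  rw [h3, h3, h2, show 1 - (s + 1) = -s by ring, h1, Gamma_add_one _ hs0,
    cpow_add _ _ (by exact_mod_cast hx.ne'), cpow_one]
  ring

theorem loopRegular_integrand₃₃ (α β : ℂ) {x : ℝ} (hx : 0 < x) (hx1 : x < 1) :
    LoopRegular 0 (integrand₃₃ α β x) := by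
  obtain ⟨q, hxq, hq⟩ := exists_between hx1
  obtain ⟨N, hN⟩ := exists_mul_norm_add_le hx hxq (1 - α) (1 - β) 0 (1 / 2)
  refine LoopRegular.of_norm_add_one_le (N := max N 1) (ρ := q) (hx.trans hxq) hq ?_ ?_
  · intro s hs h
    have e := differentiable_one_div_Gamma
    have h1 : DifferentiableAt ℂ (fun s => Gamma (1 - s)) s :=
      (differentiableAt_Gamma _ (one_sub_ne_neg_natCast h)).comp s (by fun_prop)
    have h2 := differentiableAt_Gamma s (ne_neg_natCast_of_re_pos hs)
    have h3 : DifferentiableAt ℂ (fun s => (Gamma (1 / 2 + s))⁻¹) s :=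
      (e (1 / 2 + s)).comp s (f := fun s => 1 / 2 + s) (by fun_prop)
    have h4 : ∀ a : ℂ, DifferentiableAt ℂ (fun s => (Gamma (a - s))⁻¹) s := fun a =>
      (e (a - s)).comp s (f := fun s => a - s) (by fun_prop)
    have h5 : DifferentiableAt ℂ (fun s : ℂ => (x : ℂ) ^ s) s :=
      differentiableAt_id.const_cpow (Or.inl (by exact_mod_cast hx.ne'))
    exact (((((h1.pow 2).mul h2).mul h3).mul (h4 α)).mul (h4 β)).mul h5
  · intro s hs hr
    have hr1 : 1 ≤ s.re := (le_max_right _ _).trans hr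
    have h1 := congrArg norm (integrand₃₃_add_one α β hx (s := s) (by linarith))
    simp only [norm_mul, norm_real, Real.norm_of_nonneg hx.le] at h1
    have h2 := hN s ((le_max_left _ _).trans hr)
    have h3 : 0 < ‖s‖ * ‖s + 1 / 2‖ := by
      refine mul_pos (norm_pos_iff.2 ?_) (norm_pos_iff.2 ?_)
      · rintro rfl; simp at hs
      · intro h; have := congrArg im h; norm_num at this; exact hs this
    rw [add_zero] at h2
    refine le_of_mul_le_mul_right ?_ h3
    rw [h1]
    calc _ ≤ q * (‖s‖ * ‖s + 1 / 2‖) * ‖integrand₃₃ α β x s‖ := by gcongr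
      _ = _ := by ring

/-- Only Γ(1-s)² and Γ(s) have poles to be separated, and these come from parameters equal to 1; α
and β enter through entire factors. -/
theorem isMeijerLoop_iff (α β : ℂ) (c R : ℝ) :
    IsMeijerLoop 2 1 ![1, α, β] lowerParams c R ↔ 0 < R ∧ c < 1 ∧ 0 < c := by
  constructor
  · rintro ⟨h1, h2, h3⟩
    have h4 := (h2 0 (by norm_num)).1
    have h5 := (h3 0 (by norm_num)).1
    simp [lowerParams] at h4 h5
    exact ⟨h1, h4, h5⟩
  · rintro ⟨h1, h2, h3⟩
    refine ⟨h1, fun j hj => ?_, fun j hj => ?_⟩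
    · fin_cases j <;> simp [lowerParams] at hj ⊢ <;> exact ⟨h2, h1⟩
    · fin_cases j <;> simp at hj ⊢; exact ⟨h3, h1⟩

theorem meijerDirection_eq_one {x : ℝ} (hx : 0 < x) (hx1 : x < 1) :
    meijerDirection 3 3 (x : ℂ) = 1 := by
  simp [meijerDirection, abs_of_pos hx, hx1]

theorem meijerGConverges₃₃ (α β : ℂ) {x : ℝ} (hx : 0 < x) (hx1 : x < 1) :
    MeijerGConverges 2 1 ![1, α, β] lowerParams x := by
  refine ⟨⟨1 / 2, 1, (isMeijerLoop_iff _ _ _ _).2 (by norm_num)⟩, fun c R h => ?_⟩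
  obtain ⟨hR, hc1, hc⟩ := (isMeijerLoop_iff _ _ _ _).1 h
  have hf := loopRegular_integrand₃₃ α β hx hx1
  rw [meijerIntegrand_eq_integrand₃₃, meijerDirection_eq_one hx hx1]
  simp only [one_mul]
  refine ⟨hf.integrableOn hc hR.ne', ?_,
    (hf.continuous_vertical hc hc1).intervalIntegrable _ _⟩
  have := hf.integrableOn hc (neg_neg_of_pos hR).ne
  simpa [sub_eq_add_neg] using this

theorem meijerG₃₃_eq_loopIntegral (α β : ℂ) {x c R : ℝ} (hx : 0 < x) (hx1 : x < 1) (hc : 0 < c)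
    (hc1 : c < 1) (hR : 0 < R) :
    meijerG 2 1 ![1, α, β] lowerParams x = loopIntegral 1 (integrand₃₃ α β x) c R := by
  have h : ∃ cR : ℝ × ℝ, IsMeijerLoop 2 1 ![1, α, β] lowerParams cR.1 cR.2 :=
    ⟨(c, R), (isMeijerLoop_iff _ _ _ _).2 ⟨hR, hc1, hc⟩⟩
  obtain ⟨hR', hc1', hc'⟩ := (isMeijerLoop_iff _ _ _ _).1 h.choose_spec
  rw [meijerG, dif_pos h, meijerIntegrand_eq_integrand₃₃, meijerDirection_eq_one hx hx1]
  exact (loopRegular_integrand₃₃ α β hx hx1).loopIntegral_eq hc' hc1' hc hc1 hR' hR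

/-! ### Gamma quotients and trigonometric functions in vertical strips -/

theorem norm_betaIntegral_le_one {u v : ℂ} (hu : 1 ≤ u.re) (hv : 1 ≤ v.re) :
    ‖betaIntegral u v‖ ≤ 1 := by
  have h := intervalIntegral.norm_integral_le_of_norm_le_const (a := 0) (b := 1) (C := 1)
    (f := fun x : ℝ => (x : ℂ) ^ (u - 1) * (1 - (x : ℂ)) ^ (v - 1)) (fun x hx => ?_)
  · simpa [betaIntegral] using h
  · rw [uIoc_of_le zero_le_one] at hx
    have h1 : ‖(x : ℂ) ^ (u - 1)‖ ≤ 1 := by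
      rw [norm_cpow_eq_rpow_re_of_pos hx.1]
      exact Real.rpow_le_one hx.1.le hx.2 (by simpa using hu)
    have h2 : ‖(1 - (x : ℂ)) ^ (v - 1)‖ ≤ 1 := by
      rw [← ofReal_one, ← ofReal_sub]
      -- At the endpoint x = 1 the base is 0, and the power is 1 or 0 according to whether its
      -- exponent vanishes.
      rcases hx.2.eq_or_lt with h | h
      · rw [h, sub_self, ofReal_zero]
        by_cases hv0 : v - 1 = 0
        · simp [hv0]
        · rw [zero_cpow (by simpa using hv0)]; simp
      · rw [norm_cpow_eq_rpow_re_of_pos (by linarith)]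
        exact Real.rpow_le_one (by linarith) (by linarith [hx.1]) (by simpa using hv)
    rw [norm_mul]
    exact mul_le_one₀ h1 (norm_nonneg _) h2

theorem norm_add_le_of_strip {w δ : ℂ} {a b : ℝ} (ha : a ≤ w.re) (hb : w.re ≤ b)
    (hw : 1 ≤ |w.im|) : ‖w + δ‖ ≤ (|a| + |b| + ‖δ‖ + 1) * |w.im| := by
  have h1 : |w.re| ≤ |a| + |b| := by
    rw [abs_le]; constructor
    · linarith [neg_abs_le a, abs_nonneg b]
    · linarith [le_abs_self b, abs_nonneg a]
  have h2 := norm_add_le w δ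
  have h3 := norm_le_abs_re_add_abs_im w
  nlinarith [abs_nonneg a, abs_nonneg b, norm_nonneg δ]

/-- For Re w ≥ 1 and Re δ ≥ 1 the quotient is B(w, δ)/Γ(δ), which is bounded. Each unit by which Re
δ falls short costs a factor w + δ, hence one power of |Im w|. This gives polynomial growth without
Stirling's formula. -/
theorem norm_Gamma_div_le_aux (n : ℕ) (δ : ℂ) (a b : ℝ) (ha : 1 ≤ a) (hδ : 1 - (n : ℝ) ≤ δ.re) :
    ∃ (C : ℝ) (N : ℕ), 0 ≤ C ∧ ∀ w : ℂ, a ≤ w.re → w.re ≤ b → 1 ≤ |w.im| →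
      ‖Gamma w * (Gamma (w + δ))⁻¹‖ ≤ C * |w.im| ^ N := by
  induction n generalizing δ with
  | zero =>
    simp only [Nat.cast_zero, sub_zero] at hδ
    refine ⟨‖(Gamma δ)⁻¹‖, 0, norm_nonneg _, fun w h1 _ _ => ?_⟩
    have h0 := Gamma_ne_zero_of_re_pos (s := δ) (by linarith)
    have h2 := Gamma_ne_zero_of_re_pos (s := w + δ) (by rw [add_re]; linarith)
    have h3 := Gamma_mul_Gamma_eq_betaIntegral (s := w) (t := δ) (by linarith) (by linarith)
    have h4 : Gamma w * (Gamma (w + δ))⁻¹ = betaIntegral w δ * (Gamma δ)⁻¹ := by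
      field_simp; linear_combination h3
    rw [h4, norm_mul, pow_zero, mul_one]
    exact mul_le_of_le_one_left (norm_nonneg _) (norm_betaIntegral_le_one (by linarith) hδ)
  | succ n ih =>
    obtain ⟨C, N, hC, h⟩ := ih (δ + 1) (by push_cast at hδ; rw [add_re, one_re]; linarith)
    refine ⟨(|a| + |b| + ‖δ‖ + 1) * C, N + 1, by positivity, fun w h1 h2 h3 => ?_⟩
    rw [Gamma_inv_eq, mul_left_comm, norm_mul, add_assoc w]
    calc _ ≤ ((|a| + |b| + ‖δ‖ + 1) * |w.im|) * (C * |w.im| ^ N) := by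
          gcongr
          · exact norm_add_le_of_strip h1 h2 h3
          · exact h w h1 h2 h3
      _ = _ := by ring

/-- The restriction Re w ≥ 1 is removed through Γ(w)/Γ(w+δ) = ((w+δ)/w) · Γ(w+1)/Γ(w+1+δ), where |w|
≥ 1 allows the denominator to be dropped. -/
theorem norm_Gamma_div_le_strip (δ : ℂ) (a b : ℝ) :
    ∃ (C : ℝ) (N : ℕ), 0 ≤ C ∧ ∀ w : ℂ, a ≤ w.re → w.re ≤ b → 1 ≤ |w.im| →
      ‖Gamma w * (Gamma (w + δ))⁻¹‖ ≤ C * |w.im| ^ N := by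
  have key : ∀ (m : ℕ) (a b : ℝ), 1 - (m : ℝ) ≤ a →
      ∃ (C : ℝ) (N : ℕ), 0 ≤ C ∧ ∀ w : ℂ, a ≤ w.re → w.re ≤ b → 1 ≤ |w.im| →
      ‖Gamma w * (Gamma (w + δ))⁻¹‖ ≤ C * |w.im| ^ N := by
    intro m
    induction m with
    | zero =>
      intro a b ha
      obtain ⟨n, hn⟩ := exists_nat_ge (1 - δ.re)
      exact norm_Gamma_div_le_aux n δ a b (by simpa using ha) (by linarith)
    | succ m ih =>
      intro a b ha
      push_cast at ha
      obtain ⟨C, N, hC, h⟩ := ih (a + 1) (b + 1) (by linarith)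
      refine ⟨(|a| + |b| + ‖δ‖ + 1) * C, N + 1, by positivity, fun w h1 h2 h3 => ?_⟩
      have hw0 : w ≠ 0 := by rintro rfl; norm_num at h3
      have hw1 : 1 ≤ ‖w‖ := h3.trans (abs_im_le_norm w)
      have h4 := h (w + 1) (by simpa using h1) (by simpa using h2) (by simpa using h3)
      simp only [add_im, one_im, add_zero] at h4
      rw [Gamma_inv_eq]
      rw [Gamma_add_one w hw0, add_right_comm w 1 δ, mul_assoc, norm_mul] at h4
      have h5 : ‖Gamma w * (Gamma (w + δ + 1))⁻¹‖ ≤ C * |w.im| ^ N :=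
        (le_mul_of_one_le_left (norm_nonneg _) hw1).trans h4
      rw [mul_left_comm, norm_mul]
      calc _ ≤ ((|a| + |b| + ‖δ‖ + 1) * |w.im|) * (C * |w.im| ^ N) := by
            gcongr
            exact norm_add_le_of_strip h1 h2 h3
        _ = _ := by ring
  obtain ⟨m, hm⟩ := exists_nat_ge (1 - a)
  exact key m a b (by linarith)

theorem norm_exp_mul_I (w : ℂ) : ‖exp (w * I)‖ = Real.exp (-w.im) := by
  simp [norm_exp]

/-- The reverse triangle inequality applied to the two exponentials that make up the sine. -/
theorem abs_sinh_im_le_norm_sin (w : ℂ) : |Real.sinh w.im| ≤ ‖sin w‖ := by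
  rw [sin, norm_div, norm_mul, norm_I, mul_one, norm_ofNat, Real.sinh_eq, abs_div,
    abs_of_pos (by norm_num : (0 : ℝ) < 2)]
  have h := abs_norm_sub_norm_le (exp (-w * I)) (exp (w * I))
  rw [norm_exp_mul_I, norm_exp_mul_I, neg_im, neg_neg] at h
  gcongr

theorem abs_sinh_im_le_norm_cos (w : ℂ) : |Real.sinh w.im| ≤ ‖cos w‖ := by
  have := abs_sinh_im_le_norm_sin (w + Real.pi / 2)
  rw [sin_add_pi_div_two] at this
  simpa using this

theorem exp_div_four_le_abs_sinh {u : ℝ} (hu : 1 / 2 ≤ |u|) : Real.exp |u| / 4 ≤ |Real.sinh u| := by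
  rw [Real.abs_sinh, Real.sinh_eq]
  have h1 : Real.exp |u| * Real.exp (-|u|) = 1 := by rw [← Real.exp_add]; simp
  have h2 : 1 + 1 / 2 ≤ Real.exp |u| := by linarith [Real.add_one_le_exp |u|]
  have h3 : 0 < Real.exp (-|u|) := Real.exp_pos _
  have h4 : 2 ≤ Real.exp |u| * Real.exp |u| := by nlinarith
  have h5 : 2 * Real.exp (-|u|) ≤ Real.exp |u| := by nlinarith
  linarith

theorem Gamma_one_sub_inv {w : ℂ} (hw : Gamma w ≠ 0) :
    (Gamma (1 - w))⁻¹ = Gamma w * sin (Real.pi * w) / Real.pi := by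
  have h := Gamma_mul_Gamma_one_sub w
  have hpi : (Real.pi : ℂ) ≠ 0 := by exact_mod_cast Real.pi_ne_zero
  -- Where the sine vanishes, division by zero makes the reflection formula read Γ(w)Γ(1-w) = 0.
  -- Hence Γ(1-w) = 0 and both sides are 0.
  by_cases hs : sin (Real.pi * w) = 0
  · rw [hs, div_zero, mul_eq_zero] at h
    rw [h.resolve_left hw, hs]; simp
  · have h0 : Gamma (1 - w) ≠ 0 := by
      intro h0
      rw [h0, mul_zero] at h
      exact (div_ne_zero hpi hs) h.symm
    rw [eq_div_iff hs] at h
    rw [eq_div_iff hpi, inv_mul_eq_iff_eq_mul₀ h0]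
    linear_combination -h

/-! ### The Beta kernel: functional equation and decay -/

/-- `B(s + k/2 - 1/2, 2 - 2s)` continued to the whole plane. -/
noncomputable def betaKernel (k s : ℂ) : ℂ :=
  Gamma (s + k / 2 - 1 / 2) * Gamma (2 - 2 * s) * (Gamma (3 / 2 + k / 2 - s))⁻¹

theorem betaKernel_arg_re_pos {k s : ℂ} (hs : (1 - k.re) / 2 < s.re) :
    0 < (s + k / 2 - 1 / 2).re := by
  have : (k / 2).re = k.re / 2 := by simp
  have h2 : (1 / 2 : ℂ).re = 1 / 2 := by norm_num
  rw [sub_re, add_re, this, h2]; linarith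

theorem Gamma_mul_cos_eq {k s : ℂ} (hs : (1 - k.re) / 2 < s.re) :
    Gamma (s + k / 2 - 1 / 2) * cos (Real.pi * (s + k / 2)) =
      -Real.pi * (Gamma (3 / 2 - k / 2 - s))⁻¹ := by
  have h := Gamma_one_sub_inv (Gamma_ne_zero_of_re_pos (betaKernel_arg_re_pos hs))
  have hpi : (Real.pi : ℂ) ≠ 0 := by exact_mod_cast Real.pi_ne_zero
  rw [show 1 - (s + k / 2 - 1 / 2) = 3 / 2 - k / 2 - s by ring,
    show (Real.pi : ℂ) * (s + k / 2 - 1 / 2) = Real.pi * (s + k / 2) - Real.pi / 2 by ring,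
    sin_sub_pi_div_two] at h
  rw [h]; field_simp

/-- Reflection and duplication leave two quotients Γ(w)/Γ(w+δ) of polynomial growth in vertical
strips. The exponential decay of the kernel is therefore that of 1/cos π(s+k/2). -/
theorem betaKernel_mul_cos {k s : ℂ} (hs : (1 - k.re) / 2 < s.re) :
    betaKernel k s * cos (Real.pi * (s + k / 2)) =
      -(Real.pi / (√Real.pi : ℝ)) * (2 : ℂ) ^ (1 - 2 * s) *
        (Gamma (1 - s) * (Gamma (1 - s + (1 / 2 + k / 2)))⁻¹) *
        (Gamma (3 / 2 - s) * (Gamma (3 / 2 - s + (-(k / 2))))⁻¹) := by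
  have h1 := Gamma_mul_cos_eq hs
  have h2 := Gamma_mul_Gamma_add_half (1 - s)
  have hp : ((√Real.pi : ℝ) : ℂ) ≠ 0 := by
    exact_mod_cast (Real.sqrt_pos.2 Real.pi_pos).ne'
  have h3 : (2 : ℂ) ^ (1 - 2 * (1 - s)) * (2 : ℂ) ^ (1 - 2 * s) = 1 := by
    rw [← cpow_add _ _ two_ne_zero]; ring_nf; simp
  rw [show 1 - s + 1 / 2 = 3 / 2 - s by ring, show 2 * (1 - s) = 2 - 2 * s by ring] at h2
  rw [show 2 * (1 - s) = 2 - 2 * s by ring] at h3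
  have h4 : Gamma (2 - 2 * s) = Gamma (1 - s) * Gamma (3 / 2 - s) * (2 : ℂ) ^ (1 - 2 * s) /
      (√Real.pi : ℝ) := by
    rw [eq_div_iff hp, h2]
    linear_combination -(Gamma (2 - 2 * s) * (√Real.pi : ℝ)) * h3
  rw [betaKernel, mul_right_comm, mul_right_comm (Gamma (s + k / 2 - 1 / 2)), h1, h4,
    show 1 - s + (1 / 2 + k / 2) = 3 / 2 + k / 2 - s by ring,
    show 3 / 2 - s + -(k / 2) = 3 / 2 - k / 2 - s by ring]
  ring

theorem differentiableAt_betaKernel {k s : ℂ} (hs : (1 - k.re) / 2 < s.re)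
    (h : s.re < 1 ∨ s.im ≠ 0) : DifferentiableAt ℂ (betaKernel k) s := by
  have h1 : DifferentiableAt ℂ (fun s => Gamma (s + k / 2 - 1 / 2)) s :=
    (differentiableAt_Gamma _ (ne_neg_natCast_of_re_pos (betaKernel_arg_re_pos hs))).comp s
      (f := fun s => s + k / 2 - 1 / 2) (by fun_prop)
  have h2 : DifferentiableAt ℂ (fun s => Gamma (2 - 2 * s)) s := by
    refine (differentiableAt_Gamma _ fun m hm => ?_).comp s (f := fun s => 2 - 2 * s)
      (by fun_prop)
    have hs : s = ((1 + m / 2 : ℝ) : ℂ) := by push_cast; linear_combination -hm / 2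
    have hm : (0 : ℝ) ≤ m := m.cast_nonneg
    rw [hs] at h
    rcases h with h | h
    · simp only [ofReal_re] at h; linarith
    · simp only [ofReal_im, ne_eq, not_true_eq_false] at h
  have h3 : DifferentiableAt ℂ (fun s => (Gamma (3 / 2 + k / 2 - s))⁻¹) s :=
    (differentiable_one_div_Gamma _).comp s (f := fun s => 3 / 2 + k / 2 - s) (by fun_prop)
  exact (h1.mul h2).mul h3

theorem betaKernel_add_one {k s : ℂ} (hs : (1 - k.re) / 2 < s.re) (him : s.im ≠ 0) :
    betaKernel k (s + 1) * (4 * (s * (s - 1 / 2))) =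
      (s + (k / 2 - 1 / 2)) * (1 / 2 + k / 2 - s) * betaKernel k s := by
  have e0 := betaKernel_arg_re_pos hs
  have h0 : s + k / 2 - 1 / 2 ≠ 0 := fun h => by rw [h] at e0; simp at e0
  have h1 : -2 * s ≠ 0 := fun h => him (by simpa using congrArg im h)
  have h2 : -2 * s + 1 ≠ 0 := fun h => him (by simpa using congrArg im h)
  have h3 : Gamma (2 - 2 * s) = (-2 * s + 1) * (-2 * s * Gamma (-2 * s)) := by
    rw [← Gamma_add_one _ h1, ← Gamma_add_one _ h2]; ring_nf
  have h4 : (Gamma (3 / 2 + k / 2 - (s + 1)))⁻¹ =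
      (1 / 2 + k / 2 - s) * (Gamma (3 / 2 + k / 2 - s))⁻¹ := by
    rw [Gamma_inv_eq]; ring_nf
  simp only [betaKernel]
  rw [h3, h4, show s + 1 + k / 2 - 1 / 2 = s + k / 2 - 1 / 2 + 1 by ring, Gamma_add_one _ h0,
    show 2 - 2 * (s + 1) = -2 * s by ring]
  ring

/-- The modulus of the ratio of consecutive values tends to 1/4, with a threshold in Re s that is
independent of Im s. This is why e^(Re η) < 4 is the natural domain for the exponent. -/
theorem exists_norm_betaKernel_add_one_le (k : ℂ) {q : ℝ} (hq : 1 / 4 < q) :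
    ∃ N : ℝ, ∀ s : ℂ, s.im ≠ 0 → N ≤ s.re → ‖betaKernel k (s + 1)‖ ≤ q * ‖betaKernel k s‖ := by
  obtain ⟨N, hN⟩ := exists_mul_norm_add_le (by norm_num : (0 : ℝ) < 1 / 4) hq (k / 2 - 1 / 2)
    (-(1 / 2 + k / 2)) 0 (-(1 / 2))
  refine ⟨max N ((1 - k.re) / 2 + 1), fun s hs hr => ?_⟩
  have h1 := congrArg norm (betaKernel_add_one (k := k) (s := s)
    (by linarith [(le_max_right _ _).trans hr]) hs)
  have h2 := hN s ((le_max_left _ _).trans hr)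
  have h3 : 0 < ‖s‖ * ‖s - 1 / 2‖ := by
    refine mul_pos (norm_pos_iff.2 ?_) (norm_pos_iff.2 ?_)
    · rintro rfl; simp at hs
    · intro h; have := congrArg im h; norm_num at this; exact hs this
  rw [add_zero, ← sub_eq_add_neg, ← sub_eq_add_neg] at h2
  rw [norm_mul, norm_mul, norm_mul, norm_mul, norm_mul, norm_sub_rev (1 / 2 + k / 2) s] at h1
  norm_num at h1 h2 h3 ⊢
  refine le_of_mul_le_mul_right ?_ h3
  nlinarith [mul_le_mul_of_nonneg_right h2 (norm_nonneg (betaKernel k s))]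

theorem exists_norm_betaKernel_le_strip {k : ℂ} {c : ℝ} (hc : (1 - k.re) / 2 < c) (M : ℝ) :
    ∃ C : ℝ, ∀ s : ℂ, 1 ≤ |s.im| → c ≤ s.re → s.re ≤ M →
      ‖betaKernel k s‖ ≤ C * Real.exp (-|s.im|) := by
  obtain ⟨C₁, N₁, hC₁, h₁⟩ := norm_Gamma_div_le_strip (1 / 2 + k / 2) (1 - M) (1 - c)
  obtain ⟨C₂, N₂, hC₂, h₂⟩ := norm_Gamma_div_le_strip (-(k / 2)) (3 / 2 - M) (3 / 2 - c)
  -- Beyond height Y one has |Im(s + k/2)| ≥ 1/2, so the exponential lower bound for the cosine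
  -- applies. Below it, compactness suffices.
  set Y := |k.im| + 1
  have hcpt : IsCompact (Icc c M ×ℂ (Icc (-Y) (-1) ∪ Icc 1 Y)) :=
    isCompact_Icc.reProdIm (isCompact_Icc.union isCompact_Icc)
  have hcont : ContinuousOn (betaKernel k) (Icc c M ×ℂ (Icc (-Y) (-1) ∪ Icc 1 Y)) := by
    intro s hs
    refine (differentiableAt_betaKernel (by linarith [hs.1.1])
      (Or.inr ?_)).continuousAt.continuousWithinAt
    rcases hs.2 with h | h
    · exact (by linarith [h.2] : s.im < 0).ne
    · exact (by linarith [h.1] : 0 < s.im).ne'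
  obtain ⟨A, hA⟩ := hcpt.exists_bound_of_continuousOn hcont
  set D := Real.pi / √Real.pi * 2 ^ (1 - 2 * c) * C₁ * C₂ * ((N₁ + N₂).factorial : ℝ) *
    (4 * Real.exp (Real.pi * |k.im| / 2))
  have hD : 0 ≤ D := by positivity
  refine ⟨D + A * Real.exp Y, fun s h1 h2 h3 => ?_⟩
  have hA0 : 0 ≤ A := by
    refine (norm_nonneg _).trans (hA (⟨c, 1⟩ : ℂ) ⟨⟨le_rfl, h2.trans h3⟩, Or.inr ⟨le_rfl, ?_⟩⟩)
    simp [Y]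
  rcases le_or_gt |s.im| Y with hY | hY
  · have h4 : ‖betaKernel k s‖ ≤ A := by
      refine hA s ⟨⟨h2, h3⟩, ?_⟩
      rcases le_total 0 s.im with h | h
      · right; rw [abs_of_nonneg h] at h1 hY; exact ⟨h1, hY⟩
      · left; rw [abs_of_nonpos h] at h1 hY; constructor <;> linarith
    have h5 : 1 ≤ Real.exp Y * Real.exp (-|s.im|) := by
      rw [← Real.exp_add]; exact Real.one_le_exp (by linarith)
    calc ‖betaKernel k s‖ ≤ A := h4
      _ ≤ A * (Real.exp Y * Real.exp (-|s.im|)) := le_mul_of_one_le_right hA0 h5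
      _ ≤ (D + A * Real.exp Y) * Real.exp (-|s.im|) := by
        have : 0 ≤ D * Real.exp (-|s.im|) := by positivity
        linarith
  · have hcos : Real.exp (Real.pi * |s.im|) ≤
        4 * Real.exp (Real.pi * |k.im| / 2) * ‖cos (Real.pi * (s + k / 2))‖ := by
      have h4 := abs_sinh_im_le_norm_cos (Real.pi * (s + k / 2))
      have h5 : ((Real.pi : ℂ) * (s + k / 2)).im = Real.pi * (s.im + k.im / 2) := by
        simp
      rw [h5] at h4
      have h6 : |s.im| - |k.im| / 2 ≤ |s.im + k.im / 2| := by
        have := abs_sub_abs_le_abs_sub s.im (-(k.im / 2))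
        rw [abs_neg, abs_div, abs_two, sub_neg_eq_add] at this
        exact this
      have h8 : 1 / 2 ≤ |s.im + k.im / 2| := by
        have : 0 ≤ |k.im| := abs_nonneg _
        linarith
      have h7 : 1 / 2 ≤ |Real.pi * (s.im + k.im / 2)| := by
        rw [abs_mul, abs_of_pos Real.pi_pos]
        nlinarith [Real.pi_gt_three]
      have h9 := (exp_div_four_le_abs_sinh h7).trans h4
      rw [abs_mul, abs_of_pos Real.pi_pos] at h9
      have h10 : Real.exp (Real.pi * |s.im|) ≤ Real.exp (Real.pi * |k.im| / 2) *
          Real.exp (Real.pi * |s.im + k.im / 2|) := by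
        rw [← Real.exp_add]
        refine Real.exp_le_exp.2 ?_
        nlinarith [Real.pi_pos]
      have := Real.exp_pos (Real.pi * |k.im| / 2)
      nlinarith
    have h4 := congrArg norm (betaKernel_mul_cos (k := k) (s := s) (by linarith))
    have h5 := h₁ (1 - s) (by rw [sub_re, one_re]; linarith) (by rw [sub_re, one_re]; linarith) (by simpa using h1)
    have h6 := h₂ (3 / 2 - s) (by norm_num; linarith) (by norm_num; linarith) (by simpa using h1)
    have e1 : |(1 - s).im| = |s.im| := by simp
    have e2 : |(3 / 2 - s).im| = |s.im| := by simp
    rw [e1] at h5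
    rw [e2] at h6
    have h7 : ‖(2 : ℂ) ^ (1 - 2 * s)‖ ≤ 2 ^ (1 - 2 * c) := by
      rw [← ofReal_ofNat, norm_cpow_eq_rpow_re_of_pos (by norm_num)]
      refine Real.rpow_le_rpow_of_exponent_le (by norm_num) ?_
      simp; linarith
    have h8 : |s.im| ^ (N₁ + N₂) ≤ (N₁ + N₂).factorial * Real.exp |s.im| := by
      have := Real.pow_div_factorial_le_exp |s.im| (abs_nonneg _) (N₁ + N₂)
      rwa [div_le_iff₀ (by positivity), mul_comm] at this
    have h9 : ‖betaKernel k s‖ * ‖cos (Real.pi * (s + k / 2))‖ ≤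
        Real.pi / √Real.pi * 2 ^ (1 - 2 * c) * C₁ * C₂ *
          ((N₁ + N₂).factorial * Real.exp |s.im|) := by
      rw [← norm_mul, h4, norm_mul, norm_mul, norm_mul, norm_neg, norm_div, norm_real, norm_real,
        Real.norm_of_nonneg Real.pi_pos.le, Real.norm_of_nonneg (Real.sqrt_nonneg _)]
      calc _ ≤ Real.pi / √Real.pi * 2 ^ (1 - 2 * c) * (C₁ * |s.im| ^ N₁) *
              (C₂ * |s.im| ^ N₂) := by gcongr
        _ = Real.pi / √Real.pi * 2 ^ (1 - 2 * c) * C₁ * C₂ * |s.im| ^ (N₁ + N₂) := by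
            rw [pow_add]; ring
        _ ≤ _ := by gcongr
    -- The polynomial factor was absorbed into e^|Im s|; since π ≥ 2, a factor e^(-|Im s|) is still
    -- left over from e^(-π|Im s|).
    have h10 : Real.exp |s.im| ≤ Real.exp (-|s.im|) * Real.exp (Real.pi * |s.im|) := by
      rw [← Real.exp_add]
      refine Real.exp_le_exp.2 ?_
      nlinarith [Real.pi_gt_three]
    have hpos : 0 < ‖cos (Real.pi * (s + k / 2))‖ := by
      have := Real.exp_pos (Real.pi * |s.im|)
      by_contra h
      have h0 : ‖cos (Real.pi * (s + k / 2))‖ = 0 := le_antisymm (not_lt.1 h) (norm_nonneg _)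
      rw [h0] at hcos
      linarith
    have h11 : ‖betaKernel k s‖ ≤ D * Real.exp (-|s.im|) := by
      refine le_of_mul_le_mul_right (h9.trans ?_) hpos
      calc _ ≤ Real.pi / √Real.pi * 2 ^ (1 - 2 * c) * C₁ * C₂ * ((N₁ + N₂).factorial *
              (Real.exp (-|s.im|) * (4 * Real.exp (Real.pi * |k.im| / 2) *
                ‖cos (Real.pi * (s + k / 2))‖))) := by
            gcongr
            exact h10.trans (by gcongr)
        _ = _ := by simp only [D]; ring
    have : 0 ≤ A * Real.exp Y * Real.exp (-|s.im|) := by positivity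
    linarith

/-- The strip estimate supplies decay in Im s, and the ratio bound transports it to the right with
geometric decay in Re s. -/
theorem exists_norm_betaKernel_le {k : ℂ} {c q : ℝ} (hc : (1 - k.re) / 2 < c) (hq : 1 / 4 < q)
    (hq1 : q ≤ 1) :
    ∃ C : ℝ, ∀ s : ℂ, c ≤ s.re → 1 ≤ |s.im| →
      ‖betaKernel k s‖ ≤ C * q ^ s.re * Real.exp (-|s.im|) := by
  have hq0 : 0 < q := by linarith
  obtain ⟨N, hN⟩ := exists_norm_betaKernel_add_one_le k hq
  obtain ⟨C, hC⟩ := exists_norm_betaKernel_le_strip hc (max N c + 1)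
  refine ⟨C * q ^ (-max N c - 1), fun s h1 h2 => ?_⟩
  have := norm_le_mul_rpow_of_norm_add_one_le (f := betaKernel k) (S := {y | 1 ≤ |y|})
    (A := fun y => C * Real.exp (-|y|)) (c := c) (N := max N c) hq0 hq1 (le_max_right _ _)
    (fun s hs h3 h4 => hC s hs h3 h4)
    (fun s hs h3 => hN s (abs_pos.1 (zero_lt_one.trans_le hs)) ((le_max_left _ _).trans h3)) s h2 h1
  refine this.trans_eq ?_
  rw [show s.re - max N c - 1 = (-max N c - 1) + s.re by ring, Real.rpow_add hq0]
  ring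

theorem norm_exp_mul_le (η s : ℂ) : ‖exp (η * s)‖ = Real.exp (η.re * s.re - η.im * s.im) := by
  rw [norm_exp, mul_re]

theorem loopRegular_betaKernel_mul_exp {k η : ℂ} {σ : ℝ} (hσ : (1 - k.re) / 2 ≤ σ)
    (hη : Real.exp η.re < 4) : LoopRegular σ (fun s => betaKernel k s * exp (η * s)) := by
  have h0 := Real.exp_pos η.re
  have h4 : 1 / 4 < (Real.exp η.re)⁻¹ := by
    rw [one_div]; exact (inv_lt_inv₀ (by norm_num) h0).2 hη
  obtain ⟨q, hq, hq1⟩ := exists_between h4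
  obtain ⟨N, hN⟩ := exists_norm_betaKernel_add_one_le k hq
  refine LoopRegular.of_norm_add_one_le (N := N) (ρ := q * Real.exp η.re) (by positivity)
    (by rwa [← lt_inv_mul_iff₀' h0, mul_one]) (fun s hs h => ?_) (fun s hs hr => ?_)
  · exact (differentiableAt_betaKernel (by linarith) h).mul (by fun_prop)
  · rw [norm_mul, norm_mul, mul_add, mul_one, exp_add, norm_mul, norm_exp η]
    calc _ ≤ q * ‖betaKernel k s‖ * (‖exp (η * s)‖ * Real.exp η.re) := by
          gcongr; exact hN s hs hr
      _ = _ := by ring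

theorem sin_pi_mul_ne_zero_of_re_pos {s : ℂ} (h0 : 0 < s.re) (h : s.re < 1 ∨ s.im ≠ 0) :
    sin (Real.pi * s) ≠ 0 := by
  rw [Ne, sin_eq_zero_iff]
  rintro ⟨m, hm⟩
  have hpi : (Real.pi : ℂ) ≠ 0 := by exact_mod_cast Real.pi_ne_zero
  have hs : s = ((m : ℝ) : ℂ) := by
    push_cast; exact mul_left_cancel₀ hpi (by linear_combination hm)
  rw [hs] at h h0
  rw [ofReal_re] at h0
  rcases h with h | h
  · rw [ofReal_re] at h
    have h1 : 0 < m := by exact_mod_cast h0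
    have h2 : m < 1 := by exact_mod_cast h
    omega
  · exact h (ofReal_im _)

theorem loopRegular_betaKernel_div_sin {k η : ℂ} {σ : ℝ} (hσ : (1 - k.re) / 2 ≤ σ) (hσ0 : 0 ≤ σ)
    (hη : Real.exp η.re < 4) :
    LoopRegular σ (fun s => betaKernel k s * exp (η * s) / sin (Real.pi * s)) := by
  have h0 := Real.exp_pos η.re
  have h4 : 1 / 4 < (Real.exp η.re)⁻¹ := by
    rw [one_div]; exact (inv_lt_inv₀ (by norm_num) h0).2 hη
  obtain ⟨q, hq, hq1⟩ := exists_between h4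
  obtain ⟨N, hN⟩ := exists_norm_betaKernel_add_one_le k hq
  refine LoopRegular.of_norm_add_one_le (N := N) (ρ := q * Real.exp η.re) (by positivity)
    (by rwa [← lt_inv_mul_iff₀' h0, mul_one]) (fun s hs h => ?_) (fun s hs hr => ?_)
  · exact ((loopRegular_betaKernel_mul_exp hσ hη).differentiableAt s hs h).div (by fun_prop)
      (sin_pi_mul_ne_zero_of_re_pos (hσ0.trans_lt hs) h)
  · rw [norm_div, norm_div, norm_mul, norm_mul, mul_add, mul_one, exp_add, norm_mul, norm_exp η,
      mul_add, mul_one, sin_add_pi, norm_neg]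
    calc _ ≤ q * ‖betaKernel k s‖ * (‖exp (η * s)‖ * Real.exp η.re) / ‖sin (Real.pi * s)‖ := by
          gcongr; exact hN s hs hr
      _ = _ := by ring

theorem one_le_norm_sin_pi_mul {s : ℂ} (hs : 1 ≤ |s.im|) : 1 ≤ ‖sin (Real.pi * s)‖ := by
  have h := abs_sinh_im_le_norm_sin (Real.pi * s)
  rw [im_ofReal_mul, Real.abs_sinh, abs_mul, abs_of_pos Real.pi_pos] at h
  have h2 : 1 ≤ Real.pi * |s.im| := by nlinarith [Real.pi_gt_three]
  exact (h2.trans (Real.self_le_sinh_iff.2 (by linarith))).trans h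

theorem exists_norm_betaKernel_mul_exp_le {k : ℂ} {c L : ℝ} (hc : (1 - k.re) / 2 < c)
    (hL : Real.exp L < 4) : ∃ C δ : ℝ, 0 < δ ∧ ∀ s : ℂ, c ≤ s.re → 1 ≤ |s.im| →
      ‖betaKernel k s * exp ((L : ℂ) * s)‖ ≤ C * Real.exp (-δ * s.re) * Real.exp (-|s.im|) := by
  have h0 := Real.exp_pos L
  -- Two demands on q: q ≤ 1 for the iteration, and q e^L < 1 so that decay remains after
  -- multiplication by the exponential.
  have h4 : 1 / 4 < min 1 (Real.exp L)⁻¹ := by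
    rw [one_div]
    exact lt_min (by norm_num) ((inv_lt_inv₀ (by norm_num) h0).2 hL)
  obtain ⟨q, hq, hq1⟩ := exists_between h4
  have hq0 : 0 < q := by linarith
  obtain ⟨C, hC⟩ := exists_norm_betaKernel_le hc hq (hq1.le.trans (min_le_left _ _))
  refine ⟨C, -Real.log q - L, ?_, fun s h1 h2 => ?_⟩
  · have := Real.log_lt_log hq0 (hq1.trans_le (min_le_right _ _))
    rw [Real.log_inv, Real.log_exp] at this
    linarith
  · rw [norm_mul, norm_exp_mul_le, ofReal_re, ofReal_im, zero_mul, sub_zero]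
    refine (mul_le_mul_of_nonneg_right (hC s h1 h2) (Real.exp_pos _).le).trans_eq ?_
    rw [Real.rpow_def_of_pos hq0, show -(-Real.log q - L) * s.re = Real.log q * s.re + L * s.re
      by ring, Real.exp_add]
    ring

theorem loopIntegral_betaKernel_mul_exp {k : ℂ} {c R L : ℝ} (hc : (1 - k.re) / 2 < c)
    (hc1 : c < 1) (hR : 0 < R) (hL : Real.exp L < 4) :
    loopIntegral 1 (fun s => betaKernel k s * exp ((L : ℂ) * s)) c R = (2 * (Real.pi : ℂ))⁻¹ *
      ∫ y : ℝ, betaKernel k ((c : ℂ) + y * I) * exp ((L : ℂ) * ((c : ℂ) + y * I)) := by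
  obtain ⟨C, δ, hδ, hb⟩ := exists_norm_betaKernel_mul_exp_le hc hL
  exact (loopRegular_betaKernel_mul_exp (η := (L : ℂ)) le_rfl
    (by simpa using hL)).loopIntegral_eq_vertical hc hc1 hR hδ hb

theorem loopIntegral_betaKernel_div_sin {k : ℂ} {c R L : ℝ} (hc : (1 - k.re) / 2 < c) (hc0 : 0 < c)
    (hc1 : c < 1) (hR : 0 < R) (hL : Real.exp L < 4) :
    loopIntegral 1 (fun s => betaKernel k s * exp ((L : ℂ) * s) / sin (Real.pi * s)) c R =
      (2 * (Real.pi : ℂ))⁻¹ * ∫ y : ℝ, betaKernel k ((c : ℂ) + y * I) *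
        exp ((L : ℂ) * ((c : ℂ) + y * I)) / sin (Real.pi * ((c : ℂ) + y * I)) := by
  obtain ⟨C, δ, hδ, hb⟩ := exists_norm_betaKernel_mul_exp_le hc hL
  refine (loopRegular_betaKernel_div_sin (η := (L : ℂ)) (σ := max ((1 - k.re) / 2) 0)
    (le_max_left _ _) (le_max_right _ _) (by simpa using hL)).loopIntegral_eq_vertical (C := C)
    (max_lt hc hc0) hc1 hR hδ (fun s h1 h2 => ?_)
  rw [norm_div]
  exact (div_le_self (norm_nonneg _) (one_le_norm_sin_pi_mul h2)).trans (hb s h1 h2)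

theorem integrable_betaKernel_vertical {k : ℂ} {c : ℝ} (hc : (1 - k.re) / 2 < c) (hc1 : c < 1) :
    Integrable (fun y : ℝ => betaKernel k ((c : ℂ) + y * I)) := by
  obtain ⟨C, δ, hδ, hb⟩ := exists_norm_betaKernel_mul_exp_le (L := 0) hc (by norm_num)
  have := (loopRegular_betaKernel_mul_exp (η := 0) (k := k) le_rfl
    (by norm_num)).integrable_vertical (C := C * Real.exp (-δ * c)) hc hc1
    (fun y hy => by simpa using hb (c + (y : ℂ) * I) (by simp) (by simpa using hy))
  simpa using this

theorem betaKernel_eq_betaIntegral {k s : ℂ} (hs : (1 - k.re) / 2 < s.re) (hs1 : s.re < 1) :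
    betaKernel k s = betaIntegral (s + k / 2 - 1 / 2) (2 - 2 * s) := by
  rw [betaIntegral_eq_Gamma_mul_div _ _ (betaKernel_arg_re_pos hs) (by simp; linarith), betaKernel,
    div_eq_mul_inv]
  congr 3
  ring

/-! ### Mellin inversion of the Beta kernel -/

/-- Change of variables r = φ(t) from (0, 1) onto (0, ∞), transferring convergence and value
together. -/
theorem mellin_eq_betaIntegral {f : ℝ → ℂ} {φ φ' : ℝ → ℝ} {s u v : ℂ} (hu : 0 < u.re)
    (hv : 0 < v.re) (hφ : ∀ t ∈ Ioo (0 : ℝ) 1, HasDerivAt φ (φ' t) t)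
    (hφ' : ∀ t ∈ Ioo (0 : ℝ) 1, 0 ≤ φ' t) (hinj : InjOn φ (Ioo 0 1)) (himg : φ '' Ioo 0 1 = Ioi 0)
    (h : ∀ t ∈ Ioo (0 : ℝ) 1, (φ' t : ℂ) * ((φ t : ℂ) ^ (s - 1) * f (φ t)) =
      (t : ℂ) ^ (u - 1) * (1 - (t : ℂ)) ^ (v - 1)) :
    MellinConvergent f s ∧ mellin f s = betaIntegral u v := by
  have hd : ∀ t ∈ Ioo (0 : ℝ) 1, HasDerivWithinAt φ (φ' t) (Ioo 0 1) t :=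
    fun t ht => (hφ t ht).hasDerivWithinAt
  have e : ∀ t ∈ Ioo (0 : ℝ) 1, |φ' t| • ((φ t : ℂ) ^ (s - 1) • f (φ t)) =
      (t : ℂ) ^ (u - 1) * (1 - (t : ℂ)) ^ (v - 1) := fun t ht => by
    rw [← h t ht, abs_of_nonneg (hφ' t ht), real_smul, smul_eq_mul]
  constructor
  · rw [MellinConvergent, ← himg,
      integrableOn_image_iff_integrableOn_abs_deriv_smul measurableSet_Ioo hd hinj,
      integrableOn_congr_fun e measurableSet_Ioo, ← integrableOn_Ioc_iff_integrableOn_Ioo,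
      ← intervalIntegrable_iff_integrableOn_Ioc_of_le zero_le_one]
    exact betaIntegral_convergent hu hv
  · rw [mellin, ← himg, integral_image_eq_integral_abs_deriv_smul measurableSet_Ioo hd hinj,
      setIntegral_congr_fun measurableSet_Ioo e, betaIntegral,
      intervalIntegral.integral_of_le zero_le_one, integral_Ioc_eq_integral_Ioo]

theorem mellinInv_apply_exp_neg (g : ℂ → ℂ) (c ω : ℝ) :
    mellinInv c g (Real.exp (-ω)) =
      (2 * (Real.pi : ℂ))⁻¹ * ∫ y : ℝ, g ((c : ℂ) + y * I) * exp ((ω : ℂ) * ((c : ℂ) + y * I)) := by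
  rw [mellinInv, real_smul]
  congr 1
  · push_cast; simp
  · congr 1
    funext y
    rw [smul_eq_mul, cpow_def_of_ne_zero (by exact_mod_cast (Real.exp_pos _).ne'), ← ofReal_log
      (Real.exp_pos _).le, Real.log_exp, mul_comm]
    congr 2
    push_cast; ring

/-- The function of `η` whose inverse Mellin data are given by `betaKernel k`; in the variable
`y` with `exp (η / 2) = 2 sinh y` it is `exp η * exp (-k y) / (2 cosh y)`. -/
noncomputable def betaKernelInv (k η : ℂ) : ℂ :=
  exp η * exp (-k * log ((exp (η / 2) + exp (log (exp η + 4) / 2)) / 2)) /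
    exp (log (exp η + 4) / 2)

theorem re_exp_log_div_two_pos {x : ℂ} (hx : x ∈ slitPlane) : 0 < (exp (log x / 2)).re := by
  have h1 : (log x / 2).im = arg x / 2 := by simp [log_im]
  rw [exp_re, h1]
  refine mul_pos (Real.exp_pos _) (Real.cos_pos_of_mem_Ioo ⟨?_, ?_⟩)
  · linarith [neg_pi_lt_arg x]
  · have := (arg_le_pi x).lt_of_ne (mem_slitPlane_iff_arg.1 hx).1
    linarith

theorem differentiableAt_betaKernelInv (k : ℂ) {η : ℂ} (hη : exp η + 4 ∈ slitPlane) :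
    DifferentiableAt ℂ (betaKernelInv k) η := by
  have hS := re_exp_log_div_two_pos hη
  have hlog : DifferentiableAt ℂ (fun η => exp (log (exp η + 4) / 2)) η := by
    have h1 : DifferentiableAt ℂ (fun η => exp η + 4) η := by fun_prop
    exact ((h1.clog hη).div_const 2).cexp
  have hu : (exp (η / 2) + exp (log (exp η + 4) / 2)) / 2 ∈ slitPlane := by
    set S := exp (log (exp η + 4) / 2) with hSdef
    set W := exp (η / 2) with hWdef
    have hS2 : S ^ 2 = W ^ 2 + 4 := by
      rw [hSdef, hWdef, ← exp_nat_mul, ← exp_nat_mul]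
      push_cast
      rw [mul_div_cancel₀ _ two_ne_zero, mul_div_cancel₀ _ two_ne_zero,
        exp_log (slitPlane_ne_zero hη)]
    by_contra hn
    rw [mem_slitPlane_iff, not_or, not_lt, not_not] at hn
    set u := (W + S) / 2 with hudef
    -- If u were real and nonpositive, the real part of u(S - u) would be at most 0, because Re S >
    -- 0. Hence u stays off the cut of the logarithm.
    have hu1 : u * (S - u) = 1 := by rw [hudef]; linear_combination hS2 / 4
    have hur : u = (u.re : ℂ) := by apply Complex.ext <;> simp [hn.2]
    have h1 := congrArg re hu1
    rw [mul_re, hn.2, zero_mul, sub_zero, sub_re, one_re] at h1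
    nlinarith [hn.1, mul_nonneg_of_nonpos_of_nonpos hn.1 hn.1]
  have hne : exp (log (exp η + 4) / 2) ≠ 0 := exp_ne_zero _
  have h1 : DifferentiableAt ℂ (fun η => exp (η / 2)) η := by fun_prop
  exact (differentiableAt_exp.mul ((((h1.add hlog).div_const 2).clog hu).const_mul (-k)).cexp).div
    hlog hne

/-- With e^η = (1-t)²/t the roots become explicit: e^(η/2) = (1-t)/√t, √(e^η+4) = (1+t)/√t, and the
argument of the logarithm is t^(-1/2). -/
theorem betaKernelInv_neg_log {k : ℂ} {t : ℝ} (ht : t ∈ Ioo (0 : ℝ) 1) :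
    betaKernelInv k (-(Real.log t - 2 * Real.log (1 - t) : ℝ)) =
      exp (2 * Real.log (1 - t) - Real.log t + k / 2 * Real.log t + Real.log t / 2) / (1 + t) := by
  obtain ⟨h0, h1⟩ := ht
  set l := Real.log t with hl
  set m := Real.log (1 - t) with hm
  have e1 : Real.exp l = t := Real.exp_log h0
  have e2 : Real.exp m = 1 - t := Real.exp_log (by linarith)
  have e3 : Real.exp (l / 2) * Real.exp (l / 2) = t := by rw [← Real.exp_add, add_halves, e1]
  have e4 : 0 < Real.exp (l / 2) := Real.exp_pos _
  have a1 : exp (-((l - 2 * m : ℝ) : ℂ)) = (((1 - t) ^ 2 / t : ℝ) : ℂ) := by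
    rw [← ofReal_neg, ← ofReal_exp, show -(l - 2 * m) = m + m - l by ring, Real.exp_sub,
      Real.exp_add, e1, e2]
    congr 1; ring
  have a2 : exp (-((l - 2 * m : ℝ) : ℂ) / 2) = (((1 - t) / Real.exp (l / 2) : ℝ) : ℂ) := by
    rw [← ofReal_neg, ← ofReal_ofNat, ← ofReal_div, ← ofReal_exp,
      show -(l - 2 * m) / 2 = m - l / 2 by ring, Real.exp_sub, e2]
  have a3 : exp (log (exp (-((l - 2 * m : ℝ) : ℂ)) + 4) / 2) =
      (((1 + t) / Real.exp (l / 2) : ℝ) : ℂ) := by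
    have e5 : (1 - t) ^ 2 / t + 4 = ((1 + t) / Real.exp (l / 2)) * ((1 + t) / Real.exp (l / 2)) := by
      rw [div_mul_div_comm, e3]; field_simp; ring
    have e6 : 0 < (1 + t) / Real.exp (l / 2) := by positivity
    rw [a1, ← ofReal_ofNat, ← ofReal_add, e5, ← ofReal_log (by positivity), ← ofReal_ofNat,
      ← ofReal_div, ← ofReal_exp, Real.log_mul e6.ne' e6.ne', add_self_div_two, Real.exp_log e6]
  have a4 : ((((1 - t) / Real.exp (l / 2) : ℝ) : ℂ) + (((1 + t) / Real.exp (l / 2) : ℝ) : ℂ)) / 2 =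
      ((Real.exp (-(l / 2)) : ℝ) : ℂ) := by
    rw [← ofReal_add, ← ofReal_ofNat, ← ofReal_div, Real.exp_neg]
    congr 1; field_simp; ring
  rw [betaKernelInv, a3, a2, a4, ← ofReal_log (Real.exp_pos _).le, Real.log_exp]
  have ht1 : (1 + t : ℂ) ≠ 0 := by exact_mod_cast (by linarith : (0 : ℝ) < 1 + t).ne'
  have e7 : (Real.exp (l / 2) : ℂ) ≠ 0 := by exact_mod_cast e4.ne'
  rw [show ((2 * m - l + k / 2 * l + l / 2 : ℂ)) =
    -((l - 2 * m : ℝ) : ℂ) + -k * ((-(l / 2) : ℝ) : ℂ) + ((l / 2 : ℝ) : ℂ) by push_cast; ring,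
    exp_add, exp_add, ← ofReal_exp (l / 2)]
  push_cast at e7 ⊢
  field_simp

theorem image_div_one_sub_sq : (fun t : ℝ => t / (1 - t) ^ 2) '' Ioo 0 1 = Ioi 0 := by
  ext r
  constructor
  · rintro ⟨t, ⟨h0, h1⟩, rfl⟩
    exact div_pos h0 (pow_pos (by linarith) 2)
  · intro hr
    have hr0 : 0 < r := hr
    have hcont : ContinuousOn (fun t : ℝ => r * (1 - t) ^ 2 - t) (Icc 0 1) := by fun_prop
    obtain ⟨t, ht, h⟩ := intermediate_value_Ioo' zero_le_one hcont
      (show (0 : ℝ) ∈ Ioo _ _ by constructor <;> norm_num; exact hr0)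
    refine ⟨t, ht, ?_⟩
    have : (1 - t) ≠ 0 := by linarith [ht.2]
    simp only at h ⊢
    field_simp
    linarith

theorem injOn_div_one_sub_sq : InjOn (fun t : ℝ => t / (1 - t) ^ 2) (Ioo 0 1) := by
  intro a ha b hb h
  have h1 : 1 - a ≠ 0 := by linarith [ha.2]
  have h2 : 1 - b ≠ 0 := by linarith [hb.2]
  simp only at h
  rw [div_eq_div_iff (pow_ne_zero 2 h1) (pow_ne_zero 2 h2)] at h
  have h3 : (a - b) * (1 - a * b) = 0 := by linear_combination h
  have h4 : 1 - a * b ≠ 0 := by nlinarith [ha.1, ha.2, hb.1, hb.2]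
  linarith [(mul_eq_zero.1 h3).resolve_right h4]

/-- Under r = t/(1-t)² the Jacobian (1+t)/(1-t)³ cancels the denominator 1 + t, and exactly the Beta
integrand remains. -/
theorem mellin_betaKernelInv {k s : ℂ} (hs : (1 - k.re) / 2 < s.re) (hs1 : s.re < 1) :
    MellinConvergent (fun r : ℝ => betaKernelInv k (-(Real.log r : ℝ))) s ∧
      mellin (fun r : ℝ => betaKernelInv k (-(Real.log r : ℝ))) s = betaKernel k s := by
  rw [betaKernel_eq_betaIntegral hs hs1]
  refine mellin_eq_betaIntegral (φ := fun t => t / (1 - t) ^ 2)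
    (φ' := fun t => (1 + t) / (1 - t) ^ 3) (betaKernel_arg_re_pos hs) (by simp; linarith)
    (fun t ht => ?_) (fun t ht => ?_) injOn_div_one_sub_sq image_div_one_sub_sq (fun t ht => ?_)
  · have h1 : 1 - t ≠ 0 := by linarith [ht.2]
    have h2 : HasDerivAt (fun t : ℝ => (1 - t) ^ 2) (2 * (1 - t) * (-1)) t := by
      simpa using ((hasDerivAt_id t).const_sub 1).fun_pow 2
    refine ((hasDerivAt_id' t).fun_div h2 (pow_ne_zero 2 h1)).congr_deriv ?_
    field_simp; ring
  · exact div_nonneg (by linarith [ht.1]) (pow_nonneg (by linarith [ht.2]) 3)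
  · obtain ⟨h0, h1⟩ := ht
    have h2 : 0 < 1 - t := by linarith
    have hφ : 0 < t / (1 - t) ^ 2 := by positivity
    have hlog : Real.log (t / (1 - t) ^ 2) = Real.log t - 2 * Real.log (1 - t) := by
      rw [Real.log_div h0.ne' (by positivity), Real.log_pow]; norm_num
    have ht0 : (t : ℂ) ≠ 0 := by exact_mod_cast h0.ne'
    have ht1 : (1 - t : ℂ) ≠ 0 := by exact_mod_cast h2.ne'
    have ht2 : (1 + t : ℂ) ≠ 0 := by exact_mod_cast (by linarith : (0 : ℝ) < 1 + t).ne'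
    have e1 : log (1 - t : ℂ) = Real.log (1 - t) := by
      rw [ofReal_log h2.le]; push_cast; rfl
    have e2 : (((1 + t) / (1 - t) ^ 3 : ℝ) : ℂ) = (1 + t) * exp (-3 * Real.log (1 - t)) := by
      have : exp (-3 * (Real.log (1 - t) : ℂ)) = ((1 - t : ℂ) ^ 3)⁻¹ := by
        rw [neg_mul, exp_neg, show (3 : ℂ) = ((3 : ℕ) : ℂ) by norm_num, exp_nat_mul, ← e1,
          exp_log ht1]
      rw [this]; push_cast; rw [div_eq_mul_inv]
    rw [e2, hlog, betaKernelInv_neg_log ⟨h0, h1⟩, cpow_def_of_ne_zero (by exact_mod_cast hφ.ne'),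
      ← ofReal_log hφ.le, hlog, cpow_def_of_ne_zero ht0, cpow_def_of_ne_zero ht1, e1,
      ← ofReal_log h0.le]
    rw [mul_div_assoc', mul_div_assoc', div_eq_iff ht2, mul_assoc, ← exp_add, ← exp_add,
      ← exp_add, mul_comm]
    congr 2
    push_cast; ring

theorem loopIntegral_betaKernel_ofReal {k : ℂ} {c R L : ℝ} (hc : (1 - k.re) / 2 < c)
    (hc1 : c < 1) (hR : 0 < R) (hL : Real.exp L < 4) :
    loopIntegral 1 (fun s => betaKernel k s * exp ((L : ℂ) * s)) c R = betaKernelInv k L := by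
  have hm : ∀ y : ℝ, mellin (fun r : ℝ => betaKernelInv k (-(Real.log r : ℝ))) ((c : ℂ) + y * I) =
      betaKernel k ((c : ℂ) + y * I) := fun y =>
    (mellin_betaKernelInv (by simpa using hc) (by simpa using hc1)).2
  have h := mellinInv_mellin_eq c (fun r : ℝ => betaKernelInv k (-(Real.log r : ℝ)))
    (Real.exp_pos (-L)) (mellin_betaKernelInv (by simpa using hc) (by simpa using hc1)).1 ?_ ?_
  · rw [mellinInv_apply_exp_neg, Real.log_exp] at h
    simp only [hm] at h
    rw [loopIntegral_betaKernel_mul_exp hc hc1 hR hL, h]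
    simp
  · rw [VerticalIntegrable]
    simp only [hm]
    exact integrable_betaKernel_vertical hc hc1
  · have h1 : ContinuousAt (fun r : ℝ => (-(Real.log r : ℝ) : ℂ)) (Real.exp (-L)) :=
      (continuous_ofReal.continuousAt.comp (Real.continuousAt_log (Real.exp_pos _).ne')).neg
    refine ContinuousAt.comp' (f := fun r : ℝ => (-(Real.log r : ℝ) : ℂ)) (g := betaKernelInv k)
      (differentiableAt_betaKernelInv k ?_).continuousAt h1
    rw [← ofReal_neg, ← ofReal_exp, ← ofReal_ofNat, ← ofReal_add, ofReal_mem_slitPlane]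
    positivity

/-! ### Analytic continuation in the exponent -/

theorem differentiableAt_integral_mul_exp {μ : Measure ℝ} {ψ g : ℝ → ℂ} {η₀ : ℂ} {ε : ℝ}
    {bound : ℝ → ℝ} (hε : 0 < ε) (hψ : AEStronglyMeasurable ψ μ) (hg : Continuous g)
    (hint : Integrable (fun x => ψ x * exp (η₀ * g x)) μ) (hb : Integrable bound μ)
    (h : ∀ᵐ x ∂μ, ∀ η ∈ Metric.ball η₀ ε, ‖ψ x * (exp (η * g x) * g x)‖ ≤ bound x) :
    DifferentiableAt ℂ (fun η => ∫ x, ψ x * exp (η * g x) ∂μ) η₀ := by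
  refine (hasDerivAt_integral_of_dominated_loc_of_deriv_le (bound := bound)
    (F' := fun η x => ψ x * (exp (η * g x) * g x)) (Metric.ball_mem_nhds η₀ hε)
    (Eventually.of_forall fun η => hψ.mul (by fun_prop : Continuous fun x =>
      exp (η * g x)).aestronglyMeasurable) hint
    (hψ.mul (by fun_prop : Continuous fun x => exp (η₀ * g x) * g x).aestronglyMeasurable)
    h hb (Eventually.of_forall fun x η _ => ?_)).2.differentiableAt
  have := ((hasDerivAt_mul_const (x := η) (g x)).cexp).const_mul (ψ x)
  exact this

theorem differentiableAt_rayIntegral_betaKernel {k η₀ : ℂ} {c y : ℝ} (hc : (1 - k.re) / 2 < c)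
    (hc0 : 0 < c) (hy : |y| = 1) (hη : Real.exp η₀.re < 4) :
    DifferentiableAt ℂ (fun η => ∫ t : ℝ in Ioi 0, betaKernel k ((c + t : ℝ) + (y : ℂ) * I) *
      exp (η * ((c + t : ℝ) + (y : ℂ) * I))) η₀ := by
  have hy0 : y ≠ 0 := by rintro rfl; simp at hy
  have hlog : η₀.re < Real.log 4 := by rwa [Real.lt_log_iff_exp_lt (by norm_num)]
  -- Half the distance to the boundary Re η = log 4, so that the whole ball keeps a common decay
  -- rate δ.
  set ε := (Real.log 4 - η₀.re) / 2 with hε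
  have hε0 : 0 < ε := by rw [hε]; linarith
  have h1 : Real.exp (η₀.re + ε) < 4 := by
    rw [← Real.lt_log_iff_exp_lt (by norm_num)]; rw [hε]; linarith
  obtain ⟨C, δ, hδ, hb⟩ := exists_norm_betaKernel_mul_exp_le hc h1
  have hC0 : 0 ≤ C * Real.exp (-δ * c) * Real.exp (-1) := by
    refine (norm_nonneg _).trans ((hb (c + (y : ℂ) * I) (by simp) (by simp [hy])).trans_eq ?_)
    simp [hy]
  set D := C * Real.exp (-δ * c) * Real.exp (-1) * Real.exp (|η₀.im| + ε) * (c + 1 + 2 / δ)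
  have hreg := loopRegular_betaKernel_mul_exp (k := k) (η := 0) le_rfl (by norm_num)
  have hψ := (hreg.integrableOn hc hy0).aestronglyMeasurable
  simp only [zero_mul, exp_zero, mul_one] at hψ
  refine differentiableAt_integral_mul_exp (bound := fun t => D * Real.exp (-(δ / 2) * t)) hε0
    hψ (by fun_prop)
    ((loopRegular_betaKernel_mul_exp le_rfl hη).integrableOn hc hy0)
    ((exp_neg_integrableOn_Ioi 0 (by positivity)).const_mul _) ?_
  filter_upwards [ae_restrict_mem measurableSet_Ioi] with t ht η hη'
  have ht0 : (0 : ℝ) < t := ht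
  rw [Metric.mem_ball, dist_eq] at hη'
  have h2 : η.re ≤ η₀.re + ε := by
    have := (abs_re_le_norm (η - η₀)).trans hη'.le
    rw [sub_re] at this
    linarith [(abs_le.1 this).2]
  have h3 : |η.im| ≤ |η₀.im| + ε := by
    have := (abs_im_le_norm (η - η₀)).trans hη'.le
    rw [sub_im] at this
    linarith [abs_sub_abs_le_abs_sub η.im η₀.im]
  set s : ℂ := (c + t : ℝ) + (y : ℂ) * I with hs
  have hre : s.re = c + t := by simp [hs]
  have him : s.im = y := by simp [hs]
  have h4 := hb s (by rw [hre]; linarith) (by rw [him, hy])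
  rw [norm_mul, norm_exp_mul_le, ofReal_re, ofReal_im, zero_mul, sub_zero, hre, him, hy] at h4
  have h5 : ‖exp (η * s)‖ ≤ Real.exp ((η₀.re + ε) * (c + t)) * Real.exp (|η₀.im| + ε) := by
    rw [norm_exp_mul_le, ← Real.exp_add, hre, him]
    refine Real.exp_le_exp.2 ?_
    have h6 : -(η.im * y) ≤ |η.im| := by
      refine (neg_le_abs _).trans_eq ?_
      rw [abs_mul, hy, mul_one]
    have h7 : η.re * (c + t) ≤ (η₀.re + ε) * (c + t) := by gcongr
    linarith
  -- Differentiating in η produces a factor s; half of the decay rate pays for it.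
  have h6 : ‖s‖ ≤ (c + 1 + 2 / δ) * Real.exp (δ / 2 * t) := by
    have h7 := norm_le_abs_re_add_abs_im s
    rw [hre, him, hy, abs_of_pos (by linarith)] at h7
    have h8 := Real.add_one_le_exp (δ / 2 * t)
    have h9 : 1 ≤ Real.exp (δ / 2 * t) := Real.one_le_exp (by positivity)
    have h10 : t ≤ 2 / δ * Real.exp (δ / 2 * t) := by
      rw [div_mul_eq_mul_div, le_div_iff₀ hδ]; linarith
    nlinarith
  calc ‖betaKernel k s * (exp (η * s) * s)‖ = ‖betaKernel k s‖ * ‖exp (η * s)‖ * ‖s‖ := by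
        rw [norm_mul, norm_mul, mul_assoc]
    _ ≤ ‖betaKernel k s‖ * (Real.exp ((η₀.re + ε) * (c + t)) * Real.exp (|η₀.im| + ε)) *
          ((c + 1 + 2 / δ) * Real.exp (δ / 2 * t)) := by gcongr
    _ = (‖betaKernel k s‖ * Real.exp ((η₀.re + ε) * (c + t))) * (Real.exp (|η₀.im| + ε) *
          ((c + 1 + 2 / δ) * Real.exp (δ / 2 * t))) := by ring
    _ ≤ (C * Real.exp (-δ * (c + t)) * Real.exp (-1)) * (Real.exp (|η₀.im| + ε) *
          ((c + 1 + 2 / δ) * Real.exp (δ / 2 * t))) := by gcongr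
    _ = D * Real.exp (-(δ / 2) * t) := by
        rw [show -δ * (c + t) = -δ * c + -(δ / 2) * t + -(δ / 2 * t) by ring, Real.exp_add,
          Real.exp_add, Real.exp_neg (δ / 2 * t)]
        have := (Real.exp_pos (δ / 2 * t)).ne'
        simp only [D]
        field_simp

theorem differentiableAt_segmentIntegral_betaKernel {k η₀ : ℂ} {c : ℝ} (hc : (1 - k.re) / 2 < c)
    (hc1 : c < 1) :
    DifferentiableAt ℂ (fun η => ∫ y : ℝ in (-1)..1, betaKernel k ((c : ℂ) + (y : ℂ) * I) *
      exp (η * ((c : ℂ) + (y : ℂ) * I))) η₀ := by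
  have hcont := (loopRegular_betaKernel_mul_exp (k := k) (η := 0) le_rfl
    (by norm_num)).continuous_vertical hc hc1
  simp only [zero_mul, exp_zero, mul_one] at hcont
  obtain ⟨A, hA⟩ := (isCompact_Icc.prod (isCompact_closedBall η₀ 1)).exists_bound_of_continuousOn
    (s := Icc (-1 : ℝ) 1 ×ˢ Metric.closedBall η₀ 1)
    (f := fun p : ℝ × ℂ => betaKernel k ((c : ℂ) + (p.1 : ℂ) * I) *
      (exp (p.2 * ((c : ℂ) + (p.1 : ℂ) * I)) * ((c : ℂ) + (p.1 : ℂ) * I)))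
    ((hcont.comp continuous_fst).mul (by fun_prop)).continuousOn
  simp only [intervalIntegral.integral_of_le (by norm_num : (-1 : ℝ) ≤ 1)]
  refine differentiableAt_integral_mul_exp (bound := fun _ => A) one_pos
    hcont.aestronglyMeasurable (by fun_prop) ?_ (integrable_const _) ?_
  · exact ((hcont.mul (by fun_prop)).continuousOn.integrableOn_Icc).mono_set Ioc_subset_Icc_self
  · filter_upwards [ae_restrict_mem measurableSet_Ioc] with y hy η hη
    exact hA (y, η) ⟨Ioc_subset_Icc_self hy, Metric.ball_subset_closedBall hη⟩

theorem differentiableAt_loopIntegral_betaKernel {k η₀ : ℂ} {c : ℝ} (hc : (1 - k.re) / 2 < c)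
    (hc0 : 0 < c) (hc1 : c < 1) (hη : Real.exp η₀.re < 4) :
    DifferentiableAt ℂ
      (fun η => loopIntegral 1 (fun s => betaKernel k s * exp (η * s)) c 1) η₀ := by
  simp only [loopIntegral_one]
  exact (((differentiableAt_rayIntegral_betaKernel hc hc0 (by norm_num) hη).add
    ((differentiableAt_segmentIntegral_betaKernel hc hc1).const_mul I)).sub
    (differentiableAt_rayIntegral_betaKernel hc hc0 (by norm_num) hη)).const_mul _

/-- Both sides are analytic on the half plane Re η < log 4 and agree at its real points, which
accumulate at 0. On the rays of the loop Im s is fixed, so the size of Im η does no harm. -/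
theorem loopIntegral_betaKernel {k η : ℂ} {c : ℝ} (hc : (1 - k.re) / 2 < c)
    (hc0 : 0 < c) (hc1 : c < 1) (hη : Real.exp η.re < 4) :
    loopIntegral 1 (fun s => betaKernel k s * exp (η * s)) c 1 = betaKernelInv k η := by
  have hU : {η : ℂ | Real.exp η.re < 4} = {η : ℂ | η.re < Real.log 4} := by
    ext; simp only [mem_ofPred_eq]; rw [Real.lt_log_iff_exp_lt (by norm_num)]
  have hopen : IsOpen {η : ℂ | Real.exp η.re < 4} := by
    rw [hU]; exact isOpen_lt continuous_re continuous_const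
  have hconn : IsPreconnected {η : ℂ | Real.exp η.re < 4} := by
    rw [hU]; exact (convex_halfSpace_re_lt _).isPreconnected
  have h1 : AnalyticOnNhd ℂ (fun η => loopIntegral 1 (fun s => betaKernel k s * exp (η * s)) c 1)
      {η : ℂ | Real.exp η.re < 4} := DifferentiableOn.analyticOnNhd (fun η hη =>
    (differentiableAt_loopIntegral_betaKernel hc hc0 hc1 hη).differentiableWithinAt) hopen
  have h2 : AnalyticOnNhd ℂ (betaKernelInv k) {η : ℂ | Real.exp η.re < 4} := by
    refine DifferentiableOn.analyticOnNhd (fun η hη =>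
      (differentiableAt_betaKernelInv k ?_).differentiableWithinAt) hopen
    refine mem_slitPlane_iff.2 (Or.inl ?_)
    have h3 : ‖exp η‖ < 4 := by rw [norm_exp]; exact hη
    have := (abs_le.1 (abs_re_le_norm (exp η))).1
    simp only [add_re, re_ofNat]
    linarith
  refine h1.eqOn_of_preconnected_of_frequently_eq h2 hconn (z₀ := 0) (by simp) ?_ hη
  have ht : Tendsto (fun x : ℝ => (x : ℂ)) (𝓝[≠] 0) (𝓝[≠] 0) := by
    refine tendsto_nhdsWithin_iff.2 ⟨?_, ?_⟩
    · exact (continuous_ofReal.tendsto' 0 0 ofReal_zero).mono_left nhdsWithin_le_nhds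
    · filter_upwards [self_mem_nhdsWithin] with x hx
      simpa using hx
  refine ht.frequently (Eventually.frequently ?_)
  have : ∀ᶠ x : ℝ in 𝓝[≠] 0, x < Real.log 4 :=
    nhdsWithin_le_nhds (eventually_lt_nhds (Real.log_pos (by norm_num)))
  filter_upwards [this] with x hx
  rw [Real.lt_log_iff_exp_lt (by norm_num)] at hx
  exact loopIntegral_betaKernel_ofReal hc hc1 one_pos hx

/-! ### The term with kernel 1/sin(πs) -/

theorem image_div_one_sub : (fun t : ℝ => t / (1 - t)) '' Ioo 0 1 = Ioi 0 := by
  ext r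
  constructor
  · rintro ⟨t, ⟨h0, h1⟩, rfl⟩
    exact div_pos h0 (by linarith)
  · intro hr
    have hr0 : 0 < r := hr
    refine ⟨r / (1 + r), ⟨by positivity, (div_lt_one (by linarith)).2 (by linarith)⟩, ?_⟩
    simp only
    field_simp
    ring

/-- The substitution r = t/(1-t) gives B(s, 1-s), which the reflection formula evaluates. -/
theorem mellin_inv_one_add {s : ℂ} (hs : 0 < s.re) (hs1 : s.re < 1) :
    MellinConvergent (fun r : ℝ => ((1 + r : ℝ) : ℂ)⁻¹) s ∧
      mellin (fun r : ℝ => ((1 + r : ℝ) : ℂ)⁻¹) s = Real.pi / sin (Real.pi * s) := by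
  have h1s : 0 < (1 - s).re := by rw [sub_re, one_re]; linarith
  have e : betaIntegral s (1 - s) = Real.pi / sin (Real.pi * s) := by
    rw [betaIntegral_eq_Gamma_mul_div _ _ hs h1s, Gamma_mul_Gamma_one_sub]
    simp
  rw [← e]
  refine mellin_eq_betaIntegral (φ := fun t => t / (1 - t)) (φ' := fun t => 1 / (1 - t) ^ 2) hs h1s
    (fun t ht => ?_) (fun t ht => by positivity) (fun a ha b hb h => ?_) image_div_one_sub
    (fun t ht => ?_)
  · have h1 : 1 - t ≠ 0 := by linarith [ht.2]
    refine ((hasDerivAt_id' t).fun_div ((hasDerivAt_id' t).const_sub 1) h1).congr_deriv ?_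
    field_simp; ring
  · have h1 : 1 - a ≠ 0 := by linarith [ha.2]
    have h2 : 1 - b ≠ 0 := by linarith [hb.2]
    simp only at h
    rw [div_eq_div_iff h1 h2] at h
    linarith
  · have h2 : 0 < 1 - t := by linarith [ht.2]
    have ht1 : (1 - t : ℂ) ≠ 0 := by exact_mod_cast h2.ne'
    have e1 : ((t / (1 - t) : ℝ) : ℂ) ^ (s - 1) = (t : ℂ) ^ (s - 1) * (1 - t : ℂ) ^ (1 - s) := by
      rw [div_eq_mul_inv, ofReal_mul, mul_cpow_ofReal_nonneg ht.1.le (inv_nonneg.2 h2.le),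
        ofReal_inv, inv_cpow _ _ (by
          rw [arg_ofReal_of_nonneg h2.le]; exact Real.pi_pos.ne), ← cpow_neg, neg_sub]
      push_cast; rfl
    rw [e1, show 1 - s = (1 - s - 1) + 1 by ring, cpow_add _ _ ht1, cpow_one]
    have e2 : ((1 + t / (1 - t) : ℝ) : ℂ)⁻¹ = 1 - t := by
      rw [← ofReal_inv, show (1 + t / (1 - t))⁻¹ = 1 - t by field_simp; ring]; push_cast; rfl
    rw [e2]
    push_cast
    field_simp
    ring_nf

theorem continuous_inv_sin_vertical {c : ℝ} (hc : 0 < c) (hc1 : c < 1) :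
    Continuous fun y : ℝ => (Real.pi : ℂ) / sin (Real.pi * ((c : ℂ) + y * I)) :=
  Continuous.div (by fun_prop) (by fun_prop) fun y =>
    sin_pi_mul_ne_zero_of_re_pos (by simpa using hc) (by simp [hc1])

theorem integrable_inv_sin_vertical {c : ℝ} (hc : 0 < c) (hc1 : c < 1) :
    Integrable fun y : ℝ => (Real.pi : ℂ) / sin (Real.pi * ((c : ℂ) + y * I)) := by
  refine integrable_of_norm_le_exp_neg_abs (C := 4 * Real.pi) (continuous_inv_sin_vertical hc hc1)
    (fun y hy => ?_)
  have h := abs_sinh_im_le_norm_sin (Real.pi * ((c : ℂ) + y * I))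
  rw [im_ofReal_mul] at h
  simp only [add_im, ofReal_im, mul_im, ofReal_re, I_im, mul_one, I_re, mul_zero, add_zero,
    zero_add] at h
  have h2 : |y| ≤ |Real.pi * y| := by
    rw [abs_mul, abs_of_pos Real.pi_pos]
    exact le_mul_of_one_le_left (abs_nonneg _) (by linarith [Real.pi_gt_three])
  have h3 := exp_div_four_le_abs_sinh (u := Real.pi * y) (by linarith)
  have h4 : Real.exp |y| / 4 ≤ ‖sin (Real.pi * ((c : ℂ) + y * I))‖ := by
    refine le_trans ?_ (h3.trans h)
    gcongr
  rw [norm_div, norm_real, Real.norm_of_nonneg Real.pi_pos.le, Real.exp_neg]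
  have := Real.exp_pos |y|
  rw [div_le_iff₀ (lt_of_lt_of_le (by positivity) h4)]
  calc Real.pi = 4 * Real.pi * (Real.exp |y|)⁻¹ * (Real.exp |y| / 4) := by field_simp
    _ ≤ _ := by gcongr

theorem integral_inv_sin_vertical {c : ℝ} (hc : 0 < c) (hc1 : c < 1) (ω : ℝ) :
    ∫ y : ℝ, Real.pi / sin (Real.pi * ((c : ℂ) + y * I)) * exp ((ω : ℂ) * ((c : ℂ) + y * I)) =
      2 * Real.pi * ((1 + Real.exp (-ω) : ℝ) : ℂ)⁻¹ := by
  have hm : ∀ y : ℝ, mellin (fun r : ℝ => ((1 + r : ℝ) : ℂ)⁻¹) ((c : ℂ) + y * I) =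
      Real.pi / sin (Real.pi * ((c : ℂ) + y * I)) := fun y =>
    (mellin_inv_one_add (by simpa using hc) (by simpa using hc1)).2
  have hpi : (Real.pi : ℂ) ≠ 0 := by exact_mod_cast Real.pi_ne_zero
  have h := mellinInv_mellin_eq c (fun r : ℝ => ((1 + r : ℝ) : ℂ)⁻¹)
    (Real.exp_pos (-ω)) (mellin_inv_one_add (by simpa using hc) (by simpa using hc1)).1 ?_ ?_
  · rw [mellinInv_apply_exp_neg] at h
    simp only [hm] at h
    rw [← h, ← mul_assoc, mul_inv_cancel₀ (mul_ne_zero two_ne_zero hpi), one_mul]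
  · rw [VerticalIntegrable]
    simp only [hm]
    exact integrable_inv_sin_vertical hc hc1
  · refine ContinuousAt.inv₀ (by fun_prop) ?_
    exact_mod_cast (by positivity : (0 : ℝ) < 1 + Real.exp (-ω)).ne'

theorem cpow_mul_one_sub_cpow_eq {k : ℂ} {s : ℂ} {t : ℝ} (ht : t ∈ Ioo (0 : ℝ) 1) :
    (t : ℂ) ^ (s + k / 2 - 1 / 2 - 1) * (1 - (t : ℂ)) ^ (2 - 2 * s - 1) =
      (t : ℂ) ^ (k / 2 - 3 / 2) * (1 - t) *
        exp (((Real.log t - 2 * Real.log (1 - t) : ℝ) : ℂ) * s) := by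
  have h2 : 0 < 1 - t := by linarith [ht.2]
  have ht0 : (t : ℂ) ≠ 0 := by exact_mod_cast ht.1.ne'
  have ht1 : (1 - t : ℂ) ≠ 0 := by exact_mod_cast h2.ne'
  have e1 : log (1 - t : ℂ) = Real.log (1 - t) := by
    rw [ofReal_log h2.le]; push_cast; rfl
  have e2 : (1 - t : ℂ) = exp (Real.log (1 - t)) := by rw [← e1, exp_log ht1]
  rw [cpow_def_of_ne_zero ht0, cpow_def_of_ne_zero ht0, cpow_def_of_ne_zero ht1, e1,
    ← ofReal_log ht.1.le, e2, ← exp_add, ← exp_add, ← exp_add]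
  congr 1
  push_cast; ring

/-- The double integral behind the evaluation of the Mellin-Barnes integral with kernel
`1 / sin (π s)`. -/
theorem loopIntegral_betaKernel_div_sin_eq {k : ℂ} {c R L : ℝ} (hc : (1 - k.re) / 2 < c)
    (hc0 : 0 < c) (hc1 : c < 1) (hR : 0 < R) (hL : Real.exp L < 4) :
    loopIntegral 1 (fun s => betaKernel k s * exp ((L : ℂ) * s) / sin (Real.pi * s)) c R =
      (Real.pi : ℂ)⁻¹ * ∫ t : ℝ in Ioo 0 1, (t : ℂ) ^ (k / 2 - 3 / 2) * (1 - t) *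
        ((1 + (1 - t) ^ 2 / (t * Real.exp L) : ℝ) : ℂ)⁻¹ := by
  have hpi : (Real.pi : ℂ) ≠ 0 := by exact_mod_cast Real.pi_ne_zero
  rw [loopIntegral_betaKernel_div_sin hc hc0 hc1 hR hL]
  set ψ : ℝ → ℂ := fun y => Real.pi / sin (Real.pi * ((c : ℂ) + y * I)) *
    exp ((L : ℂ) * ((c : ℂ) + y * I)) with hψ
  set B : ℝ → ℝ → ℂ := fun y t => (t : ℂ) ^ (k / 2 - 3 / 2) * (1 - t) *
    exp (((Real.log t - 2 * Real.log (1 - t) : ℝ) : ℂ) * ((c : ℂ) + y * I)) with hB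
  have hbeta : ∀ y : ℝ, betaKernel k ((c : ℂ) + y * I) = ∫ t : ℝ in Ioo 0 1, B y t := by
    intro y
    rw [betaKernel_eq_betaIntegral (by simpa using hc) (by simpa using hc1), betaIntegral,
      intervalIntegral.integral_of_le zero_le_one, integral_Ioc_eq_integral_Ioo]
    exact setIntegral_congr_fun measurableSet_Ioo fun t ht => cpow_mul_one_sub_cpow_eq ht
  have hBint : IntegrableOn (B 0) (Ioo 0 1) := by
    have := betaIntegral_convergent (u := (c : ℂ) + k / 2 - 1 / 2) (v := 2 - 2 * (c : ℂ))
      (betaKernel_arg_re_pos (by simpa using hc)) (by simp; linarith)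
    rw [intervalIntegrable_iff_integrableOn_Ioc_of_le zero_le_one,
      integrableOn_Ioc_iff_integrableOn_Ioo] at this
    refine this.congr_fun (fun t ht => ?_) measurableSet_Ioo
    rw [hB]
    simp only [ofReal_zero, zero_mul, add_zero]
    exact cpow_mul_one_sub_cpow_eq ht
  have hψint : Integrable ψ := by
    have h1 := (integrable_inv_sin_vertical hc0 hc1).norm.mul_const (Real.exp (L * c))
    refine h1.mono' ((continuous_inv_sin_vertical hc0 hc1).mul
      (by fun_prop)).aestronglyMeasurable (Eventually.of_forall fun y => ?_)
    rw [hψ]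
    simp only [norm_mul, norm_exp_mul_le]
    simp
  -- The modulus of B y t does not depend on y, so the double integrand is dominated by a product of
  -- two integrable functions of one variable.
  have hprod : Integrable (fun p : ℝ × ℝ => ψ p.1 * B p.1 p.2)
      (volume.prod (volume.restrict (Ioo 0 1))) := by
    refine (hψint.norm.mul_prod hBint.norm).mono' ?_ (Eventually.of_forall fun p => ?_)
    · refine (hψint.aestronglyMeasurable.comp_fst).mul ?_
      refine Measurable.aestronglyMeasurable ?_
      rw [hB]
      fun_prop
    · rw [norm_mul, hB]
      simp only [norm_mul, norm_exp_mul_le]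
      simp
  have h1 : ∫ y : ℝ, betaKernel k ((c : ℂ) + y * I) * exp ((L : ℂ) * ((c : ℂ) + y * I)) /
      sin (Real.pi * ((c : ℂ) + y * I)) =
      (Real.pi : ℂ)⁻¹ * ∫ y : ℝ, ∫ t : ℝ in Ioo 0 1, ψ y * B y t := by
    rw [← integral_const_mul]
    congr 1
    funext y
    rw [hbeta, integral_const_mul, hψ]
    simp only
    field_simp
  rw [h1, integral_integral_swap hprod, ← integral_const_mul, ← integral_const_mul,
    ← integral_const_mul]
  refine setIntegral_congr_fun measurableSet_Ioo fun t ht => ?_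
  have h2 : 0 < 1 - t := by linarith [ht.2]
  have h3 : ∫ y : ℝ, ψ y * B y t = (t : ℂ) ^ (k / 2 - 3 / 2) * (1 - t) *
      (2 * Real.pi * ((1 + Real.exp (-(L + (Real.log t - 2 * Real.log (1 - t)))) : ℝ) : ℂ)⁻¹) := by
    rw [← integral_inv_sin_vertical hc0 hc1, ← integral_const_mul]
    congr 1
    funext y
    rw [hψ, hB]
    simp only
    rw [ofReal_add, add_mul, exp_add]
    ring
  have h4 : Real.exp (-(L + (Real.log t - 2 * Real.log (1 - t)))) =
      (1 - t) ^ 2 / (t * Real.exp L) := by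
    rw [show -(L + (Real.log t - 2 * Real.log (1 - t))) =
      Real.log (1 - t) + Real.log (1 - t) - (Real.log t + L) by ring, Real.exp_sub, Real.exp_add,
      Real.exp_add, Real.exp_log h2, Real.exp_log ht.1, sq]
  rw [h3, h4]
  field_simp

/-! ### Splitting the sum of the two G-functions -/

theorem LoopRegular.add {σ : ℝ} {f g : ℂ → ℂ} (hf : LoopRegular σ f) (hg : LoopRegular σ g) :
    LoopRegular σ (fun s => f s + g s) := by
  refine ⟨fun s h1 h2 => (hf.differentiableAt s h1 h2).add (hg.differentiableAt s h1 h2),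
    fun c r R hc hr => ?_⟩
  obtain ⟨C₁, δ₁, hδ₁, h₁⟩ := hf.decay c r R hc hr
  obtain ⟨C₂, δ₂, hδ₂, h₂⟩ := hg.decay c r R hc hr
  set δ := min δ₁ δ₂
  refine ⟨|C₁| * Real.exp ((δ - δ₁) * c) + |C₂| * Real.exp ((δ - δ₂) * c), δ, lt_min hδ₁ hδ₂,
    fun s hs h3 h4 => ?_⟩
  have key : ∀ C δ' : ℝ, δ ≤ δ' → C * Real.exp (-δ' * s.re) ≤
      |C| * Real.exp ((δ - δ') * c) * Real.exp (-δ * s.re) := by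
    intro C δ' hδ'
    rw [mul_assoc, ← Real.exp_add]
    refine mul_le_mul (le_abs_self C) (Real.exp_le_exp.2 ?_) (Real.exp_pos _).le (abs_nonneg C)
    nlinarith
  refine (norm_add_le _ _).trans ?_
  rw [add_mul]
  exact add_le_add ((h₁ s hs h3 h4).trans (key _ _ (min_le_left _ _)))
    ((h₂ s hs h3 h4).trans (key _ _ (min_le_right _ _)))

theorem LoopRegular.const_mul {σ : ℝ} {f : ℂ → ℂ} (hf : LoopRegular σ f) (a : ℂ) :
    LoopRegular σ (fun s => a * f s) := by
  refine ⟨fun s h1 h2 => (hf.differentiableAt s h1 h2).const_mul a, fun c r R hc hr => ?_⟩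
  obtain ⟨C, δ, hδ, h⟩ := hf.decay c r R hc hr
  refine ⟨‖a‖ * C, δ, hδ, fun s hs h3 h4 => ?_⟩
  rw [norm_mul, mul_assoc]
  exact mul_le_mul_of_nonneg_left (h s hs h3 h4) (norm_nonneg a)

theorem half_sub_ne_neg_natCast {s : ℂ} (hs : 1 / 2 < s.re) (h : s.re < 1 ∨ s.im ≠ 0) (m : ℕ) :
    1 / 2 - s ≠ -m := by
  rintro h1
  have hs' : s = ((1 / 2 + m : ℝ) : ℂ) := by push_cast; linear_combination -h1
  rw [hs', ofReal_re, ofReal_im] at h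
  rw [hs', ofReal_re] at hs
  have h2 : (m : ℝ) < 1 := by
    rcases h with h | h
    · linarith
    · exact absurd rfl h
  have h3 : m = 0 := by
    have : m < 1 := by exact_mod_cast h2
    omega
  rw [h3] at hs
  norm_num at hs

theorem cpow_mul_two_cpow {x : ℝ} (hx : 0 < x) (s : ℂ) :
    (x : ℂ) ^ s * (2 : ℂ) ^ (2 * s) = exp ((Real.log (4 * x) : ℝ) * s) := by
  have e : Real.log (4 * x) = 2 * Real.log 2 + Real.log x := by
    rw [Real.log_mul (by norm_num) hx.ne', show (4 : ℝ) = 2 ^ 2 by norm_num, Real.log_pow]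
    norm_num
  rw [cpow_def_of_ne_zero (by exact_mod_cast hx.ne'), cpow_def_of_ne_zero two_ne_zero, e,
    ← ofReal_log hx.le, show log 2 = (Real.log 2 : ℝ) by rw [ofReal_log (by norm_num)]; norm_num,
    ← exp_add]
  congr 1; push_cast; ring

/-- The linear factors add up to 2(1/2 - s). Reflection of 1/Γ(1/2+s) supplies Γ(1/2-s), the two
combine to Γ(3/2-s), and duplication merges this with Γ(1-s). Writing cos(πk/2) as the cosine of a
difference separates off the pure sine term, which has no denominator. The bound Re s > 1/2 keeps
Γ(1/2-s) away from its first pole. -/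
theorem integrand₃₃_add_integrand₃₃ {k s : ℂ} {x : ℝ} (hx : 0 < x) (hk : (1 - k.re) / 2 < s.re)
    (hs : 1 / 2 < s.re) (h : s.re < 1 ∨ s.im ≠ 0) :
    integrand₃₃ ((1 + k) / 2) ((3 - k) / 2) x s + integrand₃₃ ((1 + -k) / 2) ((3 - -k) / 2) x s =
      ((√Real.pi : ℝ) : ℂ)⁻¹ * (betaKernel k s * exp ((Real.log (4 * x) : ℝ) * s) *
        (sin (Real.pi * (s + k / 2)) - cos (Real.pi * k / 2) / sin (Real.pi * s))) := by
  have hpi : (Real.pi : ℂ) ≠ 0 := by exact_mod_cast Real.pi_ne_zero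
  have hp : ((√Real.pi : ℝ) : ℂ) ≠ 0 := by
    exact_mod_cast (Real.sqrt_pos.2 Real.pi_pos).ne'
  have hp2 : ((√Real.pi : ℝ) : ℂ) * ((√Real.pi : ℝ) : ℂ) = Real.pi := by
    rw [← ofReal_mul, Real.mul_self_sqrt Real.pi_pos.le]
  have hsin := sin_pi_mul_ne_zero_of_re_pos (s := s) (by linarith) h
  have h1 : Gamma s * Gamma (1 - s) = Real.pi / sin (Real.pi * s) := Gamma_mul_Gamma_one_sub s
  have h2 := Gamma_one_sub_inv (Gamma_ne_zero (half_sub_ne_neg_natCast hs h))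
  rw [show 1 - (1 / 2 - s) = 1 / 2 + s by ring, show (Real.pi : ℂ) * (1 / 2 - s) =
    Real.pi / 2 - Real.pi * s by ring, sin_pi_div_two_sub] at h2
  have h0 : 1 / 2 - s ≠ 0 := by simpa using half_sub_ne_neg_natCast hs h 0
  have h3 : Gamma (3 / 2 - s) = (1 / 2 - s) * Gamma (1 / 2 - s) := by
    rw [← Gamma_add_one _ h0]; ring_nf
  have h4 : (Gamma ((1 + k) / 2 - s))⁻¹ =
      ((1 + k) / 2 - s) * (Gamma (3 / 2 + k / 2 - s))⁻¹ := by
    rw [Gamma_inv_eq]; ring_nf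
  have h5 : (Gamma ((1 + -k) / 2 - s))⁻¹ =
      ((1 - k) / 2 - s) * (Gamma (3 / 2 - k / 2 - s))⁻¹ := by
    rw [Gamma_inv_eq]; ring_nf
  have h6 := Gamma_mul_cos_eq hk
  have h7 := Gamma_mul_Gamma_add_half (1 - s)
  rw [show 1 - s + 1 / 2 = 3 / 2 - s by ring, show 1 - 2 * (1 - s) = 2 * s - 1 by ring,
    show 2 * (1 - s) = 2 - 2 * s by ring, cpow_sub _ _ two_ne_zero, cpow_one] at h7
  have h8 := cpow_mul_two_cpow hx s
  have h9 : cos (Real.pi * k / 2) = cos (Real.pi * s) * cos (Real.pi * (s + k / 2)) +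
      sin (Real.pi * s) * sin (Real.pi * (s + k / 2)) := by
    rw [← cos_sub, ← cos_neg]; congr 1; ring
  simp only [integrand₃₃, betaKernel]
  rw [h4, h5, show (3 - k) / 2 - s = 3 / 2 - k / 2 - s by ring,
    show (3 - -k) / 2 - s = 3 / 2 + k / 2 - s by ring, h2]
  set P := (Gamma (3 / 2 + k / 2 - s))⁻¹
  set Q := (Gamma (3 / 2 - k / 2 - s))⁻¹
  have e1 : sin (Real.pi * (s + k / 2)) - cos (Real.pi * k / 2) / sin (Real.pi * s) =
      -(cos (Real.pi * s) * cos (Real.pi * (s + k / 2)) / sin (Real.pi * s)) := by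
    rw [h9]; field_simp; ring
  rw [e1, ← h8]
  calc _ = (Gamma s * Gamma (1 - s)) * (Gamma (1 - s) * ((1 / 2 - s) * Gamma (1 / 2 - s))) * 2 *
        cos (Real.pi * s) / Real.pi * P * Q * (x : ℂ) ^ s := by ring
    _ = Real.pi / sin (Real.pi * s) * (Gamma (2 - 2 * s) * ((2 : ℂ) ^ (2 * s) / 2) *
        (√Real.pi : ℝ)) * 2 *
        cos (Real.pi * s) / Real.pi * P * Q * (x : ℂ) ^ s := by rw [h1, ← h3, h7]
    _ = ((√Real.pi : ℝ) : ℂ)⁻¹ * (√Real.pi * √Real.pi : ℂ) / sin (Real.pi * s) *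
        (Gamma (2 - 2 * s) * (2 : ℂ) ^ (2 * s)) *
        cos (Real.pi * s) * P * Q * (x : ℂ) ^ s := by field_simp
    _ = -(((√Real.pi : ℝ) : ℂ)⁻¹ / sin (Real.pi * s) * (Gamma (2 - 2 * s) * (2 : ℂ) ^ (2 * s)) *
        cos (Real.pi * s) * P * (-Real.pi * Q) * (x : ℂ) ^ s) := by rw [hp2]; ring
    _ = _ := by rw [← h6]; ring

/-- Here e^η = -4cos² b, so √(e^η+4) = 2 sin b, and the argument of the logarithm is sin b + iε cos
b = e^(iε(π/2-b)), a point of the unit circle. -/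
theorem betaKernelInv_log_add {k : ℂ} {b ε : ℝ} (hb0 : 0 < b) (hb1 : b < Real.pi / 2)
    (hε : ε = 1 ∨ ε = -1) :
    betaKernelInv k ((Real.log (4 * Real.cos b ^ 2) : ℝ) + ε * Real.pi * I) =
      -(2 * (Real.cos b : ℂ) ^ 2 / Real.sin b) * exp (-(ε * (k * (Real.pi / 2 - b) * I))) := by
  have hc : 0 < Real.cos b := Real.cos_pos_of_mem_Ioo ⟨by linarith, hb1⟩
  have hs : 0 < Real.sin b := Real.sin_pos_of_pos_of_lt_pi hb0 (by linarith)
  have hexp : exp (ε * Real.pi * I) = -1 := by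
    rcases hε with rfl | rfl
    · simp
    · rw [ofReal_neg, ofReal_one, neg_one_mul, neg_mul, exp_neg, exp_pi_mul_I]; norm_num
  have hexp2 : exp (ε * Real.pi * I / 2) = ε * I := by
    rcases hε with rfl | rfl
    · rw [ofReal_one, one_mul, one_mul, mul_div_right_comm, exp_pi_div_two_mul_I]
    · rw [ofReal_neg, ofReal_one, neg_one_mul, neg_mul, neg_div, mul_div_right_comm, exp_neg,
        exp_pi_div_two_mul_I, inv_I, neg_one_mul]
  have hL : Real.log (4 * Real.cos b ^ 2) = 2 * Real.log (2 * Real.cos b) := by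
    rw [show 4 * Real.cos b ^ 2 = (2 * Real.cos b) ^ 2 by ring, Real.log_pow]; norm_num
  have a1 : exp ((Real.log (4 * Real.cos b ^ 2) : ℝ) + ε * Real.pi * I) =
      -(4 * (Real.cos b : ℂ) ^ 2) := by
    rw [exp_add, hexp, ← ofReal_exp, Real.exp_log (by positivity)]; push_cast; ring
  have a2 : exp (((Real.log (4 * Real.cos b ^ 2) : ℝ) + ε * Real.pi * I) / 2) =
      ε * (2 * Real.cos b * I) := by
    rw [add_div, exp_add, hexp2, hL, ofReal_mul, ofReal_ofNat, mul_div_cancel_left₀ _ two_ne_zero,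
      ← ofReal_exp, Real.exp_log (by positivity)]
    push_cast; ring
  have a3 : exp (log (-(4 * (Real.cos b : ℂ) ^ 2) + 4) / 2) = 2 * Real.sin b := by
    have : -(4 * (Real.cos b : ℂ) ^ 2) + 4 = (((2 * Real.sin b) ^ 2 : ℝ) : ℂ) := by
      have h := Real.sin_sq_add_cos_sq b
      rw [show (2 * Real.sin b) ^ 2 = -(4 * Real.cos b ^ 2) + 4 by linear_combination 4 * h]
      push_cast; ring
    rw [this, ← ofReal_log (by positivity), Real.log_pow, Nat.cast_ofNat, ofReal_mul, ofReal_ofNat,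
      mul_div_cancel_left₀ _ two_ne_zero, ← ofReal_exp, Real.exp_log (by positivity)]
    push_cast; ring
  have a4 : log ((ε * (2 * Real.cos b * I) + 2 * Real.sin b) / 2) =
      ((ε * (Real.pi / 2 - b) : ℝ) : ℂ) * I := by
    have h1 : (ε * (2 * Real.cos b * I) + 2 * Real.sin b : ℂ) / 2 =
        exp (((ε * (Real.pi / 2 - b) : ℝ) : ℂ) * I) := by
      rw [exp_mul_I, ← ofReal_cos, ← ofReal_sin]
      rcases hε with rfl | rfl
      · rw [one_mul, Real.cos_pi_div_two_sub, Real.sin_pi_div_two_sub]; push_cast; ring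
      · rw [neg_one_mul, Real.cos_neg, Real.sin_neg, Real.cos_pi_div_two_sub,
          Real.sin_pi_div_two_sub]
        push_cast; ring
    rw [h1, log_exp]
    · simp only [mul_im, ofReal_re, ofReal_im, I_im, I_re]
      rcases hε with rfl | rfl <;> nlinarith [Real.pi_pos]
    · simp only [mul_im, ofReal_re, ofReal_im, I_im, I_re]
      rcases hε with rfl | rfl <;> nlinarith [Real.pi_pos]
  have hsC : (Real.sin b : ℂ) ≠ 0 := by exact_mod_cast hs.ne'
  rw [betaKernelInv, a1, a2, a3, a4]
  have e : -k * (((ε * (Real.pi / 2 - b) : ℝ) : ℂ) * I) = -(ε * (k * (Real.pi / 2 - b) * I)) := by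
    push_cast; ring
  rw [e]
  field_simp
  ring

theorem setIntegral_comp_sq (k : ℂ) {x : ℝ} (hx : 0 < x) :
    ∫ t : ℝ in Ioo 0 1, (t : ℂ) ^ (k / 2 - 3 / 2) * (1 - t) *
        ((1 + (1 - t) ^ 2 / (t * (4 * x)) : ℝ) : ℂ)⁻¹ =
      8 * x * ∫ τ : ℝ in Ioo 0 1, (τ : ℂ) ^ k *
        (((1 - τ ^ 2) / ((1 - τ ^ 2) ^ 2 + 4 * x * τ ^ 2) : ℝ) : ℂ) := by
  have himg : (fun τ : ℝ => τ ^ 2) '' Ioo 0 1 = Ioo 0 1 := by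
    ext t
    constructor
    · rintro ⟨τ, ⟨h0, h1⟩, rfl⟩
      exact ⟨by positivity, by simp only; nlinarith⟩
    · rintro ⟨h0, h1⟩
      exact ⟨√t, ⟨Real.sqrt_pos.2 h0, (Real.sqrt_lt' one_pos).2 (by simpa using h1)⟩,
        Real.sq_sqrt h0.le⟩
  have hinj : InjOn (fun τ : ℝ => τ ^ 2) (Ioo 0 1) := fun a ha b hb h =>
    (pow_left_inj₀ ha.1.le hb.1.le two_ne_zero).1 h
  have hd : ∀ τ ∈ Ioo (0 : ℝ) 1, HasDerivWithinAt (fun τ : ℝ => τ ^ 2) (2 * τ) (Ioo 0 1) τ :=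
    fun τ _ => by simpa using (hasDerivAt_pow 2 τ).hasDerivWithinAt
  conv_lhs => rw [← himg]
  rw [integral_image_eq_integral_abs_deriv_smul measurableSet_Ioo hd hinj, ← integral_const_mul]
  refine setIntegral_congr_fun measurableSet_Ioo fun τ ⟨h0, h1⟩ => ?_
  have hτ : (τ : ℂ) ≠ 0 := by exact_mod_cast h0.ne'
  -- Of the three extra powers of τ, one comes from the Jacobian and two from clearing the
  -- denominator of the inner fraction.
  have e1 : ((τ ^ 2 : ℝ) : ℂ) ^ (k / 2 - 3 / 2) * (τ : ℂ) ^ 3 = (τ : ℂ) ^ k := by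
    have h2 : (0 : ℝ) < τ ^ 2 := by positivity
    rw [cpow_def_of_ne_zero (by exact_mod_cast h2.ne'), ← ofReal_log h2.le, Real.log_pow,
      cpow_def_of_ne_zero hτ]
    conv_lhs => rw [← exp_log hτ, ← exp_nat_mul, ← exp_add]
    congr 1
    rw [← ofReal_log h0.le]
    push_cast; ring
  have e2 : (1 + (1 - τ ^ 2) ^ 2 / (τ ^ 2 * (4 * x)))⁻¹ =
      4 * x * τ ^ 2 / ((1 - τ ^ 2) ^ 2 + 4 * x * τ ^ 2) := by
    have : 0 < (1 - τ ^ 2) ^ 2 + 4 * x * τ ^ 2 := by positivity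
    field_simp
    ring
  rw [← ofReal_inv, e2, abs_of_pos (by positivity), real_smul, ← e1]
  push_cast
  ring

/-- The real-parameter integral `∫₀¹ τ^k (1 - τ²) / ((1 - τ²)² + 4 x τ²) dτ`. -/
noncomputable def kernelIntegral (k : ℂ) (x : ℝ) : ℂ :=
  ∫ τ : ℝ in Ioo 0 1, (τ : ℂ) ^ k *
    (((1 - τ ^ 2) / ((1 - τ ^ 2) ^ 2 + 4 * x * τ ^ 2) : ℝ) : ℂ)

theorem meijerG_add_meijerG {k : ℂ} {b : ℝ} (hk : -1 < k.re) (hb0 : 0 < b)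
    (hb1 : b < Real.pi / 2) :
    meijerG 2 1 (upperParams k) lowerParams (Real.cos b ^ 2 : ℝ) +
      meijerG 2 1 (upperParams (-k)) lowerParams (Real.cos b ^ 2 : ℝ) =
      -(((√Real.pi : ℝ) : ℂ)⁻¹ * (cos (Real.pi * k / 2) * ((Real.pi : ℂ)⁻¹ *
        (8 * (Real.cos b : ℂ) ^ 2 * kernelIntegral k (Real.cos b ^ 2))) +
        2 * (Real.cos b : ℂ) ^ 2 / Real.sin b * sin (k * b))) := by
  have hcos : 0 < Real.cos b := Real.cos_pos_of_mem_Ioo ⟨by linarith, hb1⟩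
  have hsin : 0 < Real.sin b := Real.sin_pos_of_pos_of_lt_pi hb0 (by linarith)
  set x := Real.cos b ^ 2 with hx
  have hx0 : 0 < x := by positivity
  have hx1 : x < 1 := by nlinarith [Real.sin_sq_add_cos_sq b]
  -- The first bound avoids the pole of Γ(1/2-s), the second those of Γ(s+k/2-1/2). Since Re k > -1,
  -- a line σ < Re s = c < 1 exists, and it is admissible for both G-functions.
  set σ := max (1 / 2) ((1 - k.re) / 2) with hσ
  have hσ1 : σ < 1 := max_lt (by norm_num) (by linarith)
  have hσ2 : 1 / 2 ≤ σ := le_max_left _ _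
  have hσ3 : (1 - k.re) / 2 ≤ σ := le_max_right _ _
  obtain ⟨c, hc, hc1⟩ := exists_between hσ1
  have hc0 : 0 < c := by linarith
  have hkc : (1 - k.re) / 2 < c := by linarith
  set L := Real.log (4 * x) with hL
  have hL4 : Real.exp L = 4 * x := Real.exp_log (by positivity)
  have hre : ∀ ε : ℝ, ((L : ℂ) + ε * Real.pi * I).re = L := fun ε => by simp
  have hreg1 : ∀ ε : ℝ, LoopRegular σ
      (fun s => betaKernel k s * exp (((L : ℂ) + ε * Real.pi * I) * s)) := fun ε =>
    loopRegular_betaKernel_mul_exp hσ3 (by rw [hre, hL4]; linarith)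
  have hreg2 : LoopRegular σ (fun s => betaKernel k s * exp ((L : ℂ) * s) / sin (Real.pi * s)) :=
    loopRegular_betaKernel_div_sin hσ3 (by linarith) (by rw [ofReal_re, hL4]; linarith)
  have hK : ∀ ε : ℝ, (ε = 1 ∨ ε = -1) →
      loopIntegral 1 (fun s => betaKernel k s * exp (((L : ℂ) + ε * Real.pi * I) * s)) c 1 =
      -(2 * (Real.cos b : ℂ) ^ 2 / Real.sin b) * exp (-(ε * (k * (Real.pi / 2 - b) * I))) :=
    fun ε hε => by
      rw [loopIntegral_betaKernel hkc hc0 hc1 (by rw [hre, hL4]; linarith), hL, hx,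
        betaKernelInv_log_add hb0 hb1 hε]
  rw [upperParams, upperParams, meijerG₃₃_eq_loopIntegral _ _ hx0 hx1 hc0 hc1 one_pos,
    meijerG₃₃_eq_loopIntegral _ _ hx0 hx1 hc0 hc1 one_pos,
    ← (loopRegular_integrand₃₃ _ _ hx0 hx1).loopIntegral_add (loopRegular_integrand₃₃ _ _ hx0 hx1)
      hc0 hc1 one_pos]
  set p := ((√Real.pi : ℝ) : ℂ)⁻¹
  have hdec : ∀ s : ℂ, σ < s.re → (s.re < 1 ∨ s.im ≠ 0) →
      integrand₃₃ ((1 + k) / 2) ((3 - k) / 2) x s + integrand₃₃ ((1 + -k) / 2) ((3 - -k) / 2) x s =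
      (p * exp (Real.pi * k / 2 * I) / (2 * I) *
          (betaKernel k s * exp (((L : ℂ) + (1 : ℝ) * Real.pi * I) * s)) +
        -(p * exp (-(Real.pi * k / 2 * I)) / (2 * I)) *
          (betaKernel k s * exp (((L : ℂ) + (-1 : ℝ) * Real.pi * I) * s))) +
        -(p * cos (Real.pi * k / 2)) *
          (betaKernel k s * exp ((L : ℂ) * s) / sin (Real.pi * s)) := by
    intro s hs h
    rw [integrand₃₃_add_integrand₃₃ hx0 (by linarith) (by linarith) h]
    have e1 : ((L : ℂ) + (1 : ℝ) * Real.pi * I) * s = L * s + Real.pi * s * I := by push_cast; ring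
    have e2 : ((L : ℂ) + (-1 : ℝ) * Real.pi * I) * s = L * s + -(Real.pi * s * I) := by
      push_cast; ring
    have e3 : (Real.pi : ℂ) * (s + k / 2) * I = Real.pi * s * I + Real.pi * k / 2 * I := by ring
    have e4 : -((Real.pi : ℂ) * (s + k / 2)) * I = -(Real.pi * s * I) + -(Real.pi * k / 2 * I) := by
      ring
    have e5 : sin (Real.pi * (s + k / 2)) =
        (exp (Real.pi * s * I) * exp (Real.pi * k / 2 * I) -
          exp (-(Real.pi * s * I)) * exp (-(Real.pi * k / 2 * I))) / (2 * I) := by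
      rw [← exp_add, ← exp_add, ← e3, ← e4, sin]
      field_simp
      rw [I_sq]; ring
    rw [e1, e2, exp_add, exp_add, e5]
    ring
  rw [loopIntegral_congr hc hc1 one_pos hdec,
    ((hreg1 1).const_mul _ |>.add ((hreg1 (-1)).const_mul _)).loopIntegral_add
      (hreg2.const_mul _) hc hc1 one_pos,
    ((hreg1 1).const_mul _).loopIntegral_add ((hreg1 (-1)).const_mul _) hc hc1 one_pos,
    loopIntegral_const_mul, loopIntegral_const_mul, loopIntegral_const_mul,
    hK 1 (Or.inl rfl), hK (-1) (Or.inr rfl),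
    loopIntegral_betaKernel_div_sin_eq hkc hc0 hc1 one_pos (by rw [hL4]; linarith), hL4,
    setIntegral_comp_sq k hx0, ← kernelIntegral]
  have e6 : sin (k * b) = (exp (Real.pi * k / 2 * I) *
      exp (-((1 : ℝ) * (k * (Real.pi / 2 - b) * I))) - exp (-(Real.pi * k / 2 * I)) *
      exp (-((-1 : ℝ) * (k * (Real.pi / 2 - b) * I)))) / (2 * I) := by
    rw [← exp_add, ← exp_add, sin]
    have e7 : (Real.pi : ℂ) * k / 2 * I + -((1 : ℝ) * (k * (Real.pi / 2 - b) * I)) = k * b * I := by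
      push_cast; ring
    have e8 : -((Real.pi : ℂ) * k / 2 * I) + -((-1 : ℝ) * (k * (Real.pi / 2 - b) * I)) =
        -(k * b) * I := by
      push_cast; ring
    rw [e7, e8]
    field_simp
    rw [I_sq]; ring
  rw [e6, hx]
  push_cast
  ring

/-! ### Euler's integral and the principal branch of ₂F₁(1, a; a+1; ·) -/

/-- Euler's integral `∫₀¹ t^(a-1) / (1 - t u) dt`. -/
noncomputable def eulerIntegral (a u : ℂ) : ℂ :=
  ∫ t : ℝ in Ioo 0 1, (t : ℂ) ^ (a - 1) * (1 - t * u)⁻¹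

theorem one_sub_mul_ne_zero {u : ℂ} (hu : 1 - u ∈ slitPlane) {t : ℝ} (ht0 : 0 ≤ t) (ht1 : t ≤ 1) :
    1 - t * u ≠ 0 := by
  intro h
  have h1 : (t : ℂ) * u = 1 := by linear_combination -h
  have hre := congrArg re h1
  have him := congrArg im h1
  rw [re_ofReal_mul, one_re] at hre
  rw [im_ofReal_mul, one_im] at him
  have ht : t ≠ 0 := by rintro rfl; simp at hre
  have h2 := (mul_eq_zero.1 him).resolve_left ht
  rcases mem_slitPlane_iff.1 hu with h | h
  · rw [sub_re, one_re] at h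
    have := mul_pos (ht0.lt_of_ne' ht) h
    linarith
  · rw [sub_im, one_im, h2] at h; simp at h

theorem integrableOn_cpow_mul {a : ℂ} (ha : 0 < a.re) {g : ℝ → ℂ}
    (hg : ContinuousOn g (Icc 0 1)) :
    IntegrableOn (fun t : ℝ => (t : ℂ) ^ (a - 1) * g t) (Ioo 0 1) := by
  obtain ⟨A, hA⟩ := isCompact_Icc.exists_bound_of_continuousOn hg
  have h1 : IntegrableOn (fun t : ℝ => (t : ℂ) ^ (a - 1)) (Ioo 0 1) := by
    rw [← integrableOn_Ioc_iff_integrableOn_Ioo, ←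
      intervalIntegrable_iff_integrableOn_Ioc_of_le zero_le_one]
    exact intervalIntegral.intervalIntegrable_cpow' (by simpa using ha)
  refine (h1.norm.mul_const A).mono' (h1.aestronglyMeasurable.mul
    ((hg.mono Ioo_subset_Icc_self).aestronglyMeasurable measurableSet_Ioo)) ?_
  filter_upwards [ae_restrict_mem measurableSet_Ioo] with t ht
  rw [norm_mul]
  exact mul_le_mul_of_nonneg_left (hA t (Ioo_subset_Icc_self ht)) (norm_nonneg _)

theorem continuousOn_one_sub_mul_inv {u : ℂ} (hu : 1 - u ∈ slitPlane) :
    ContinuousOn (fun t : ℝ => (1 - t * u)⁻¹) (Icc 0 1) :=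
  ContinuousOn.inv₀ (by fun_prop) fun _ ht => one_sub_mul_ne_zero hu ht.1 ht.2

theorem isOpen_one_sub_mem_slitPlane : IsOpen {z : ℂ | 1 - z ∈ slitPlane} :=
  isOpen_slitPlane.preimage (by fun_prop)

theorem differentiableAt_eulerIntegral {a u₀ : ℂ} (ha : 0 < a.re) (hu : 1 - u₀ ∈ slitPlane) :
    DifferentiableAt ℂ (eulerIntegral a) u₀ := by
  obtain ⟨ε, hε, hball⟩ := Metric.nhds_basis_closedBall.mem_iff.1
    (isOpen_one_sub_mem_slitPlane.mem_nhds hu)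
  have hcont : ContinuousOn (fun p : ℝ × ℂ => (p.1 : ℂ) * ((1 - p.1 * p.2) ^ 2)⁻¹)
      (Icc (0 : ℝ) 1 ×ˢ Metric.closedBall u₀ ε) :=
    ContinuousOn.mul (by fun_prop) (ContinuousOn.inv₀ (by fun_prop) fun p hp =>
      pow_ne_zero 2 (one_sub_mul_ne_zero (hball hp.2) hp.1.1 hp.1.2))
  obtain ⟨A, hA⟩ := (isCompact_Icc.prod (isCompact_closedBall u₀ ε)).exists_bound_of_continuousOn
    hcont
  have h1 := integrableOn_cpow_mul ha (g := fun _ => 1) continuousOn_const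
  have hmeas := h1.aestronglyMeasurable
  simp only [mul_one] at hmeas
  refine (hasDerivAt_integral_of_dominated_loc_of_deriv_le (μ := volume.restrict (Ioo (0 : ℝ) 1))
    (F := fun (u : ℂ) (t : ℝ) => (t : ℂ) ^ (a - 1) * (1 - t * u)⁻¹)
    (F' := fun (u : ℂ) (t : ℝ) => (t : ℂ) ^ (a - 1) * (t * ((1 - t * u) ^ 2)⁻¹))
    (bound := fun t => ‖(t : ℂ) ^ (a - 1) * 1‖ * A)
    (Metric.ball_mem_nhds u₀ hε) ?_ (integrableOn_cpow_mul ha (continuousOn_one_sub_mul_inv hu))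
    (hmeas.mul ?_) ?_ (h1.norm.mul_const A) ?_).2.differentiableAt
  · filter_upwards [Metric.ball_mem_nhds u₀ hε] with u hu'
    exact (integrableOn_cpow_mul ha (continuousOn_one_sub_mul_inv
      (hball (Metric.ball_subset_closedBall hu')))).aestronglyMeasurable
  · refine ContinuousOn.aestronglyMeasurable (fun t ht => ?_) measurableSet_Ioo
    have := one_sub_mul_ne_zero hu ht.1.le ht.2.le
    exact ContinuousAt.continuousWithinAt (ContinuousAt.mul (by fun_prop)
      (ContinuousAt.inv₀ (by fun_prop) (pow_ne_zero 2 this)))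
  · filter_upwards [ae_restrict_mem measurableSet_Ioo] with t ht u hu'
    rw [norm_mul, mul_one]
    exact mul_le_mul_of_nonneg_left (hA (t, u) ⟨Ioo_subset_Icc_self ht,
      Metric.ball_subset_closedBall hu'⟩) (norm_nonneg _)
  · filter_upwards [ae_restrict_mem measurableSet_Ioo] with t ht u hu'
    have h2 := one_sub_mul_ne_zero (hball (Metric.ball_subset_closedBall hu')) ht.1.le ht.2.le
    have h3 : HasDerivAt (fun u : ℂ => 1 - t * u) (-t) u := by
      simpa using ((hasDerivAt_id u).const_mul (t : ℂ)).const_sub 1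
    refine ((h3.fun_inv h2).const_mul _).congr_deriv ?_
    rw [neg_neg, div_eq_mul_inv]

theorem integral_cpow_Ioo {a : ℂ} (ha : 0 < a.re) :
    ∫ t : ℝ in Ioo 0 1, (t : ℂ) ^ (a - 1) = a⁻¹ := by
  have ha0 : a ≠ 0 := by rintro rfl; simp at ha
  rw [← integral_Ioc_eq_integral_Ioo, ← intervalIntegral.integral_of_le zero_le_one,
    integral_cpow (Or.inl (by simpa using ha))]
  simp [ha0]

theorem ascPochhammer_div_succ {a : ℂ} (ha : 0 < a.re) (n : ℕ) :
    (ascPochhammer ℂ n).eval a * ((ascPochhammer ℂ n).eval (a + 1))⁻¹ = a * (a + n)⁻¹ := by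
  have h1 : (ascPochhammer ℂ n).eval a * (a + n) = a * (ascPochhammer ℂ n).eval (a + 1) := by
    rw [← ascPochhammer_succ_eval, ascPochhammer_succ_left]
    simp
  have h2 : (ascPochhammer ℂ n).eval (a + 1) ≠ 0 := by
    rw [Ne, ascPochhammer_eval_eq_zero_iff]
    rintro ⟨m, -, hm⟩
    have := congrArg re hm
    simp at this
    have hm0 : (0 : ℝ) ≤ m := m.cast_nonneg
    linarith
  have h3 : a + n ≠ 0 := by
    intro h
    have := congrArg re h
    simp at this
    have hm0 : (0 : ℝ) ≤ n := n.cast_nonneg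
    linarith
  field_simp
  exact h1

/-- The Pochhammer quotient telescopes to a/(a+n), and 1/(a+n) = ∫₀¹ t^(a+n-1) dt. The geometric
series in tz may be integrated term by term because its terms are dominated by |z|^n. -/
theorem ordinaryHypergeometric_one_eq_eulerIntegral {a z : ℂ} (ha : 0 < a.re) (hz : ‖z‖ < 1) :
    ordinaryHypergeometric 1 a (a + 1) z = a * eulerIntegral a z := by
  have ha0 : ∀ n : ℕ, 0 < (a + n).re := fun n => by
    have hm0 : (0 : ℝ) ≤ n := n.cast_nonneg
    simp; linarith
  have hterm : ∀ n : ℕ, ∀ t ∈ Ioo (0 : ℝ) 1,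
      (t : ℂ) ^ (a + n - 1) * z ^ n = (t : ℂ) ^ (a - 1) * (t * z) ^ n := by
    intro n t ht
    have ht0 : (t : ℂ) ≠ 0 := by exact_mod_cast ht.1.ne'
    rw [show a + n - 1 = a - 1 + n by ring, cpow_add _ _ ht0, cpow_natCast, mul_pow]
    ring
  have hint : ∀ n : ℕ, Integrable (fun t : ℝ => (t : ℂ) ^ (a + n - 1) * z ^ n)
      (volume.restrict (Ioo 0 1)) := fun n => integrableOn_cpow_mul (ha0 n) continuousOn_const
  have hval : ∀ n : ℕ, ∫ t : ℝ in Ioo 0 1, (t : ℂ) ^ (a + n - 1) * z ^ n = (a + n)⁻¹ * z ^ n :=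
    fun n => by rw [integral_mul_const, integral_cpow_Ioo (ha0 n)]
  have h1 := integrableOn_cpow_mul ha (g := fun _ => 1) continuousOn_const
  simp only [mul_one] at h1
  have hsum : Summable fun n : ℕ => ∫ t : ℝ in Ioo 0 1, ‖(t : ℂ) ^ (a + n - 1) * z ^ n‖ := by
    refine Summable.of_nonneg_of_le (fun n => integral_nonneg fun t => norm_nonneg _) (fun n => ?_)
      ((summable_geometric_of_lt_one (norm_nonneg z) hz).mul_left
        (∫ t : ℝ in Ioo 0 1, ‖(t : ℂ) ^ (a - 1)‖))
    rw [← integral_mul_const]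
    refine setIntegral_mono_on (hint n).norm (h1.norm.mul_const _) measurableSet_Ioo fun t ht => ?_
    rw [hterm n t ht, norm_mul, norm_pow, norm_mul, norm_real, Real.norm_of_nonneg ht.1.le]
    have h2 := mul_le_of_le_one_left (norm_nonneg z) ht.2.le
    have h3 : 0 ≤ t * ‖z‖ := mul_nonneg ht.1.le (norm_nonneg z)
    gcongr
  have h := hasSum_integral_of_summable_integral_norm hint hsum
  have e : ∫ t : ℝ in Ioo 0 1, ∑' n : ℕ, (t : ℂ) ^ (a + n - 1) * z ^ n = eulerIntegral a z := by
    refine setIntegral_congr_fun measurableSet_Ioo fun t ht => ?_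
    simp only [hterm _ t ht]
    rw [tsum_mul_left, tsum_geometric_of_norm_lt_one]
    rw [norm_mul, norm_real, Real.norm_of_nonneg ht.1.le]
    nlinarith [norm_nonneg z, ht.1, ht.2]
  rw [e] at h
  rw [ordinaryHypergeometric_eq_tsum, ← h.tsum_eq, ← tsum_mul_left]
  refine tsum_congr fun n => ?_
  rw [hval, ascPochhammer_eval_one, smul_eq_mul, mul_assoc _ ((ascPochhammer ℂ n).eval a),
    ascPochhammer_div_succ ha, inv_mul_cancel₀ (by exact_mod_cast n.factorial_ne_zero)]
  ring

theorem isPrincipalBranch_eulerIntegral {a : ℂ} (ha : 0 < a.re) :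
    IsPrincipalBranch₂F₁ 1 a (a + 1) (fun z => a * eulerIntegral a z) :=
  ⟨DifferentiableOn.analyticOnNhd (fun _ hz =>
    ((differentiableAt_eulerIntegral ha hz).const_mul a).differentiableWithinAt)
    isOpen_one_sub_mem_slitPlane,
    fun _ hz => (ordinaryHypergeometric_one_eq_eulerIntegral ha hz).symm⟩

/-- The identity theorem: the cut plane is a reflected copy of the star-convex slit plane, hence
connected, and both functions equal the Gauss series near 0. -/
theorem IsPrincipalBranch₂F₁.eqOn {a b c : ℂ} {F G : ℂ → ℂ} (hF : IsPrincipalBranch₂F₁ a b c F)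
    (hG : IsPrincipalBranch₂F₁ a b c G) : EqOn F G {z : ℂ | 1 - z ∈ slitPlane} := by
  have hconn : IsPreconnected {z : ℂ | 1 - z ∈ slitPlane} := by
    have h1 : {z : ℂ | 1 - z ∈ slitPlane} = (fun z => 1 - z) '' slitPlane := by
      ext z
      exact ⟨fun h => ⟨1 - z, h, sub_sub_cancel 1 z⟩, by
        rintro ⟨w, hw, rfl⟩; simpa using hw⟩
    rw [h1]
    exact (starConvex_one_slitPlane.isPathConnected
      one_mem_slitPlane).isConnected.isPreconnected.image _ (by fun_prop)
  refine hF.1.eqOn_of_preconnected_of_eventuallyEq hG.1 hconn (z₀ := 0) (by simp) ?_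
  filter_upwards [Metric.ball_mem_nhds (0 : ℂ) one_pos] with z hz
  rw [mem_ball_zero_iff] at hz
  rw [hF.2 z hz, hG.2 z hz]

theorem gauss₂F₁_one_eq {a u : ℂ} (ha : 0 < a.re) (hu : 1 - u ∈ slitPlane) :
    gauss₂F₁ 1 a (a + 1) u = a * eulerIntegral a u := by
  have h : ∃ F : ℂ → ℂ, IsPrincipalBranch₂F₁ 1 a (a + 1) F :=
    ⟨_, isPrincipalBranch_eulerIntegral ha⟩
  rw [gauss₂F₁, dif_pos h]
  exact h.choose_spec.eqOn (isPrincipalBranch_eulerIntegral ha) hu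

theorem conj_eulerIntegral (a u : ℂ) :
    (starRingEnd ℂ) (eulerIntegral ((starRingEnd ℂ) a) u) =
      eulerIntegral a ((starRingEnd ℂ) u) := by
  rw [eulerIntegral, ← integral_conj]
  refine setIntegral_congr_fun measurableSet_Ioo fun t ht => ?_
  have h1 : arg (t : ℂ) ≠ Real.pi := by
    rw [arg_ofReal_of_nonneg ht.1.le]; exact Real.pi_pos.ne
  have h2 : (starRingEnd ℂ) a - 1 = (starRingEnd ℂ) (a - 1) := by simp
  simp only [map_mul, map_inv₀, map_sub, map_one, conj_ofReal]
  rw [h2, cpow_conj _ _ h1]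
  simp

/-! ### The hypergeometric brackets as one real-variable integral -/

/-- The integral `∫₀¹ t^k / (1 - t² u²) dt`. -/
noncomputable def eulerIntegralSq (k u : ℂ) : ℂ :=
  ∫ t : ℝ in Ioo 0 1, (t : ℂ) ^ k * ((1 - t * u) * (1 + t * u))⁻¹

theorem eulerIntegral_add_neg {k u : ℂ} (hk : -1 < k.re) (hu : 1 - u ∈ slitPlane)
    (hu' : 1 + u ∈ slitPlane) :
    eulerIntegral (k + 1) u + eulerIntegral (k + 1) (-u) = 2 * eulerIntegralSq k u := by
  have hk1 : 0 < (k + 1).re := by simp; linarith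
  have hu'' : 1 - -u ∈ slitPlane := by rwa [sub_neg_eq_add]
  rw [eulerIntegral, eulerIntegral, ← integral_add
    (integrableOn_cpow_mul hk1 (continuousOn_one_sub_mul_inv hu))
    (integrableOn_cpow_mul hk1 (continuousOn_one_sub_mul_inv hu'')), eulerIntegralSq,
    ← integral_const_mul]
  refine setIntegral_congr_fun measurableSet_Ioo fun t ht => ?_
  have h1 := one_sub_mul_ne_zero hu ht.1.le ht.2.le
  have h2 := one_sub_mul_ne_zero hu'' ht.1.le ht.2.le
  rw [mul_neg, sub_neg_eq_add] at h2
  simp only [mul_neg, sub_neg_eq_add, add_sub_cancel_right]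
  field_simp
  ring

theorem continuousOn_one_sub_sq_inv {u : ℂ} (hu : 1 - u ∈ slitPlane) (hu' : 1 + u ∈ slitPlane) :
    ContinuousOn (fun t : ℝ => ((1 - t * u) * (1 + t * u))⁻¹) (Icc 0 1) := by
  refine ContinuousOn.inv₀ (by fun_prop) fun t ht => mul_ne_zero
    (one_sub_mul_ne_zero hu ht.1 ht.2) ?_
  have h2 := one_sub_mul_ne_zero (u := -u) (by rwa [sub_neg_eq_add]) ht.1 ht.2
  rwa [mul_neg, sub_neg_eq_add] at h2

theorem integrableOn_eulerIntegralSq {k u : ℂ} (hk : -1 < k.re) (hu : 1 - u ∈ slitPlane)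
    (hu' : 1 + u ∈ slitPlane) :
    IntegrableOn (fun t : ℝ => (t : ℂ) ^ k * ((1 - t * u) * (1 + t * u))⁻¹) (Ioo 0 1) := by
  have := integrableOn_cpow_mul (a := k + 1) (by simp; linarith)
    (continuousOn_one_sub_sq_inv hu hu')
  simpa only [add_sub_cancel_right] using this

/-- The odd part carries t²u²/(1-t²u²) = 1/(1-t²u²) - 1, and the subtracted term integrates to
1/(k+1). -/
theorem eulerIntegral_sub_neg {k u : ℂ} (hk : -1 < k.re) (hu : 1 - u ∈ slitPlane)
    (hu' : 1 + u ∈ slitPlane) :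
    u * (eulerIntegral (k + 2) u - eulerIntegral (k + 2) (-u)) =
      2 * (eulerIntegralSq k u - (k + 1)⁻¹) := by
  have hk1 : 0 < (k + 1).re := by simp; linarith
  have hk2 : 0 < (k + 2).re := by simp; linarith
  have hu'' : 1 - -u ∈ slitPlane := by rwa [sub_neg_eq_add]
  have hM : IntegrableOn (fun t : ℝ => (t : ℂ) ^ k) (Ioo 0 1) := by
    simpa using integrableOn_cpow_mul hk1 (g := fun _ => 1) continuousOn_const
  have hMv : (k + 1)⁻¹ = ∫ t : ℝ in Ioo 0 1, (t : ℂ) ^ k := by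
    rw [← integral_cpow_Ioo hk1, add_sub_cancel_right]
  rw [eulerIntegral, eulerIntegral, ← integral_sub
    (integrableOn_cpow_mul hk2 (continuousOn_one_sub_mul_inv hu))
    (integrableOn_cpow_mul hk2 (continuousOn_one_sub_mul_inv hu'')), eulerIntegralSq, hMv,
    ← integral_sub (integrableOn_eulerIntegralSq hk hu hu') hM, ← integral_const_mul,
    ← integral_const_mul]
  refine setIntegral_congr_fun measurableSet_Ioo fun t ht => ?_
  have h1 := one_sub_mul_ne_zero hu ht.1.le ht.2.le
  have h2 := one_sub_mul_ne_zero hu'' ht.1.le ht.2.le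
  have ht0 : (t : ℂ) ≠ 0 := by exact_mod_cast ht.1.ne'
  rw [mul_neg, sub_neg_eq_add] at h2
  simp only [mul_neg, sub_neg_eq_add]
  rw [show k + 2 - 1 = k + 1 by ring, cpow_add _ _ ht0, cpow_one, mul_inv]
  have hp := mul_inv_cancel₀ h1
  have hq := mul_inv_cancel₀ h2
  generalize (1 - t * u)⁻¹ = p at *
  generalize (1 + t * u)⁻¹ = q at *
  linear_combination (t : ℂ) ^ k * (-hp - hq - p * hq - q * hp)

theorem inv_eq_conj_of_norm_eq_one {v : ℂ} (hv : ‖v‖ = 1) : v⁻¹ = (starRingEnd ℂ) v := by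
  rw [inv_def, normSq_eq_norm_sq, hv]; simp

/-- On the unit circle conjugation exchanges v with v⁻¹ and sends iv to -iv⁻¹. The parametric real
part therefore pairs each Euler integral at u with the one at -u: odd parts in the first bracket,
even parts in the second. The constants 1/(k+1) from the odd parts cancel between v and v⁻¹. -/
theorem reParam_bracket_eq {k v : ℂ} (hk : -1 < k.re) (hv : ‖v‖ = 1) (hre : 0 < v.re) :
    1 / (k + 2) * reParam (bracketA v) k - 1 / (k + 1) * reParam (bracketB v) k =
      I * (v⁻¹ * eulerIntegralSq k (I * v⁻¹) - v * eulerIntegralSq k (I * v)) := by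
  have hinv := inv_eq_conj_of_norm_eq_one hv
  have hconjinv : (starRingEnd ℂ) (v⁻¹) = v := by rw [hinv, conj_conj]
  have hv0 : v ≠ 0 := by rintro rfl; simp at hre
  have hsum : v + v⁻¹ ≠ 0 := by
    intro h
    have := congrArg re h
    rw [hinv, add_re, conj_re, zero_re] at this
    linarith
  have h1 : 0 < (k + 1).re := by simp; linarith
  have h2 : 0 < (k + 2).re := by simp; linarith
  have h1c : 0 < ((starRingEnd ℂ) k + 1).re := by simp; linarith
  have h2c : 0 < ((starRingEnd ℂ) k + 2).re := by simp; linarith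
  have hk1 : k + 1 ≠ 0 := fun h => by rw [h] at h1; simp at h1
  have hk2 : k + 2 ≠ 0 := fun h => by rw [h] at h2; simp at h2
  have hmem : ∀ w : ℂ, w.re ≠ 0 → 1 - I * w ∈ slitPlane ∧ 1 + I * w ∈ slitPlane := by
    intro w hw'
    exact ⟨mem_slitPlane_iff.2 (Or.inr (by simpa using hw')),
      mem_slitPlane_iff.2 (Or.inr (by simpa using hw'))⟩
  obtain ⟨s1, s2⟩ := hmem v hre.ne'
  obtain ⟨s3, s4⟩ := hmem v⁻¹ (by rw [hinv, conj_re]; exact hre.ne')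
  have g : ∀ l u : ℂ, 0 < (l + 2).re → 1 - u ∈ slitPlane →
      gauss₂F₁ 1 (l + 2) (l + 3) u = (l + 2) * eulerIntegral (l + 2) u := by
    intro l u hl hu
    rw [← gauss₂F₁_one_eq hl hu]; congr 1; ring
  have g' : ∀ l u : ℂ, 0 < (l + 1).re → 1 - u ∈ slitPlane →
      gauss₂F₁ 1 (l + 1) (l + 2) u = (l + 1) * eulerIntegral (l + 1) u := by
    intro l u hl hu
    rw [← gauss₂F₁_one_eq hl hu]; congr 1; ring
  have c2 : ∀ u : ℂ, (starRingEnd ℂ) (eulerIntegral ((starRingEnd ℂ) k + 2) u) =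
      eulerIntegral (k + 2) ((starRingEnd ℂ) u) := fun u => by
    rw [← conj_eulerIntegral, map_add, map_ofNat]
  have c1 : ∀ u : ℂ, (starRingEnd ℂ) (eulerIntegral ((starRingEnd ℂ) k + 1) u) =
      eulerIntegral (k + 1) ((starRingEnd ℂ) u) := fun u => by
    rw [← conj_eulerIntegral]; simp
  have d1 : (starRingEnd ℂ) (I * v) = -(I * v⁻¹) := by rw [map_mul, conj_I, hinv, neg_mul]
  have d2 : (starRingEnd ℂ) (I * v⁻¹) = -(I * v) := by rw [map_mul, conj_I, hconjinv, neg_mul]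
  have e1 := eulerIntegral_sub_neg hk s1 s2
  have e2 := eulerIntegral_sub_neg hk s3 s4
  have f1 := eulerIntegral_add_neg hk s1 s2
  have f2 := eulerIntegral_add_neg hk s3 s4
  have hA : 1 / (k + 2) * reParam (bracketA v) k = 2 * I / (v + v⁻¹) *
      (eulerIntegralSq k (I * v⁻¹) - eulerIntegralSq k (I * v)) := by
    rw [reParam, bracketA, bracketA, g _ _ h2 s1, g _ _ h2 s3, g _ _ h2c s1, g _ _ h2c s3]
    simp only [map_sub, map_mul, map_div₀, map_add, c2, d1, d2, hconjinv, ← hinv, conj_conj,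
      map_ofNat]
    have : 1 / (k + 2) * ((2 * v / (v + v⁻¹) * ((k + 2) * eulerIntegral (k + 2) (I * v)) -
        2 * v⁻¹ / (v⁻¹ + v) * ((k + 2) * eulerIntegral (k + 2) (I * v⁻¹)) +
        (2 * v⁻¹ / (v⁻¹ + v) * ((k + 2) * eulerIntegral (k + 2) (-(I * v⁻¹))) -
        2 * v / (v + v⁻¹) * ((k + 2) * eulerIntegral (k + 2) (-(I * v))))) / 2) =
        1 / (v + v⁻¹) * (v * (eulerIntegral (k + 2) (I * v) - eulerIntegral (k + 2) (-(I * v))) -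
          v⁻¹ * (eulerIntegral (k + 2) (I * v⁻¹) - eulerIntegral (k + 2) (-(I * v⁻¹)))) := by
      rw [add_comm v⁻¹ v]
      generalize v + v⁻¹ = S at hsum ⊢
      generalize v⁻¹ = w
      field_simp
      ring
    rw [this]
    linear_combination (1 / (v + v⁻¹)) * (-I * e1 + I * e2) + (1 / (v + v⁻¹)) *
      (v⁻¹ * (eulerIntegral (k + 2) (I * v⁻¹) - eulerIntegral (k + 2) (-(I * v⁻¹))) -
       v * (eulerIntegral (k + 2) (I * v) - eulerIntegral (k + 2) (-(I * v)))) * (-I_mul_I)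
  have hB : 1 / (k + 1) * reParam (bracketB v) k = -I / (v + v⁻¹) *
      ((v⁻¹ ^ 2 - 1) * eulerIntegralSq k (I * v⁻¹) -
        (v ^ 2 - 1) * eulerIntegralSq k (I * v)) := by
    rw [reParam, bracketB, bracketB, g' _ _ h1 s1, g' _ _ h1 s3, g' _ _ h1c s1, g' _ _ h1c s3]
    simp only [map_sub, map_mul, map_div₀, map_add, map_pow, map_one, c1, d1, d2, hconjinv,
      ← hinv, conj_conj, conj_I]
    rw [add_comm v⁻¹ v]
    have hI : I ≠ 0 := I_ne_zero
    generalize v + v⁻¹ = S at hsum ⊢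
    generalize v⁻¹ = w at *
    have : 1 / (k + 1) * (((w ^ 2 - 1) / (I * S) * ((k + 1) * eulerIntegral (k + 1) (I * w)) -
        (v ^ 2 - 1) / (I * S) * ((k + 1) * eulerIntegral (k + 1) (I * v)) +
        ((v ^ 2 - 1) / (-I * S) * ((k + 1) * eulerIntegral (k + 1) (-(I * v))) -
        (w ^ 2 - 1) / (-I * S) * ((k + 1) * eulerIntegral (k + 1) (-(I * w))))) / 2) =
        1 / (2 * I * S) * ((w ^ 2 - 1) *
          (eulerIntegral (k + 1) (I * w) + eulerIntegral (k + 1) (-(I * w))) -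
          (v ^ 2 - 1) * (eulerIntegral (k + 1) (I * v) + eulerIntegral (k + 1) (-(I * v)))) := by
      field_simp
      ring
    rw [this, f1, f2]
    field_simp
    rw [I_sq]
    ring
  rw [hA, hB]
  have hvv : v * v⁻¹ = 1 := mul_inv_cancel₀ hv0
  generalize v⁻¹ = w at *
  field_simp
  linear_combination (eulerIntegralSq k (I * v) - eulerIntegralSq k (I * w)) * hvv

/-- The two denominators are 1 + t²v² and 1 + t²v⁻². Their product is (1-t²)² + 4xt², because v² +
v⁻² = 4x - 2. -/
theorem eulerIntegralSq_sub_eq_kernelIntegral {k v : ℂ} {x : ℝ} (hk : -1 < k.re) (hv : ‖v‖ = 1)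
    (hre : 0 < v.re) (hx : (v + v⁻¹) ^ 2 = 4 * x) :
    v⁻¹ * eulerIntegralSq k (I * v⁻¹) - v * eulerIntegralSq k (I * v) =
      -(v - v⁻¹) * kernelIntegral k x := by
  have hv0 : v ≠ 0 := by rintro rfl; simp at hre
  have hinv := inv_eq_conj_of_norm_eq_one hv
  have hmem : ∀ w : ℂ, w.re ≠ 0 → 1 - I * w ∈ slitPlane ∧ 1 + I * w ∈ slitPlane := by
    intro w hw'
    exact ⟨mem_slitPlane_iff.2 (Or.inr (by simpa using hw')),
      mem_slitPlane_iff.2 (Or.inr (by simpa using hw'))⟩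
  obtain ⟨s1, s2⟩ := hmem v hre.ne'
  obtain ⟨s3, s4⟩ := hmem v⁻¹ (by rw [hinv, conj_re]; exact hre.ne')
  rw [eulerIntegralSq, eulerIntegralSq, kernelIntegral, ← integral_const_mul,
    ← integral_const_mul, ← integral_const_mul,
    ← integral_sub ((integrableOn_eulerIntegralSq hk s3 s4).const_mul _)
      ((integrableOn_eulerIntegralSq hk s1 s2).const_mul _)]
  refine setIntegral_congr_fun measurableSet_Ioo fun t ht => ?_
  have n1 : ∀ u : ℂ, 1 - u ∈ slitPlane → 1 + u ∈ slitPlane → (1 - t * u) * (1 + t * u) ≠ 0 := by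
    intro u h1 h2
    refine mul_ne_zero (one_sub_mul_ne_zero h1 ht.1.le ht.2.le) ?_
    have h3 := one_sub_mul_ne_zero (u := -u) (by rwa [sub_neg_eq_add]) ht.1.le ht.2.le
    rwa [mul_neg, sub_neg_eq_add] at h3
  have hvv : v * v⁻¹ = 1 := mul_inv_cancel₀ hv0
  have m1 := n1 _ s1 s2
  have m2 := n1 _ s3 s4
  have q1 : (1 - t * (I * v)) * (1 + t * (I * v)) = 1 + t ^ 2 * v ^ 2 := by
    linear_combination -(t : ℂ) ^ 2 * v ^ 2 * I_sq
  have q2 : (1 - t * (I * v⁻¹)) * (1 + t * (I * v⁻¹)) = 1 + t ^ 2 * v⁻¹ ^ 2 := by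
    linear_combination -(t : ℂ) ^ 2 * v⁻¹ ^ 2 * I_sq
  rw [q1] at m1
  rw [q2] at m2
  have q3 : (((1 - t ^ 2) ^ 2 + 4 * x * t ^ 2 : ℝ) : ℂ) =
      (1 + t ^ 2 * v ^ 2) * (1 + t ^ 2 * v⁻¹ ^ 2) := by
    push_cast
    linear_combination -(t : ℂ) ^ 2 * hx + (2 * (t : ℂ) ^ 2 - t ^ 4 * (v * v⁻¹ + 1)) * hvv
  rw [q1, q2, ofReal_div, q3]
  generalize v⁻¹ = w at *
  have q4 : w * (1 + t ^ 2 * v ^ 2) - v * (1 + t ^ 2 * w ^ 2) = -(v - w) * (1 - (t : ℂ) ^ 2) := by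
    linear_combination (t : ℂ) ^ 2 * (v - w) * hvv
  push_cast
  generalize (1 : ℂ) + t ^ 2 * v ^ 2 = M₁ at *
  generalize (1 : ℂ) + t ^ 2 * w ^ 2 = M₂ at *
  field_simp
  linear_combination (t : ℂ) ^ k * q4

/-! ### Assembly on the unit circle -/

theorem exists_angle {v : ℂ} (hv : ‖v‖ = 1) (hre : 0 < v.re) (hv1 : v ≠ 1) :
    ∃ θ : ℝ, θ ≠ 0 ∧ |θ| < Real.pi / 2 ∧ v = exp (θ * I) := by
  have h : v = exp (arg v * I) := by
    have := norm_mul_exp_arg_mul_I v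
    rw [hv, ofReal_one, one_mul] at this
    exact this.symm
  refine ⟨arg v, fun h0 => hv1 ?_, abs_arg_lt_pi_div_two_iff.2 (Or.inl hre), h⟩
  rw [h, h0]; simp

theorem add_inv_exp_mul_I (θ : ℝ) : exp (θ * I) + (exp (θ * I))⁻¹ = 2 * Real.cos θ := by
  rw [← exp_neg, ← neg_mul, ofReal_cos, cos]; ring

theorem sub_inv_exp_mul_I (θ : ℝ) : exp (θ * I) - (exp (θ * I))⁻¹ = 2 * Real.sin θ * I := by
  rw [← exp_neg, ← neg_mul, ofReal_sin, sin]
  linear_combination (exp (θ * I) - exp (-θ * I)) * I_mul_I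

theorem meijerG_add_meijerG_eq_bracket {k v : ℂ} (hk : -1 < k.re) (hv : ‖v‖ = 1) (hre : 0 < v.re)
    (hv1 : v ≠ 1) :
    meijerG 2 1 (upperParams k) lowerParams ((v + v⁻¹) ^ 2 / 4) +
      meijerG 2 1 (upperParams (-k)) lowerParams ((v + v⁻¹) ^ 2 / 4) =
    (v + v⁻¹) ^ 2 / (I * (Real.sqrt Real.pi : ℂ) * (v - v⁻¹)) *
      (2 / (Real.pi : ℂ) * Complex.cos ((Real.pi : ℂ) * k / 2) *
          (1 / (k + 2) * reParam (bracketA v) k - 1 / (k + 1) * reParam (bracketB v) k) -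
        I / 2 * (v ^ k - v ^ (-k))) := by
  obtain ⟨θ, hθ0, hθ, rfl⟩ := exists_angle hv hre hv1
  have hb0 : 0 < |θ| := abs_pos.2 hθ0
  have hcos : 0 < Real.cos θ := by
    rw [← Real.cos_abs]; exact Real.cos_pos_of_mem_Ioo ⟨by linarith, hθ⟩
  have hx : (exp (θ * I) + (exp (θ * I))⁻¹) ^ 2 = 4 * ((Real.cos θ ^ 2 : ℝ) : ℂ) := by
    rw [add_inv_exp_mul_I]; push_cast; ring
  have hsinC : (Real.sin θ : ℂ) ≠ 0 := by
    rcases abs_choice θ with h | h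
    · have := Real.sin_pos_of_pos_of_lt_pi hb0 (by linarith [Real.pi_pos])
      rw [h] at this; exact_mod_cast this.ne'
    · have := Real.sin_pos_of_pos_of_lt_pi hb0 (by linarith [Real.pi_pos])
      rw [h, Real.sin_neg] at this
      exact_mod_cast (by linarith : Real.sin θ < 0).ne
  -- The evaluation is available for positive angles only; this expression is even in θ, so |θ| may
  -- be used.
  have hratio : 2 * (Real.cos |θ| : ℂ) ^ 2 / Real.sin |θ| * sin (k * |θ|) =
      2 * (Real.cos θ : ℂ) ^ 2 / Real.sin θ * sin (k * θ) := by
    rw [Real.cos_abs]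
    rcases abs_choice θ with h | h
    · rw [h]
    · rw [h, Real.sin_neg, ofReal_neg, ofReal_neg, mul_neg, sin_neg, div_neg]; ring
  have hlog : log (exp (θ * I)) = θ * I := by
    have := abs_lt.1 hθ
    rw [log_exp] <;> simp <;> linarith
  have hpow : exp (θ * I) ^ k - exp (θ * I) ^ (-k) = 2 * I * sin (k * θ) := by
    rw [cpow_def_of_ne_zero (exp_ne_zero _), cpow_def_of_ne_zero (exp_ne_zero _), hlog, sin,
      show (θ : ℂ) * I * k = k * θ * I by ring, show (θ : ℂ) * I * -k = -(k * θ) * I by ring]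
    linear_combination (exp (-(k * θ) * I) - exp (k * θ * I)) * (-I_mul_I)
  have hpi : (Real.pi : ℂ) ≠ 0 := by exact_mod_cast Real.pi_ne_zero
  have hp : ((√Real.pi : ℝ) : ℂ) ≠ 0 := by
    exact_mod_cast (Real.sqrt_pos.2 Real.pi_pos).ne'
  rw [reParam_bracket_eq hk hv hre, eulerIntegralSq_sub_eq_kernelIntegral hk hv hre hx, hpow, hx,
    mul_div_cancel_left₀ _ (by norm_num : (4 : ℂ) ≠ 0), sub_inv_exp_mul_I]
  have hmain := meijerG_add_meijerG hk hb0 hθ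
  rw [hratio, Real.cos_abs] at hmain
  rw [hmain]
  push_cast
  have hsinC' : sin (θ : ℂ) ≠ 0 := by rwa [← ofReal_sin]
  field_simp
  ring

/-! ### The case k = 0 -/

/-- For x = 1 - y² the denominator factors as (1+t²+2yt)(1+t²-2yt), and the integrand is a
logarithmic derivative of the quotient of the factors. -/
theorem kernelIntegral_zero {x y : ℝ} (hy0 : y ≠ 0) (hy : |y| < 1) (hx : x = 1 - y ^ 2) :
    kernelIntegral 0 x = ((1 / (4 * y) * (Real.log (1 + y) - Real.log (1 - y)) : ℝ) : ℂ) := by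
  obtain ⟨hy1, hy2⟩ := abs_lt.1 hy
  have hp : ∀ t : ℝ, 0 < 1 + t ^ 2 + 2 * y * t := fun t => by nlinarith [sq_nonneg (t + y)]
  have hm : ∀ t : ℝ, 0 < 1 + t ^ 2 - 2 * y * t := fun t => by nlinarith [sq_nonneg (t - y)]
  have hden : ∀ t : ℝ, (1 - t ^ 2) ^ 2 + 4 * x * t ^ 2 =
      (1 + t ^ 2 + 2 * y * t) * (1 + t ^ 2 - 2 * y * t) := fun t => by rw [hx]; ring
  have hd : ∀ t : ℝ, HasDerivAt (fun t : ℝ => 1 / (4 * y) *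
      (Real.log (1 + t ^ 2 + 2 * y * t) - Real.log (1 + t ^ 2 - 2 * y * t)))
      ((1 - t ^ 2) / ((1 - t ^ 2) ^ 2 + 4 * x * t ^ 2)) t := by
    intro t
    have h1 : HasDerivAt (fun t : ℝ => 1 + t ^ 2 + 2 * y * t) (2 * t + 2 * y) t := by
      simpa using ((hasDerivAt_pow 2 t).const_add 1).fun_add ((hasDerivAt_id' t).const_mul (2 * y))
    have h2 : HasDerivAt (fun t : ℝ => 1 + t ^ 2 - 2 * y * t) (2 * t - 2 * y) t := by
      simpa using ((hasDerivAt_pow 2 t).const_add 1).fun_sub ((hasDerivAt_id' t).const_mul (2 * y))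
    refine (((h1.log (hp t).ne').fun_sub (h2.log (hm t).ne')).const_mul _).congr_deriv ?_
    rw [hden, div_sub_div _ _ (hp t).ne' (hm t).ne', ← mul_div_assoc]
    congr 1
    field_simp
    ring
  have hint : IntervalIntegrable (fun t : ℝ => (1 - t ^ 2) / ((1 - t ^ 2) ^ 2 + 4 * x * t ^ 2))
      volume 0 1 := by
    refine Continuous.intervalIntegrable (Continuous.div (by fun_prop) (by fun_prop) fun t => ?_) _ _
    rw [hden]; exact (mul_pos (hp t) (hm t)).ne'
  have h := intervalIntegral.integral_eq_sub_of_hasDerivAt (fun t _ => hd t) hint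
  have e : kernelIntegral 0 x =
      ((∫ t : ℝ in 0..1, (1 - t ^ 2) / ((1 - t ^ 2) ^ 2 + 4 * x * t ^ 2) : ℝ) : ℂ) := by
    rw [kernelIntegral, intervalIntegral.integral_of_le zero_le_one, integral_Ioc_eq_integral_Ioo]
    simp only [cpow_zero, one_mul]
    exact integral_ofReal
  rw [e, h]
  congr 1
  have e1 : (1 : ℝ) + 1 ^ 2 + 2 * y * 1 = 2 * (1 + y) := by ring
  have e2 : (1 : ℝ) + 1 ^ 2 - 2 * y * 1 = 2 * (1 - y) := by ring
  rw [e1, e2, Real.log_mul two_ne_zero (by linarith), Real.log_mul two_ne_zero (by linarith)]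
  simp

theorem meijerG_zero_eq {b : ℝ} (hs : Real.sin b ≠ 0) (hc : Real.cos b ≠ 0) :
    meijerG 2 1 (upperParams 0) lowerParams ((Real.cos b ^ 2 : ℝ) : ℂ) =
      ((2 / Real.pi ^ (3 / 2 : ℝ) * Real.cos b * Real.cot b *
        Real.log |Real.cos b / (1 + Real.sin b)| : ℝ) : ℂ) := by
  have hsq := Real.sin_sq_add_cos_sq b
  have hc2 : 0 < Real.cos b ^ 2 := by positivity
  have hs2 : 0 < Real.sin b ^ 2 := by positivity
  have hs1 : |Real.sin b| < 1 := by rw [← sq_lt_one_iff_abs_lt_one]; linarith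
  obtain ⟨h1, h2⟩ := abs_lt.1 hs1
  -- The angle arcsin |sin b| lies in (0, π/2) and has the same squared cosine as b, which reduces
  -- arbitrary b to the range already treated.
  have hβ0 : 0 < Real.arcsin |Real.sin b| := Real.arcsin_pos.2 (abs_pos.2 hs)
  have hβ1 : Real.arcsin |Real.sin b| < Real.pi / 2 := Real.arcsin_lt_pi_div_two.2 hs1
  have hβc : Real.cos (Real.arcsin |Real.sin b|) ^ 2 = Real.cos b ^ 2 := by
    rw [Real.cos_arcsin, sq_abs, Real.sq_sqrt (by linarith)]; linarith
  have h := meijerG_add_meijerG (k := 0) (by simp) hβ0 hβ1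
  rw [neg_zero, zero_mul, sin_zero, mul_zero, mul_zero, zero_div, cos_zero, ← ofReal_pow, hβc,
    kernelIntegral_zero hs hs1 (by linarith)] at h
  have hlog : Real.log |Real.cos b / (1 + Real.sin b)| =
      -(Real.log (1 + Real.sin b) - Real.log (1 - Real.sin b)) / 2 := by
    have e1 : Real.cos b ^ 2 = (1 + Real.sin b) * (1 - Real.sin b) := by linear_combination hsq
    have e2 := congrArg Real.log e1
    rw [Real.log_pow, Real.log_mul (by linarith) (by linarith)] at e2
    push_cast at e2
    rw [Real.log_abs, Real.log_div hc (by linarith)]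
    linarith
  have hpi : Real.pi ^ (3 / 2 : ℝ) = Real.pi * √Real.pi := by
    rw [show (3 / 2 : ℝ) = 1 + 1 / 2 by norm_num, Real.rpow_add Real.pi_pos, Real.rpow_one,
      ← Real.sqrt_eq_rpow]
  have hpi0 : (Real.pi : ℂ) ≠ 0 := by exact_mod_cast Real.pi_ne_zero
  have hp : ((√Real.pi : ℝ) : ℂ) ≠ 0 := by
    exact_mod_cast (Real.sqrt_pos.2 Real.pi_pos).ne'
  have hsC : (Real.sin b : ℂ) ≠ 0 := by exact_mod_cast hs
  -- At k = 0 the two G-functions coincide and the sine term vanishes, so the value is half of the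
  -- evaluated sum.
  have h3 : meijerG 2 1 (upperParams 0) lowerParams ((Real.cos b ^ 2 : ℝ) : ℂ) =
      -((√Real.pi : ℝ) : ℂ)⁻¹ * ((Real.pi : ℂ)⁻¹ * (4 * ((Real.cos b ^ 2 : ℝ) : ℂ) *
      ((1 / (4 * Real.sin b) * (Real.log (1 + Real.sin b) - Real.log (1 - Real.sin b)) : ℝ) : ℂ))) :=
    by linear_combination h / 2
  rw [h3, hlog, hpi, Real.cot_eq_cos_div_sin]
  generalize Real.log (1 + Real.sin b) = l₁
  generalize Real.log (1 - Real.sin b) = l₂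
  simp only [ofReal_mul, ofReal_div, ofReal_sub, ofReal_neg, ofReal_pow, ofReal_one, ofReal_ofNat]
  field_simp

theorem upperParams_zero : upperParams 0 = ![1, 1 / 2, 3 / 2] := by simp [upperParams]

theorem exists_ofReal_eq_sq {v : ℂ} (hv : ‖v‖ = 1) (hre : 0 < v.re) (hv1 : v ≠ 1) :
    ∃ x : ℝ, 0 < x ∧ x < 1 ∧ (v + v⁻¹) ^ 2 / 4 = x := by
  have h1 : v.re ^ 2 + v.im ^ 2 = 1 := by
    have := normSq_eq_norm_sq v
    rw [hv, normSq_apply] at this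
    linarith
  refine ⟨v.re ^ 2, by positivity, ?_, ?_⟩
  · have him : v.im ≠ 0 := by
      intro h
      rw [h] at h1
      exact hv1 (Complex.ext (by rw [one_re]; nlinarith) (by rw [h, one_im]))
    have : 0 < v.im ^ 2 := by positivity
    linarith
  · rw [inv_eq_conj_of_norm_eq_one hv, add_conj]; push_cast; ring

theorem reParam_ofReal (f : ℂ → ℂ) (k : ℝ) : reParam f k = ((f k).re : ℂ) := by
  rw [reParam, conj_ofReal, add_conj]; push_cast; ring

theorem mainTheorem9 :
    (∀ k v : ℂ, -1 < k.re → ‖v‖ = 1 → 0 < v.re → v ≠ 1 →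
      MeijerGConverges 2 1 (upperParams k) lowerParams ((v + v⁻¹) ^ 2 / 4) ∧
      MeijerGConverges 2 1 (upperParams (-k)) lowerParams ((v + v⁻¹) ^ 2 / 4) ∧
      meijerG 2 1 (upperParams k) lowerParams ((v + v⁻¹) ^ 2 / 4) +
          meijerG 2 1 (upperParams (-k)) lowerParams ((v + v⁻¹) ^ 2 / 4) =
        (v + v⁻¹) ^ 2 / (I * (Real.sqrt Real.pi : ℂ) * (v - v⁻¹)) *
          (2 / (Real.pi : ℂ) * Complex.cos ((Real.pi : ℂ) * k / 2) *
              (1 / (k + 2) * reParam (bracketA v) k - 1 / (k + 1) * reParam (bracketB v) k) -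
            I / 2 * (v ^ k - v ^ (-k)))) ∧
    (∀ (k : ℝ) (v : ℂ), -1 < k → ‖v‖ = 1 → 0 < v.re → v ≠ 1 →
      meijerG 2 1 (upperParams k) lowerParams ((v + v⁻¹) ^ 2 / 4) +
          meijerG 2 1 (upperParams (-k)) lowerParams ((v + v⁻¹) ^ 2 / 4) =
        (v + v⁻¹) ^ 2 / (I * (Real.sqrt Real.pi : ℂ) * (v - v⁻¹)) *
          (2 / (Real.pi : ℂ) * Complex.cos ((Real.pi : ℂ) * k / 2) *
              (1 / ((k : ℂ) + 2) * ((bracketA v k).re : ℂ) -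
                1 / ((k : ℂ) + 1) * ((bracketB v k).re : ℂ)) -
            I / 2 * (v ^ (k : ℂ) - v ^ (-(k : ℂ))))) ∧
    (∀ b : ℝ, Real.sin b ≠ 0 → Real.cos b ≠ 0 →
      MeijerGConverges 2 1 ![1, 1 / 2, 3 / 2] ![1, 1, 1 / 2] ((Real.cos b ^ 2 : ℝ) : ℂ) ∧
      meijerG 2 1 ![1, 1 / 2, 3 / 2] ![1, 1, 1 / 2] ((Real.cos b ^ 2 : ℝ) : ℂ) =
        ((2 / Real.pi ^ (3 / 2 : ℝ) * Real.cos b * Real.cot b *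
          Real.log |Real.cos b / (1 + Real.sin b)| : ℝ) : ℂ)) := by
  refine ⟨fun k v hk hv hre hv1 => ?_, fun k v hk hv hre hv1 => ?_, fun b hs hc => ?_⟩
  · obtain ⟨x, hx0, hx1, hx⟩ := exists_ofReal_eq_sq hv hre hv1
    refine ⟨?_, ?_, meijerG_add_meijerG_eq_bracket hk hv hre hv1⟩
    · rw [hx]; exact meijerGConverges₃₃ _ _ hx0 hx1
    · rw [hx]; exact meijerGConverges₃₃ _ _ hx0 hx1
  · have h := meijerG_add_meijerG_eq_bracket (k := (k : ℂ)) (by simpa using hk) hv hre hv1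
    rwa [reParam_ofReal, reParam_ofReal] at h
  · rw [← upperParams_zero]
    refine ⟨?_, meijerG_zero_eq hs hc⟩
    have hsq := Real.sin_sq_add_cos_sq b
    have hs2 : 0 < Real.sin b ^ 2 := by positivity
    exact meijerGConverges₃₃ _ _ (by positivity) (by linarith)
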